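/- Let $n\ge 1$, let $D=\prod_{i=1}^n(l_i,h_i)\subset\mathbb R^n$ ($l_i<h_i$) be an open bounded rectangle, and let $V=H^1_0(D;\mathbb R)$ with $\|v\|_V^2=\|v\|_{L^2(D)}^2+\|\nabla v\|_{L^2(D)}^2$, $V'=H^{-1}(D;\mathbb R)$ its continuous dual with the dual norm, and $H=L^2(D;\mathbb R)$. For a probability space $(\Omega,\mathcal F,\mathbb P)$ with $L^2_{\mathbb P}(\Omega;\mathbb R)$ separable put $V_{\mathbb P}=L^2_{\mathbb P}(\Omega;V)$, $V'_{\mathbb P}=L^2_{\mathbb P}(\Omega;V')$, $H_{\mathbb P}=L^2_{\mathbb P}(\Omega;H)$, $\langle g,v\rangle_{V'_{\mathbb P},V_{\mathbb P}}=\mathbb E[\langle g,v\rangle_{V',V}]$, and $$W_{\mathbb P}(s_1,s_2)=\{v\in L^2((s_1,s_2);V_{\mathbb P}):\ \partial_t v\in L^2((s_1,s_2);V'_{\mathbb P})\},\qquad \|v\|_{W_{\mathbb P}}^2=\|v\|^2_{L^2(V_{\mathbb P})}+\|\partial_t v\|^2_{L^2(V'_{\mathbb P})},$$ where $\partial_t$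 is the distributional derivative via $V_{\mathbb P}\hookrightarrow H_{\mathbb P}\hookrightarrow V'_{\mathbb P}$; elements of $W_{\mathbb P}(s_1,s_2)$ are identified with their representatives in $C([s_1,s_2];H_{\mathbb P})$. Let $T>0$ and $0<\underline\nu\le\overline\nu<\infty$. Let $\nu$ be a jointly measurable random field for which there are random variables $\nu_{\min},\nu_{\max}$ with $\underline\nu\le\nu_{\min}(\omega)\le\nu(\omega,x)\le\nu_{\max}(\omega)\le\overline\nu$ for a.e. $x\in D$, almost surely. Let $$a\in L^\infty((0,\infty);L^r(D;\mathbb R)),\ n\le r\le\infty,\qquad b\in L^\infty((0,\infty)\times D;\mathbb R^n),\qquad \mathcal N(a,b)=\|a\|_{L^\infty((0,\infty);L^r(D))}+\|b\|_{L^\infty((0,\infty)\times D)}.\tag{RA}$$ For $t_0\ge0$, $y_0\in H_{\mathbb P}$ and $f\in L^2((t_0,t_0+T);V'_{\mathbb P})$, a weak solution of $$\partial_t y-\nabla\cdot(\nu\nabla y)+a\,y+\nabla\cdot(b\,y)=f\ \text{ in }(t_0,t_0+T)\times D,\qquad y=0\ \text{ on }(t_0,t_0+T)\times\partial D,\qquad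 y(t_0)=y_0,$$ is a $y\in W_{\mathbb P}(t_0,t_0+T)$ with $y(t_0)=y_0$ in $H_{\mathbb P}$ and, for all $\varphi\in L^2((t_0,t_0+T);V_{\mathbb P})$, $$\int_{t_0}^{t_0+T}\Big(\langle\partial_t y,\varphi\rangle_{V'_{\mathbb P},V_{\mathbb P}}+\mathbb E\int_D\nu\nabla y\cdot\nabla\varphi\,dx+\mathbb E\int_D a\,y\,\varphi\,dx-\mathbb E\int_D y\,b\cdot\nabla\varphi\,dx\Big)dt=\int_{t_0}^{t_0+T}\langle f,\varphi\rangle_{V'_{\mathbb P},V_{\mathbb P}}\,dt .$$ Then there are a constant $c_2>0$ depending only on $(T,\overline\nu,\underline\nu,D)$ and a constant $c_1>0$ depending only on $(T,\overline\nu,\underline\nu,a,b,D)$ (with $a$ regarded as an element of the space in (RA)) such that for all such $(\Omega,\mathcal F,\mathbb P)$, $\nu$, $t_0$, $y_0$, $f$ there is exactly one weak solution $y\in W_{\mathbb P}(t_0,t_0+T)$, and it satisfies $$\|y\|^2_{C([t_0,t_0+T];H_{\mathbb P})}+\|y\|^2_{W_{\mathbb P}(t_0,t_0+T)}\le c_1\big(\|y_0\|^2_{H_{\mathbb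 P}}+\|f\|^2_{L^2((t_0,t_0+T);V'_{\mathbb P})}\big)$$ and $$\|y_0\|^2_{H_{\mathbb P}}\le c_2\big(1+T^{-1}+\mathcal N(a,b)\big)\|y\|^2_{L^2((t_0,t_0+T);V_{\mathbb P})}+\|f\|^2_{L^2((t_0,t_0+T);V'_{\mathbb P})}.$$ -/

import Mathlib

open MeasureTheory Set
open scoped ENNReal InnerProductSpace

noncomputable section

namespace RandomParabolic

/-! ### Spatial spaces -/

/-- Euclidean space `ℝⁿ`. -/
abbrev Eu (n : ℕ) : Type := EuclideanSpace ℝ (Fin n)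

/-- The open rectangle `∏ᵢ (loᵢ, hiᵢ)` in `ℝⁿ`. -/
def box {n : ℕ} (lo hi : Fin n → ℝ) : Set (Eu n) :=
  {x | ∀ i, x i ∈ Ioo (lo i) (hi i)}

/-- `H = L²(D; ℝ)`. -/
abbrev HD {n : ℕ} (D : Set (Eu n)) : Type := Lp ℝ 2 (volume.restrict D)

/-- `L²(D; ℝⁿ)`, the space in which gradients live. -/
abbrev GD {n : ℕ} (D : Set (Eu n)) : Type := Lp (Eu n) 2 (volume.restrict D)

/-- The pairs `(φ, ∇φ)` in `L²(D) × L²(D; ℝⁿ)` with `φ` a smooth function that is compactly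
supported in `D`. The ambient product carries the norm `(‖u‖² + ‖∇u‖²)^(1/2)`. -/
def testPairs {n : ℕ} (D : Set (Eu n)) : Submodule ℝ (WithLp 2 (HD D × GD D)) where
  carrier := {p | ∃ φ : Eu n → ℝ, ContDiff ℝ ((⊤ : ℕ∞) : WithTop ℕ∞) φ ∧ HasCompactSupport φ ∧ tsupport φ ⊆ D ∧
    p.fst =ᵐ[volume.restrict D] φ ∧ p.snd =ᵐ[volume.restrict D] gradient φ}
  zero_mem' := by
    refine ⟨0, contDiff_const, HasCompactSupport.zero, by simp [tsupport], ?_, ?_⟩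
    · exact Lp.coeFn_zero _ _ _
    · refine (Lp.coeFn_zero _ _ _).trans (Filter.Eventually.of_forall fun x => ?_)
      simp [gradient, Pi.zero_def]
  add_mem' := by
    rintro p q ⟨φ, hφ, cφ, sφ, p1, p2⟩ ⟨ψ, hψ, cψ, sψ, q1, q2⟩
    refine ⟨φ + ψ, hφ.add hψ, cφ.add cψ, (tsupport_add φ ψ).trans (union_subset sφ sψ), ?_, ?_⟩
    · exact (Lp.coeFn_add _ _).trans (p1.add q1)
    · refine (Lp.coeFn_add p.snd q.snd).trans ((p2.add q2).trans
        (Filter.Eventually.of_forall fun x => ?_))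
      have h1 : DifferentiableAt ℝ φ x := (hφ.differentiable (by simp)) x
      have h2 : DifferentiableAt ℝ ψ x := (hψ.differentiable (by simp)) x
      simp [gradient, fderiv_add h1 h2]
  smul_mem' := by
    rintro c p ⟨φ, hφ, cφ, sφ, p1, p2⟩
    refine ⟨c • φ, hφ.const_smul c, cφ.smul_left (f := fun _ => c),
      (tsupport_smul_subset_right (fun _ => c) φ).trans sφ, ?_, ?_⟩
    · exact (Lp.coeFn_smul c _).trans (p1.const_smul c)
    · refine (Lp.coeFn_smul c p.snd).trans ((p2.const_smul c).trans
        (Filter.Eventually.of_forall fun x => ?_))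
      have h1 : DifferentiableAt ℝ φ x := (hφ.differentiable (by simp)) x
      simp [gradient, fderiv_const_smul h1]

/-- `V = H¹₀(D; ℝ)`: the closure of the test functions in `H¹(D)`, an element being recorded
as the pair `(u, ∇u)`; it is a Hilbert space with `‖u‖² = ‖u‖²_{L²} + ‖∇u‖²_{L²}`. -/
abbrev H10 {n : ℕ} (D : Set (Eu n)) : Submodule ℝ (WithLp 2 (HD D × GD D)) :=
  (testPairs D).topologicalClosure

/-- `V = H¹₀(D; ℝ)` as a type. -/
abbrev VD {n : ℕ} (D : Set (Eu n)) : Type := ↥(H10 D)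

/-- `V' = H⁻¹(D; ℝ)`, the continuous dual of `V` with the dual norm. -/
abbrev VDdual {n : ℕ} (D : Set (Eu n)) : Type := StrongDual ℝ (VD D)

/-- The inclusion `V ↪ H`. -/
def toH {n : ℕ} (D : Set (Eu n)) : VD D →L[ℝ] HD D :=
  (WithLp.fstL 2 ℝ (HD D) (GD D)).comp (H10 D).subtypeL

/-- The weak gradient `V → L²(D; ℝⁿ)`. -/
def grad {n : ℕ} (D : Set (Eu n)) : VD D →L[ℝ] GD D :=
  (WithLp.sndL 2 ℝ (HD D) (GD D)).comp (H10 D).subtypeL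

/-- The inclusion `V ↪ H ≅ H' ↪ V'`, i.e. `u ↦ (w ↦ (u, w)_H)`. -/
def toDual {n : ℕ} (D : Set (Eu n)) : VD D →L[ℝ] VDdual D :=
  (ContinuousLinearMap.precomp ℝ (toH D)).comp
    ((innerSL ℝ : HD D →L[ℝ] HD D →L[ℝ] ℝ).comp (toH D))

theorem toDual_apply {n : ℕ} (D : Set (Eu n)) (u w : VD D) :
    toDual D u w = ⟪toH D u, toH D w⟫_ℝ := rfl

/-! ### Time-dependent spaces -/

section Time

/-- `L²((s₁, s₂); X)`. -/
abbrev L2t (X : Type*) [NormedAddCommGroup X] (s₁ s₂ : ℝ) : Type _ :=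
  Lp X 2 (volume.restrict (Ioo s₁ s₂))

theorem integrable_smul_L2t {X : Type*} [NormedAddCommGroup X] [NormedSpace ℝ X] {s₁ s₂ : ℝ}
    {ψ : ℝ → ℝ} (hψ : Continuous ψ) (hc : HasCompactSupport ψ) {g : ℝ → X}
    (hg : MemLp g 2 (volume.restrict (Ioo s₁ s₂))) :
    Integrable (fun t => ψ t • g t) (volume.restrict (Ioo s₁ s₂)) := by
  obtain ⟨C, hC⟩ := hc.exists_bound_of_continuous hψ
  exact (hg.integrable (by norm_num)).bdd_smul C hψ.aestronglyMeasurable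
    (Filter.Eventually.of_forall hC)

variable {X Y : Type*} [NormedAddCommGroup X] [NormedSpace ℝ X]
  [NormedAddCommGroup Y] [NormedSpace ℝ Y]

/-- For an inclusion `ι : X → Y`: `g ∈ L²((s₁, s₂); Y)` is the distributional time derivative,
as a `Y`-valued distribution on `(s₁, s₂)`, of `v ∈ L²((s₁, s₂); X)`. -/
def IsTimeDeriv (ι : X →L[ℝ] Y) {s₁ s₂ : ℝ} (v : L2t X s₁ s₂) (g : L2t Y s₁ s₂) : Prop :=
  ∀ ψ : ℝ → ℝ, ContDiff ℝ ((⊤ : ℕ∞) : WithTop ℕ∞) ψ → HasCompactSupport ψ →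
    tsupport ψ ⊆ Ioo s₁ s₂ →
    ∫ t in Ioo s₁ s₂, deriv ψ t • ι (v t) = - ∫ t in Ioo s₁ s₂, ψ t • g t

/-- The pairs `(v, ∂ₜ v)` with `v ∈ L²((s₁, s₂); X)` and `∂ₜ v ∈ L²((s₁, s₂); Y)`, with the norm
`(‖v‖²_{L²(X)} + ‖∂ₜ v‖²_{L²(Y)})^(1/2)`. -/
def timeSobolev (ι : X →L[ℝ] Y) (s₁ s₂ : ℝ) :
    Submodule ℝ (WithLp 2 (L2t X s₁ s₂ × L2t Y s₁ s₂)) where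
  carrier := {p | IsTimeDeriv ι p.fst p.snd}
  zero_mem' := by
    intro ψ _ _ _
    have h1 : ∫ t in Ioo s₁ s₂, deriv ψ t • ι ((0 : L2t X s₁ s₂) t) = 0 := by
      refine integral_eq_zero_of_ae ?_
      filter_upwards [Lp.coeFn_zero X 2 (volume.restrict (Ioo s₁ s₂))] with t ht
      rw [ht]; simp
    have h2 : ∫ t in Ioo s₁ s₂, ψ t • ((0 : L2t Y s₁ s₂) t) = 0 := by
      refine integral_eq_zero_of_ae ?_
      filter_upwards [Lp.coeFn_zero Y 2 (volume.restrict (Ioo s₁ s₂))] with t ht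
      rw [ht]; simp
    exact h1.trans (by rw [← neg_zero]; exact congrArg _ h2.symm)
  add_mem' := by
    intro p q hp hq ψ hψ hc hs
    have hd : Continuous (deriv ψ) := hψ.continuous_deriv (by simp)
    have i1 := integrable_smul_L2t hd hc.deriv (ι.comp_memLp p.fst)
    have i2 := integrable_smul_L2t hd hc.deriv (ι.comp_memLp q.fst)
    have i3 := integrable_smul_L2t hψ.continuous hc (Lp.memLp p.snd)
    have i4 := integrable_smul_L2t hψ.continuous hc (Lp.memLp q.snd)
    have h1 : ∫ t in Ioo s₁ s₂, deriv ψ t • ι ((p.fst + q.fst) t) =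
        (∫ t in Ioo s₁ s₂, deriv ψ t • ι (p.fst t)) +
          ∫ t in Ioo s₁ s₂, deriv ψ t • ι (q.fst t) := by
      refine Eq.trans (integral_congr_ae ?_) (integral_add i1 i2)
      filter_upwards [Lp.coeFn_add p.fst q.fst] with t ht
      rw [ht]; simp
    have h2 : ∫ t in Ioo s₁ s₂, ψ t • ((p.snd + q.snd) t) =
        (∫ t in Ioo s₁ s₂, ψ t • p.snd t) + ∫ t in Ioo s₁ s₂, ψ t • q.snd t := by
      refine Eq.trans (integral_congr_ae ?_) (integral_add i3 i4)
      filter_upwards [Lp.coeFn_add p.snd q.snd] with t ht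
      rw [ht]; simp
    refine h1.trans ?_
    rw [hp ψ hψ hc hs, hq ψ hψ hc hs, ← neg_add]
    exact congrArg _ h2.symm
  smul_mem' := by
    intro c p hp ψ hψ hc hs
    have h1 : ∫ t in Ioo s₁ s₂, deriv ψ t • ι ((c • p.fst) t) =
        c • ∫ t in Ioo s₁ s₂, deriv ψ t • ι (p.fst t) := by
      refine Eq.trans (integral_congr_ae ?_) (integral_smul c _)
      filter_upwards [Lp.coeFn_smul c p.fst] with t ht
      rw [ht]; simp [smul_comm c]
    have h2 : ∫ t in Ioo s₁ s₂, ψ t • ((c • p.snd) t) = c • ∫ t in Ioo s₁ s₂, ψ t • p.snd t := by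
      refine Eq.trans (integral_congr_ae ?_) (integral_smul c _)
      filter_upwards [Lp.coeFn_smul c p.snd] with t ht
      rw [ht]; simp [smul_comm c]
    refine h1.trans ?_
    rw [hp ψ hψ hc hs, smul_neg]
    exact congrArg _ h2.symm

end Time

/-! ### Random spaces -/

section Random

variable {n : ℕ} (D : Set (Eu n)) {Ω : Type*} [MeasurableSpace Ω] (P : Measure Ω)

/-- `H_P = L²_P(Ω; H)`. -/
abbrev HP : Type _ := Lp (HD D) 2 P

/-- `V_P = L²_P(Ω; V)`. -/
abbrev VP : Type _ := Lp (VD D) 2 P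

/-- `V'_P = L²_P(Ω; V')`. -/
abbrev VPdual : Type _ := Lp (VDdual D) 2 P

/-- The inclusion `V_P ↪ H_P`. -/
def toHP : VP D P →L[ℝ] HP D P := (toH D).compLpL 2 P

/-- The inclusion `V_P ↪ H_P ↪ V'_P`. -/
def toDualP : VP D P →L[ℝ] VPdual D P := (toDual D).compLpL 2 P

variable {D P}

/-- The duality `⟨g, v⟩_{V'_P, V_P} = 𝔼[⟨g, v⟩_{V', V}]`. -/
def pairing (g : VPdual D P) (v : VP D P) : ℝ := ∫ ω, (g ω) (v ω) ∂P

variable (D P)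

/-- Assumption on the diffusion: `ν` is a (jointly measurable) random field, and there are
random variables `νmin`, `νmax` with `0 < νlo ≤ νmin(ω) ≤ ν(ω, x) ≤ νmax(ω) ≤ νhi`
for a.e. `x ∈ D`, almost surely. -/
structure IsUniformDiffusion (νlo νhi : ℝ) (ν : Ω → Eu n → ℝ) : Prop where
  pos : 0 < νlo
  aestronglyMeasurable :
    AEStronglyMeasurable (Function.uncurry ν) (P.prod (volume.restrict D))
  bounds : ∃ νmin νmax : Ω → ℝ, Measurable νmin ∧ Measurable νmax ∧
    ∀ᵐ ω ∂P, νlo ≤ νmin ω ∧ νmax ω ≤ νhi ∧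
      ∀ᵐ x ∂(volume.restrict D), νmin ω ≤ ν ω x ∧ ν ω x ≤ νmax ω

/-- `W_P(s₁, s₂)`: an element is recorded as the pair `(v, ∂ₜ v)`, so that its norm is
`(‖v‖²_{L²(V_P)} + ‖∂ₜ v‖²_{L²(V'_P)})^(1/2)`. -/
abbrev WP (s₁ s₂ : ℝ) : Type _ := 
  ↥(timeSobolev (X := VP D P) (Y := VPdual D P) (toDualP D P) s₁ s₂)

variable {D P}

/-- `u ∈ C([s₁, s₂]; H_P)` is the continuous representative of `v ∈ L²((s₁, s₂); V_P)`. -/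
def IsContRep {s₁ s₂ : ℝ} (v : L2t (VP D P) s₁ s₂) (u : C(Icc s₁ s₂, HP D P)) : Prop :=
  ∀ᵐ t ∂(volume.restrict (Ioo s₁ s₂)), ∀ ht : t ∈ Icc s₁ s₂, u ⟨t, ht⟩ = toHP D P (v t)

/-! ### Coefficients and weak solutions -/

variable (D) in
/-- `L^∞((0, ∞); L^r(D; ℝ))`, the space of reaction coefficients. -/
abbrev ReactionSpace (r : ℝ≥0∞) [Fact (1 ≤ r)] : Type :=
  Lp (Lp ℝ r (volume.restrict D)) ∞ (volume.restrict (Ioi (0 : ℝ)))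

variable (D) in
/-- `L^∞((0, ∞) × D; ℝⁿ)`, the space of convection coefficients. -/
abbrev ConvectionSpace : Type :=
  Lp (Eu n) ∞ ((volume.restrict (Ioi (0 : ℝ))).prod (volume.restrict D))

/-- `𝒩(a, b) = ‖a‖_{L^∞((0,∞); L^r(D))} + ‖b‖_{L^∞((0,∞) × D)}`. -/
def coeffNorm {r : ℝ≥0∞} [Fact (1 ≤ r)] (a : ReactionSpace D r) (b : ConvectionSpace D) : ℝ :=
  ‖a‖ + ‖b‖

/-- `∫_Ω ∫_D ν ∇v · ∇w dx dP`. -/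
def diffusionForm (ν : Ω → Eu n → ℝ) (v w : VP D P) : ℝ :=
  ∫ ω, (∫ x in D, ν ω x * ⟪grad D (v ω) x, grad D (w ω) x⟫_ℝ) ∂P

/-- `⟨α v, w⟩_{V'_P, V_P} = 𝔼[∫_D α v w dx]` for `α ∈ L^r(D)`. -/
def reactionForm {r : ℝ≥0∞} (α : Lp ℝ r (volume.restrict D)) (v w : VP D P) : ℝ :=
  ∫ ω, (∫ x in D, α x * toH D (v ω) x * toH D (w ω) x) ∂P

/-- `∫_Ω ∫_D v β · ∇w dx dP` for a vector field `β` on `D`. -/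
def convectionForm (β : Eu n → Eu n) (v w : VP D P) : ℝ :=
  ∫ ω, (∫ x in D, toH D (v ω) x * ⟪β x, grad D (w ω) x⟫_ℝ) ∂P

/-- `y ∈ W_P(t₀, t₀ + T)` is a weak solution of
`∂ₜ y - ∇ · (ν ∇y) + a y + ∇ · (b y) = f`, `y = 0` on `∂D`, `y(t₀) = y₀`. -/
def IsWeakSolution {r : ℝ≥0∞} [Fact (1 ≤ r)] (ν : Ω → Eu n → ℝ)
    (a : ReactionSpace D r) (b : ConvectionSpace D) (t₀ T : ℝ) (hT : 0 < T)
    (y₀ : HP D P) (f : L2t (VPdual D P) t₀ (t₀ + T)) (y : WP D P t₀ (t₀ + T)) : Prop :=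
  (∀ φ : L2t (VP D P) t₀ (t₀ + T),
    (∫ t in Ioo t₀ (t₀ + T), pairing (y.1.snd t) (φ t))
      + (∫ t in Ioo t₀ (t₀ + T), diffusionForm ν (y.1.fst t) (φ t))
      + (∫ t in Ioo t₀ (t₀ + T), reactionForm (a t) (y.1.fst t) (φ t))
      - (∫ t in Ioo t₀ (t₀ + T), convectionForm (fun x => b (t, x)) (y.1.fst t) (φ t))
      = ∫ t in Ioo t₀ (t₀ + T), pairing (f t) (φ t)) ∧
  ∃ u : C(Icc t₀ (t₀ + T), HP D P), IsContRep y.1.fst u ∧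
    u ⟨t₀, left_mem_Icc.2 (le_add_of_nonneg_right hT.le)⟩ = y₀

end Random

end RandomParabolic

end

/-!
The equation is an abstract parabolic problem `y' + A(t) y = f`, `y(a) = y₀`, for a triple
`V ↪ H ≅ H' ↪ V'` of Hilbert spaces, here `V_P ↪ H_P ↪ V'_P`. The dual is identified with `V` by the
Riesz isomorphism (`rieszEquiv`, `rieszP`), so that a time derivative in `L²(V')` becomes an element
`g` of `L²(V)`, and the inclusion `V ↪ V'` becomes `j* ∘ j` (`rieszIncl`), where `j : V → H` is the
inclusion. All that the solution theory uses of `A` is that it is weakly measurable in time, bounded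
by a constant `M`, and satisfies a Gårding inequality `α ‖v‖² ≤ A t v v + lam ‖j v‖²`
(`IsGardingFamily`).

*Gårding's inequality.* The only form that is not obviously bounded on `V = H¹₀` is the reaction
form `∫ α v w`. The inequality `W^{1,1} ⊂ L^{n/(n-1)}` applied to the product of two test functions
bounds `‖v w‖_{L^{n/(n-1)}}` by `‖v‖ ‖∇w‖ + ‖w‖ ‖∇v‖`, with norms in `L²`; this passes to `H¹₀` by
Fatou's lemma, and Hölder's inequality with `α ∈ L^r ⊂ L^n` gives the bound
`exists_isReactionBound`. Each term carries only one gradient, so Young's inequality absorbs the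
reaction and the convection into the diffusion (`garding_VD`). The constant is the same for all
`r ≥ n`, and for almost all realizations of `ν`; thus the inequality may be integrated over `Ω`
(`garding_VP`). Randomness plays no other role.

*Energy identity.* If `v ∈ L²(V)` has weak derivative `g`, then `j* j v` is a primitive of `g`, and
`‖j v‖²` has weak derivative `2 ⟪g, v⟫` (`integral_deriv_mul_inner_eq`); this is seen by pairing the
increments of `j* j v` with `v(· + h) + v`, so that no smoothing is needed. Consequently `j v` has a
weakly continuous representative whose norm is continuous, hence a continuous one
(`exists_continuousOn_rep`).

*Estimates.* The energy identity, Gårding's inequality and Grönwall's inequality bound the solution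
by the data (`IsGardingFamily.Solves.energy_le`); applied to a difference of solutions this gives
uniqueness. Averaging the energy identity over the time interval bounds `y₀` by the
solution (`IsGardingFamily.Solves.norm_initial_sq_le`), with a constant affine in `M`.

*Existence.* The adjoint operator `φ ↦ -(j* j φ') + A* φ`, on `C¹` functions vanishing at the final
time, is bounded below; multiplying by `exp (2 lam (t - a))` absorbs the lower-order term of
Gårding's inequality (`IsGardingFamily.le_norm_adjointOp`). Lions' projection theorem then gives a
very weak solution (`IsGardingFamily.exists_veryWeak`), which turns out to have a time derivative in
`L²(V')` and the right initial value (`IsGardingFamily.exists_solution`).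
-/

noncomputable section

namespace RandomParabolic

/-! ### Bounded measurable families of bilinear forms -/

section LpNorm

variable {α X Y : Type*} [MeasurableSpace α] {μ : Measure α} [NormedAddCommGroup X]
  [NormedAddCommGroup Y]

theorem integrable_norm_mul_norm (u : Lp X 2 μ) (w : Lp Y 2 μ) :
    Integrable (fun a => ‖u a‖ * ‖w a‖) μ :=
  (Lp.memLp u).norm.integrable_mul (Lp.memLp w).norm

theorem integral_norm_mul_norm_eq_inner (u : Lp X 2 μ) (w : Lp Y 2 μ) :
    ∫ a, ‖u a‖ * ‖w a‖ ∂μ =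
      ⟪(Lp.memLp w).norm.toLp (fun a => ‖w a‖), (Lp.memLp u).norm.toLp (fun a => ‖u a‖)⟫_ℝ := by
  rw [L2.inner_def]
  refine integral_congr_ae ?_
  filter_upwards [(Lp.memLp u).norm.coeFn_toLp, (Lp.memLp w).norm.coeFn_toLp] with a h1 h2
  rw [h1, h2]
  simp

theorem norm_toLp_norm (u : Lp X 2 μ) : ‖(Lp.memLp u).norm.toLp (fun a => ‖u a‖)‖ = ‖u‖ := by
  rw [Lp.norm_toLp, eLpNorm_norm, Lp.norm_def]

theorem norm_sq_eq_integral (u : Lp X 2 μ) : ‖u‖ ^ 2 = ∫ a, ‖u a‖ ^ 2 ∂μ := by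
  rw [← norm_toLp_norm, ← real_inner_self_eq_norm_sq, ← integral_norm_mul_norm_eq_inner]
  simp only [sq]

theorem integrable_norm_sq (u : Lp X 2 μ) : Integrable (fun a => ‖u a‖ ^ 2) μ := by
  simpa only [sq] using integrable_norm_mul_norm u u

theorem integral_norm_mul_norm_le (u : Lp X 2 μ) (w : Lp Y 2 μ) :
    ∫ a, ‖u a‖ * ‖w a‖ ∂μ ≤ ‖u‖ * ‖w‖ := by
  rw [integral_norm_mul_norm_eq_inner, ← norm_toLp_norm u, ← norm_toLp_norm w, mul_comm]
  exact real_inner_le_norm _ _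

end LpNorm

section LiftForm

variable {α X Y : Type*} [MeasurableSpace α] {μ : Measure α}
  [NormedAddCommGroup X] [NormedSpace ℝ X] [NormedAddCommGroup Y] [NormedSpace ℝ Y]

/-- A weakly measurable family of operators maps strongly measurable functions to strongly
measurable functions: this holds for simple functions, and passes to pointwise limits. -/
theorem aestronglyMeasurable_clm_apply {E : Type*} [NormedAddCommGroup E] [NormedSpace ℝ E]
    {L : α → X →L[ℝ] E} (hL : ∀ x, AEStronglyMeasurable (fun a => L a x) μ)
    {u : α → X} (hu : AEStronglyMeasurable u μ) :
    AEStronglyMeasurable (fun a => L a (u a)) μ := by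
  obtain ⟨u', hu', huu'⟩ := hu
  have hsimple : ∀ s : SimpleFunc α X, AEStronglyMeasurable (fun a => L a (s a)) μ := by
    intro s
    induction s using SimpleFunc.induction with
    | @const c s hs =>
      have : (fun a => L a ((SimpleFunc.piecewise s hs (SimpleFunc.const α c)
          (SimpleFunc.const α 0)) a)) = s.indicator (fun a => L a c) := by
        ext a
        by_cases ha : a ∈ s <;> simp [ha, piecewise]
      rw [this]
      exact (hL c).indicator hs
    | @add f g _ hf hg =>
      have : (fun a => L a ((f + g) a)) = fun a => L a (f a) + L a (g a) := by
        ext a; simp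
      rw [this]
      exact hf.add hg
  have h' : AEStronglyMeasurable (fun a => L a (u' a)) μ :=
    aestronglyMeasurable_of_tendsto_ae Filter.atTop (fun n => hsimple (hu'.approx n))
      (Filter.Eventually.of_forall fun a => ((L a).continuous.tendsto _).comp
        (hu'.tendsto_approx a))
  exact h'.congr (huu'.mono fun a ha => by simp only [ha])

theorem aestronglyMeasurable_bilin_apply {B : α → X →L[ℝ] Y →L[ℝ] ℝ}
    (hB : ∀ x y, AEStronglyMeasurable (fun a => B a x y) μ)
    {u : α → X} {w : α → Y} (hu : AEStronglyMeasurable u μ) (hw : AEStronglyMeasurable w μ) :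
    AEStronglyMeasurable (fun a => B a (u a) (w a)) μ := by
  refine aestronglyMeasurable_clm_apply (L := fun a => B a (u a)) (fun y => ?_) hw
  exact aestronglyMeasurable_clm_apply (L := fun a => (B a).flip y) (fun x => hB x y) hu

theorem ae_norm_bilin_apply_le {B : α → X →L[ℝ] Y →L[ℝ] ℝ}
    {K : ℝ} (hK : ∀ᵐ a ∂μ, ‖B a‖ ≤ K) (u : α → X) (w : α → Y) :
    ∀ᵐ a ∂μ, ‖B a (u a) (w a)‖ ≤ K * (‖u a‖ * ‖w a‖) := by
  filter_upwards [hK] with a ha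
  calc ‖B a (u a) (w a)‖ ≤ ‖B a‖ * ‖u a‖ * ‖w a‖ := (B a).le_opNorm₂ _ _
    _ ≤ K * ‖u a‖ * ‖w a‖ := by gcongr
    _ = K * (‖u a‖ * ‖w a‖) := by ring

theorem integrable_bilin {B : α → X →L[ℝ] Y →L[ℝ] ℝ}
    (hB : ∀ x y, AEStronglyMeasurable (fun a => B a x y) μ) {K : ℝ}
    (hK : ∀ᵐ a ∂μ, ‖B a‖ ≤ K) (u : Lp X 2 μ) (w : Lp Y 2 μ) :
    Integrable (fun a => B a (u a) (w a)) μ :=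
  ((integrable_norm_mul_norm u w).const_mul K).mono'
    (aestronglyMeasurable_bilin_apply hB (Lp.aestronglyMeasurable u) (Lp.aestronglyMeasurable w))
    (ae_norm_bilin_apply_le hK u w)

theorem abs_integral_bilin_le {B : α → X →L[ℝ] Y →L[ℝ] ℝ} {K : ℝ} (hK0 : 0 ≤ K)
    (hK : ∀ᵐ a ∂μ, ‖B a‖ ≤ K) (u : Lp X 2 μ) (w : Lp Y 2 μ) :
    ‖∫ a, B a (u a) (w a) ∂μ‖ ≤ K * ‖u‖ * ‖w‖ :=
  calc ‖∫ a, B a (u a) (w a) ∂μ‖ ≤ ∫ a, K * (‖u a‖ * ‖w a‖) ∂μ :=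
        norm_integral_le_of_norm_le ((integrable_norm_mul_norm u w).const_mul K)
          (ae_norm_bilin_apply_le hK u w)
    _ = K * ∫ a, ‖u a‖ * ‖w a‖ ∂μ := integral_const_mul _ _
    _ ≤ K * (‖u‖ * ‖w‖) := by gcongr; exact integral_norm_mul_norm_le u w
    _ = K * ‖u‖ * ‖w‖ := by ring

/-- The bounded bilinear form `(u, w) ↦ ∫ B a (u a) (w a) dμ(a)` on `L²(μ; X) × L²(μ; Y)`
induced by an essentially bounded, weakly measurable family `B` of bilinear forms on `X × Y`. -/
def liftForm (μ : Measure α) (B : α → X →L[ℝ] Y →L[ℝ] ℝ)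
    (hB : ∀ x y, AEStronglyMeasurable (fun a => B a x y) μ) (K : ℝ) (hK0 : 0 ≤ K)
    (hK : ∀ᵐ a ∂μ, ‖B a‖ ≤ K) : Lp X 2 μ →L[ℝ] Lp Y 2 μ →L[ℝ] ℝ :=
  LinearMap.mkContinuous₂
    (LinearMap.mk₂ ℝ (fun (u : Lp X 2 μ) (w : Lp Y 2 μ) => ∫ a, B a (u a) (w a) ∂μ)
      (fun u u' w => by
        rw [← integral_add (integrable_bilin hB hK u w) (integrable_bilin hB hK u' w)]
        refine integral_congr_ae ?_
        filter_upwards [Lp.coeFn_add u u'] with a ha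
        simp only [ha, Pi.add_apply, map_add, add_apply])
      (fun c u w => by
        rw [← integral_smul]
        refine integral_congr_ae ?_
        filter_upwards [Lp.coeFn_smul c u] with a ha
        simp only [ha, Pi.smul_apply, map_smul, smul_apply])
      (fun u w w' => by
        rw [← integral_add (integrable_bilin hB hK u w) (integrable_bilin hB hK u w')]
        refine integral_congr_ae ?_
        filter_upwards [Lp.coeFn_add w w'] with a ha
        simp only [ha, Pi.add_apply, map_add])
      (fun c u w => by
        rw [← integral_smul]
        refine integral_congr_ae ?_
        filter_upwards [Lp.coeFn_smul c w] with a ha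
        simp only [ha, Pi.smul_apply, map_smul]))
    K (fun u w => abs_integral_bilin_le hK0 hK u w)

theorem norm_liftForm_le {B : α → X →L[ℝ] Y →L[ℝ] ℝ}
    (hB : ∀ x y, AEStronglyMeasurable (fun a => B a x y) μ) {K : ℝ} (hK0 : 0 ≤ K)
    (hK : ∀ᵐ a ∂μ, ‖B a‖ ≤ K) : ‖liftForm μ B hB K hK0 hK‖ ≤ K :=
  LinearMap.mkContinuous₂_norm_le _ hK0 _

end LiftForm

/-! ### Weak derivatives in time -/

section WeakDerivative

open scoped ContDiff

/-- A smooth function on the line with compact support inside `(a, b)`. -/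
structure IsTest (a b : ℝ) (ψ : ℝ → ℝ) : Prop where
  contDiff : ContDiff ℝ ∞ ψ
  hasCompactSupport : HasCompactSupport ψ
  tsupport_subset : tsupport ψ ⊆ Ioo a b

variable {X : Type*} [NormedAddCommGroup X] [NormedSpace ℝ X]

theorem exists_Icc_of_isCompact_subset_Ioo {a b : ℝ} (hab : a < b) {K : Set ℝ} (hK : IsCompact K)
    (hKab : K ⊆ Ioo a b) : ∃ a' b', a < a' ∧ b' < b ∧ K ⊆ Icc a' b' := by
  rcases K.eq_empty_or_nonempty with rfl | hne
  · exact ⟨(a + b) / 2, (a + b) / 2, by linarith, by linarith, empty_subset _⟩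
  · obtain ⟨x, hx, hx'⟩ := hK.exists_isLeast hne
    obtain ⟨y, hy, hy'⟩ := hK.exists_isGreatest hne
    exact ⟨x, y, (hKab hx).1, (hKab hy).2, fun z hz => ⟨hx' hz, hy' hz⟩⟩

theorem IsTest.exists_Icc {a b : ℝ} (hab : a < b) {ψ : ℝ → ℝ} (hψ : IsTest a b ψ) :
    ∃ a' b', a < a' ∧ b' < b ∧ tsupport ψ ⊆ Icc a' b' :=
  exists_Icc_of_isCompact_subset_Ioo hab hψ.hasCompactSupport hψ.tsupport_subset

theorem IsTest.eq_zero {a b : ℝ} {ψ : ℝ → ℝ} (hψ : IsTest a b ψ) {t : ℝ} (ht : t ∉ Ioo a b) :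
    ψ t = 0 :=
  image_eq_zero_of_notMem_tsupport fun h => ht (hψ.tsupport_subset h)

/-- A test function with zero mean is the derivative of a test function. -/
theorem IsTest.exists_deriv_eq {a b : ℝ} (hab : a < b) {k : ℝ → ℝ} (hk : IsTest a b k)
    (hk0 : ∫ t, k t = 0) : ∃ ψ, IsTest a b ψ ∧ deriv ψ = k := by
  obtain ⟨a', b', ha', hb', hs⟩ := hk.exists_Icc hab
  have hkc : Continuous k := hk.contDiff.continuous
  have hd : ∀ t, HasDerivAt (fun t => ∫ s in a..t, k s) (k t) t := fun t =>
    hkc.integral_hasStrictDerivAt a t |>.hasDerivAt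
  have hderiv : deriv (fun t => ∫ s in a..t, k s) = k := funext fun t => (hd t).deriv
  have hk' : ∀ t, t ∉ Icc a' b' → k t = 0 := fun t ht =>
    image_eq_zero_of_notMem_tsupport fun h => ht (hs h)
  have hsupp : Function.support (fun t => ∫ s in a..t, k s) ⊆ Icc a' b' := by
    intro t ht
    by_contra hcon
    apply ht
    rcases lt_or_ge t a' with hlt | hge
    · refine intervalIntegral.integral_zero_ae (Filter.Eventually.of_forall fun s hs' => ?_)
      refine hk' s fun h => ?_
      have := (mem_uIoc.1 hs')
      rcases this with h1 | h1 <;> linarith [h.1, h1.1, h1.2]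
    · have hbt : b' < t := by
        by_contra hle
        exact hcon ⟨hge, not_lt.1 hle⟩
      show ∫ s in a..t, k s = 0
      rw [intervalIntegral.integral_eq_integral_of_support_subset, hk0]
      intro s hs'
      have : s ∈ Icc a' b' := by
        by_contra h
        exact hs' (hk' s h)
      exact ⟨by linarith [this.1], by linarith [this.2]⟩
  have hts : tsupport (fun t => ∫ s in a..t, k s) ⊆ Icc a' b' :=
    closure_minimal hsupp isClosed_Icc
  refine ⟨fun t => ∫ s in a..t, k s, ⟨?_, ?_, ?_⟩, hderiv⟩
  · rw [contDiff_infty_iff_deriv, hderiv]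
    exact ⟨fun t => (hd t).differentiableAt, hk.contDiff⟩
  · exact isCompact_Icc.of_isClosed_subset (isClosed_tsupport _) hts
  · exact hts.trans fun t ht => ⟨by linarith [ht.1], by linarith [ht.2]⟩

theorem exists_isTest_integral_eq_one {a b : ℝ} (hab : a < b) :
    ∃ η, IsTest a b η ∧ ∫ t, η t = 1 := by
  let f : ContDiffBump ((a + b) / 2) :=
    ⟨(b - a) / 8, (b - a) / 4, by linarith, by linarith⟩
  refine ⟨f.normed volume, ⟨f.contDiff_normed, f.hasCompactSupport_normed, ?_⟩, f.integral_normed⟩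
  rw [f.tsupport_normed_eq, Real.closedBall_eq_Icc]
  intro t ht
  have h1 : (a + b) / 2 - (b - a) / 4 ≤ t := ht.1
  have h2 : t ≤ (a + b) / 2 + (b - a) / 4 := ht.2
  exact ⟨by linarith, by linarith⟩

theorem IsTest.integrableOn_smul {a b : ℝ} {ψ : ℝ → ℝ} (hψ : IsTest a b ψ) {F : ℝ → X}
    (hF : IntegrableOn F (Ioo a b)) : IntegrableOn (fun t => ψ t • F t) (Ioo a b) := by
  obtain ⟨C, hC⟩ := hψ.hasCompactSupport.exists_bound_of_continuous hψ.contDiff.continuous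
  exact Integrable.bdd_smul hF C hψ.contDiff.continuous.aestronglyMeasurable
    (Filter.Eventually.of_forall hC)

theorem IsTest.deriv {a b : ℝ} {ψ : ℝ → ℝ} (hψ : IsTest a b ψ) : IsTest a b (deriv ψ) :=
  ⟨(contDiff_infty_iff_deriv.1 hψ.contDiff).2, hψ.hasCompactSupport.deriv,
    tsupport_deriv_subset.trans hψ.tsupport_subset⟩

theorem IsTest.setIntegral_smul {a b : ℝ} {ψ : ℝ → ℝ} (hψ : IsTest a b ψ) (F : ℝ → X) :
    ∫ t in Ioo a b, ψ t • F t = ∫ t, ψ t • F t :=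
  setIntegral_eq_integral_of_forall_compl_eq_zero fun t ht => by rw [hψ.eq_zero ht, zero_smul]

/-- The du Bois-Reymond lemma: a function with vanishing weak derivative is constant. -/
theorem exists_ae_eq_const_of_integral_deriv_smul_eq_zero [CompleteSpace X]
    {a b : ℝ} (hab : a < b) {F : ℝ → X}
    (hF : IntegrableOn F (Ioo a b))
    (h : ∀ ψ, IsTest a b ψ → ∫ t in Ioo a b, deriv ψ t • F t = 0) :
    ∃ c, ∀ᵐ t ∂volume.restrict (Ioo a b), F t = c := by
  obtain ⟨η₀, hη₀, hη₀1⟩ := exists_isTest_integral_eq_one hab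
  refine ⟨∫ t in Ioo a b, η₀ t • F t, ?_⟩
  set c := ∫ t in Ioo a b, η₀ t • F t with hc
  have hloc : IntegrableOn (fun t => F t - c) (Ioo a b) :=
    hF.sub (integrable_const c)
  have key : ∀ η : ℝ → ℝ, ContDiff ℝ ∞ η → HasCompactSupport η → tsupport η ⊆ Ioo a b →
      ∫ t, η t • (F t - c) = 0 := by
    intro η h1 h2 h3
    have hη : IsTest a b η := ⟨h1, h2, h3⟩
    set m := ∫ t, η t with hm
    have hk : IsTest a b (fun t => η t - m * η₀ t) := by
      refine ⟨h1.sub (contDiff_const.mul hη₀.contDiff), ?_, ?_⟩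
      · exact h2.sub (hη₀.hasCompactSupport.mul_left (f := fun _ => m))
      · refine (tsupport_sub η _).trans (union_subset h3 ?_)
        exact (tsupport_mul_subset_right (f := fun _ => m)).trans hη₀.tsupport_subset
    have i1 : Integrable η := h1.continuous.integrable_of_hasCompactSupport h2
    have i2 : Integrable η₀ :=
      hη₀.contDiff.continuous.integrable_of_hasCompactSupport hη₀.hasCompactSupport
    have hk0 : ∫ t, (η t - m * η₀ t) = 0 := by
      rw [integral_sub i1 (i2.const_mul m), integral_const_mul, hη₀1, mul_one, sub_self]
    obtain ⟨ψ, hψ, hψd⟩ := hk.exists_deriv_eq hab hk0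
    have h0 := h ψ hψ
    rw [hψd] at h0
    rw [← hη.setIntegral_smul]
    have e1 : ∫ t in Ioo a b, (η t - m * η₀ t) • F t =
        (∫ t in Ioo a b, η t • F t) - m • c := by
      rw [hc, ← integral_smul]
      refine Eq.trans ?_ (integral_sub (hη.integrableOn_smul hF)
        ((hη₀.integrableOn_smul hF).smul m))
      refine integral_congr_ae (Filter.Eventually.of_forall fun t => ?_)
      simp only [sub_smul, mul_smul]
    have e2 : ∫ t in Ioo a b, η t • (F t - c) = (∫ t in Ioo a b, η t • F t) - m • c := by
      simp only [smul_sub]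
      rw [integral_sub (hη.integrableOn_smul hF) (hη.integrableOn_smul (integrable_const c)),
        hη.setIntegral_smul (fun _ => c), integral_smul_const]
    rw [e2, ← e1, h0]
  have := isOpen_Ioo.ae_eq_zero_of_integral_contDiff_smul_eq_zero (U := Ioo a b)
    hloc.locallyIntegrableOn key
  rw [ae_restrict_iff' measurableSet_Ioo]
  filter_upwards [this] with t ht hmem
  exact sub_eq_zero.1 (ht hmem)

/-- Integration by parts against the primitive of a Bochner integrable function. -/
theorem integral_deriv_smul_primitive [CompleteSpace X] {a b : ℝ} {g : ℝ → X}
    (hg : Integrable g) {ψ : ℝ → ℝ} (hψ : ContDiff ℝ 1 ψ) :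
    ∫ t in Ioo a b, deriv ψ t • (∫ s in a..t, g s) = ∫ s in Ioo a b, (ψ b - ψ s) • g s := by
  have hdc : Continuous (deriv ψ) := hψ.continuous_deriv le_rfl
  let μ := volume.restrict (Ioo a b)
  let f : ℝ → ℝ → X := fun t s => {p : ℝ × ℝ | p.2 < p.1}.indicator
    (fun p => deriv ψ p.1 • g p.2) (t, s)
  have hint : Integrable (Function.uncurry f) (μ.prod μ) := by
    have h1 : Integrable (deriv ψ) μ :=
      (hdc.continuousOn.integrableOn_Icc (a := a) (b := b)).mono_set Ioo_subset_Icc_self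
    have h2 : Integrable g μ := hg.integrableOn
    exact (h1.smul_prod h2).indicator (measurableSet_lt measurable_snd measurable_fst)
  have hswap := integral_integral_swap hint
  have e1 : ∀ t ∈ Ioo a b, ∫ s, f t s ∂μ = deriv ψ t • ∫ s in a..t, g s := by
    intro t ht
    have : (fun s => f t s) = (Iio t).indicator (fun s => deriv ψ t • g s) := by
      ext s; simp [f, indicator]
    rw [this, integral_indicator measurableSet_Iio, Measure.restrict_restrict measurableSet_Iio,
      integral_smul, intervalIntegral.integral_of_le ht.1.le, integral_Ioc_eq_integral_Ioo]
    congr 3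
    ext s
    simp only [mem_inter_iff, mem_Iio, mem_Ioo]
    exact ⟨fun h => ⟨h.2.1, h.1⟩, fun h => ⟨h.2, h.1, h.2.trans ht.2⟩⟩
  have e2 : ∀ s ∈ Ioo a b, ∫ t, f t s ∂μ = (ψ b - ψ s) • g s := by
    intro s hs
    have : (fun t => f t s) = (Ioi s).indicator (fun t => deriv ψ t • g s) := by
      ext t; simp [f, indicator]
    rw [this, integral_indicator measurableSet_Ioi, Measure.restrict_restrict measurableSet_Ioi,
      integral_smul_const]
    congr 1
    have : Ioi s ∩ Ioo a b = Ioo s b := by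
      ext t
      simp only [mem_inter_iff, mem_Ioi, mem_Ioo]
      exact ⟨fun h => ⟨h.1, h.2.2⟩, fun h => ⟨h.1, hs.1.trans h.1, h.2⟩⟩
    rw [this, ← integral_Ioc_eq_integral_Ioo, ← intervalIntegral.integral_of_le hs.2.le]
    exact intervalIntegral.integral_deriv_eq_sub
      (fun t _ => (hψ.differentiable one_ne_zero) t) (hdc.intervalIntegrable _ _)
  rw [setIntegral_congr_fun measurableSet_Ioo (fun t ht => (e1 t ht).symm),
    setIntegral_congr_fun measurableSet_Ioo (fun t ht => (e2 t ht).symm)]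
  exact hswap

/-- A function with an integrable weak derivative is almost everywhere a primitive of it. -/
theorem exists_ae_eq_primitive [CompleteSpace X] {a b : ℝ} (hab : a < b) {F g : ℝ → X}
    (hF : IntegrableOn F (Ioo a b)) (hg : Integrable g)
    (h : ∀ ψ, IsTest a b ψ →
      ∫ t in Ioo a b, deriv ψ t • F t = - ∫ t in Ioo a b, ψ t • g t) :
    ∃ c, ∀ᵐ t ∂volume.restrict (Ioo a b), F t = c + ∫ s in a..t, g s := by
  have hprim : Continuous (fun t => ∫ s in a..t, g s) := hg.continuous_primitive a
  have hprim' : IntegrableOn (fun t => ∫ s in a..t, g s) (Ioo a b) :=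
    (hprim.continuousOn.integrableOn_Icc).mono_set Ioo_subset_Icc_self
  obtain ⟨c, hc⟩ := exists_ae_eq_const_of_integral_deriv_smul_eq_zero hab
    (F := fun t => F t - ∫ s in a..t, g s) (hF.sub hprim') (by
      intro ψ hψ
      simp only [smul_sub]
      rw [integral_sub (hψ.deriv.integrableOn_smul hF) (hψ.deriv.integrableOn_smul hprim'),
        h ψ hψ, integral_deriv_smul_primitive hg (hψ.contDiff.of_le (by simp)),
        hψ.eq_zero (t := b) (fun h => lt_irrefl _ h.2)]
      simp only [zero_sub, neg_smul, integral_neg, sub_self])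
  exact ⟨c, hc.mono fun t ht => by rw [← ht, sub_add_cancel]⟩

end WeakDerivative

/-! ### The energy of a function with weak derivative in the dual space -/

section Energy

open scoped ContDiff Topology
open Filter

/-- The translation `f ↦ f(h + ·)` on `L²(ℝ; V)`. -/
def translate {V : Type*} [NormedAddCommGroup V] (h : ℝ) (f : Lp V 2 (volume : Measure ℝ)) :
    Lp V 2 (volume : Measure ℝ) := DomAddAct.mk h +ᵥ f

theorem coeFn_translate {V : Type*} [NormedAddCommGroup V] (h : ℝ)
    (f : Lp V 2 (volume : Measure ℝ)) : translate h f =ᵐ[volume] fun t => f (h + t) :=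
  DomAddAct.vadd_Lp_ae_eq (DomAddAct.mk h) f

theorem continuous_translate {V : Type*} [NormedAddCommGroup V]
    (f : Lp V 2 (volume : Measure ℝ)) : Continuous fun h : ℝ => translate h f := by
  have : Fact ((2 : ℝ≥0∞) ≠ ⊤) := ⟨by norm_num⟩
  have h1 : Continuous fun h : ℝ => (DomAddAct.mk h : ℝᵈᵃᵃ) :=
    DomAddAct.continuous_mk
  exact h1.vadd continuous_const

theorem translate_zero {V : Type*} [NormedAddCommGroup V]
    (f : Lp V 2 (volume : Measure ℝ)) : translate 0 f = f := by
  refine Lp.ext ((coeFn_translate 0 f).trans (Eventually.of_forall fun t => ?_))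
  simp only [zero_add]

theorem norm_translate {V : Type*} [NormedAddCommGroup V] (h : ℝ)
    (f : Lp V 2 (volume : Measure ℝ)) : ‖translate h f‖ = ‖f‖ :=
  DomAddAct.norm_vadd_Lp _ _

variable {V : Type*} [NormedAddCommGroup V] [InnerProductSpace ℝ V]

/-- The real inner product as a continuous bilinear form. -/
def innerForm (V : Type*) [NormedAddCommGroup V] [InnerProductSpace ℝ V] :
    V →L[ℝ] V →L[ℝ] ℝ := innerSL ℝ

@[simp] theorem innerForm_apply (x y : V) : innerForm V x y = ⟪x, y⟫_ℝ := rfl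

/-- The form `(u, w) ↦ ∫ ψ ⟪u, w⟫` on `L²(ℝ; V)` for a bounded continuous weight `ψ`. -/
def weightedInner {ψ : ℝ → ℝ} (hψ : Continuous ψ) {C : ℝ} (hC0 : 0 ≤ C) (hC : ∀ t, ‖ψ t‖ ≤ C) :
    Lp V 2 (volume : Measure ℝ) →L[ℝ] Lp V 2 (volume : Measure ℝ) →L[ℝ] ℝ :=
  liftForm volume (fun t => ψ t • innerForm V)
    (fun x y => (hψ.mul continuous_const).aestronglyMeasurable) C hC0
    (Eventually.of_forall fun t => ContinuousLinearMap.opNorm_le_bound₂ _ hC0 fun x y => by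
      calc ‖ψ t * ⟪x, y⟫_ℝ‖ = ‖ψ t‖ * ‖⟪x, y⟫_ℝ‖ := norm_mul _ _
        _ ≤ C * (‖x‖ * ‖y‖) := by gcongr; exacts [hC t, norm_inner_le_norm x y]
        _ = C * ‖x‖ * ‖y‖ := (mul_assoc _ _ _).symm)

theorem weightedInner_apply {ψ : ℝ → ℝ} (hψ : Continuous ψ) {C : ℝ} (hC0 : 0 ≤ C)
    (hC : ∀ t, ‖ψ t‖ ≤ C) (u w : Lp V 2 (volume : Measure ℝ)) :
    weightedInner hψ hC0 hC u w = ∫ t, ψ t * ⟪u t, w t⟫_ℝ := rfl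

theorem intervalIntegrable_of_L2 {V : Type*} [NormedAddCommGroup V]
    (g : Lp V 2 (volume : Measure ℝ)) (a b : ℝ) :
    IntervalIntegrable g volume a b :=
  (intervalIntegrable_iff.2 (((Lp.memLp g).locallyIntegrable (by norm_num)).integrableOn_isCompact
    isCompact_uIcc |>.mono_set uIoc_subset_uIcc))

/-- Fubini: an average of the pairings of `g(s + ·)` with `v(h + ·) + v` is the pairing of the
average. -/
theorem integral_weighted_interval_eq [CompleteSpace V] {ψ : ℝ → ℝ} (hψ : Continuous ψ)
    {C : ℝ} (hC0 : 0 ≤ C) (hC : ∀ t, ‖ψ t‖ ≤ C) (g v : Lp V 2 (volume : Measure ℝ)) {h : ℝ}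
    (hh : 0 ≤ h) :
    ∫ s in (0 : ℝ)..h, weightedInner hψ hC0 hC (translate s g) (translate h v + v) =
      ∫ t, ψ t * ⟪∫ s in (0 : ℝ)..h, g (s + t), v (h + t) + v t⟫_ℝ := by
  have hk : (translate h v + v : Lp V 2 (volume : Measure ℝ)) =ᵐ[volume]
      fun t => v (h + t) + v t := by
    filter_upwards [Lp.coeFn_add (translate h v) v, coeFn_translate h v] with t h1 h2
    rw [h1, Pi.add_apply, h2]
  set k := translate h v + v with hkdef
  have e1 : ∀ s, weightedInner hψ hC0 hC (translate s g) k =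
      ∫ t, ψ t * ⟪g (s + t), k t⟫_ℝ := by
    intro s
    rw [weightedInner_apply]
    refine integral_congr_ae ?_
    filter_upwards [coeFn_translate s g] with t ht
    rw [ht]
  have hgm : StronglyMeasurable (fun p : ℝ × ℝ => g (p.1 + p.2)) :=
    (Lp.stronglyMeasurable g).comp_measurable (measurable_fst.add measurable_snd)
  have hkm : StronglyMeasurable (fun p : ℝ × ℝ => k p.2) :=
    (Lp.stronglyMeasurable k).comp_measurable measurable_snd
  have hfm : StronglyMeasurable (fun p : ℝ × ℝ => ψ p.2 * ⟪g (p.1 + p.2), k p.2⟫_ℝ) :=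
    (hψ.comp continuous_snd).stronglyMeasurable.mul (hgm.inner hkm)
  let f : ℝ → ℝ → ℝ := fun s t => ψ t * ⟪g (s + t), k t⟫_ℝ
  have hbound : ∀ s, ∀ᵐ t, ‖f s t‖ ≤ C * (‖translate s g t‖ * ‖k t‖) := by
    intro s
    filter_upwards [coeFn_translate s g] with t ht
    rw [ht, norm_mul]
    gcongr
    · exact hC t
    · exact norm_inner_le_norm _ _
  have hfs : ∀ s, Integrable (f s) := fun s =>
    ((integrable_norm_mul_norm (translate s g) k).const_mul C).mono'
      (hfm.comp_measurable measurable_prodMk_left).aestronglyMeasurable (hbound s)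
  have hint : Integrable (Function.uncurry f) ((volume.restrict (Ioc 0 h)).prod volume) := by
    rw [integrable_prod_iff (f := Function.uncurry f) hfm.aestronglyMeasurable]
    refine ⟨Eventually.of_forall hfs, ?_⟩
    refine Integrable.mono' (g := fun _ => C * (‖g‖ * ‖k‖)) (integrable_const _)
      (hfm.norm.integral_prod_right').aestronglyMeasurable (Eventually.of_forall fun s => ?_)
    rw [Real.norm_of_nonneg (integral_nonneg fun t => norm_nonneg _)]
    calc ∫ t, ‖f s t‖ ≤ ∫ t, C * (‖translate s g t‖ * ‖k t‖) :=
          integral_mono_ae (hfs s).norm ((integrable_norm_mul_norm _ _).const_mul C) (hbound s)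
      _ = C * ∫ t, ‖translate s g t‖ * ‖k t‖ := integral_const_mul _ _
      _ ≤ C * (‖g‖ * ‖k‖) := by
        gcongr
        rw [← norm_translate s g]
        exact integral_norm_mul_norm_le _ _
  simp only [e1]
  rw [intervalIntegral.integral_of_le hh, integral_integral_swap hint]
  refine integral_congr_ae ?_
  filter_upwards [hk] with t ht
  rw [← intervalIntegral.integral_of_le hh]
  simp only [f]
  rw [intervalIntegral.integral_const_mul, ← ht]
  congr 1
  have hgi : IntervalIntegrable (fun s => g (s + t)) volume 0 h := by
    simpa using (intervalIntegrable_of_L2 g (0 + t) (h + t)).comp_add_right t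
  have := ContinuousLinearMap.intervalIntegral_comp_comm
    ((innerForm V).flip (k t)) hgi
  simpa only [ContinuousLinearMap.flip_apply, innerForm_apply] using this

/-- Averages over `(0, h)` of a continuous function of two variables converge as `h → 0`. -/
theorem tendsto_average_of_continuous {Φ : ℝ → ℝ → ℝ} (hΦ : Continuous (Function.uncurry Φ)) :
    Tendsto (fun h : ℝ => h⁻¹ • ∫ s in (0 : ℝ)..h, Φ s h) (𝓝[>] 0) (𝓝 (Φ 0 0)) := by
  rw [Metric.tendsto_nhds]
  intro ε hε
  have h1 := Metric.continuousAt_iff.1 (hΦ.continuousAt (x := ((0 : ℝ), (0 : ℝ)))) (ε / 2)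
    (half_pos hε)
  obtain ⟨δ, hδ, hδ'⟩ := h1
  filter_upwards [Ioo_mem_nhdsGT hδ] with h hh
  have hΦh : Continuous fun s => Φ s h := hΦ.comp (continuous_id.prodMk continuous_const)
  have e : h⁻¹ • (∫ s in (0 : ℝ)..h, Φ s h) - Φ 0 0 =
      h⁻¹ * ∫ s in (0 : ℝ)..h, (Φ s h - Φ 0 0) := by
    rw [intervalIntegral.integral_sub (hΦh.intervalIntegrable _ _) (by simp),
      intervalIntegral.integral_const, smul_eq_mul, smul_eq_mul, sub_zero, mul_sub,
      ← mul_assoc h⁻¹ h, inv_mul_cancel₀ hh.1.ne', one_mul]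
  have hb : ‖∫ s in (0 : ℝ)..h, (Φ s h - Φ 0 0)‖ ≤ ε / 2 * |h - 0| := by
    refine intervalIntegral.norm_integral_le_of_norm_le_const fun s hs => ?_
    rw [uIoc_of_le hh.1.le] at hs
    have := @hδ' (s, h) (by
      rw [Prod.dist_eq, max_lt_iff]
      simp only [Real.dist_eq, sub_zero]
      rw [abs_of_pos hs.1, abs_of_pos hh.1]
      exact ⟨hs.2.trans_lt hh.2, hh.2⟩)
    exact (Real.dist_eq _ _ ▸ this).le
  rw [Real.dist_eq, e, abs_mul, abs_of_pos (inv_pos.2 hh.1)]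
  rw [sub_zero, abs_of_pos hh.1, Real.norm_eq_abs] at hb
  calc h⁻¹ * |∫ s in (0 : ℝ)..h, (Φ s h - Φ 0 0)| ≤ h⁻¹ * (ε / 2 * h) := by
        gcongr
        exact inv_nonneg.2 hh.1.le
    _ = ε / 2 := by field_simp [hh.1.ne']
    _ < ε := half_lt_self hε

/-- The derivative at `0` of the translations of a smooth weight against an integrable
function. -/
theorem hasDerivAt_integral_translate_mul {a b : ℝ} {ψ : ℝ → ℝ} (hψ : IsTest a b ψ) {q : ℝ → ℝ}
    (hq : Integrable q) :
    HasDerivAt (fun h => ∫ t, ψ (t - h) * q t) (∫ t, -deriv ψ t * q t) 0 := by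
  obtain ⟨L, hL⟩ := hψ.contDiff.lipschitzWith_of_hasCompactSupport hψ.hasCompactSupport (by simp)
  have hψc : Continuous ψ := hψ.contDiff.continuous
  have hm : ∀ h : ℝ, AEStronglyMeasurable (fun t => ψ (t - h) * q t) volume := fun h =>
    (hψc.comp (continuous_id.sub continuous_const)).aestronglyMeasurable.mul hq.1
  obtain ⟨C, hC⟩ := hψ.hasCompactSupport.exists_bound_of_continuous hψc
  refine (hasDerivAt_integral_of_dominated_loc_of_lip (bound := fun t => L * |q t|)
    (univ_mem : univ ∈ 𝓝 (0 : ℝ)) (Eventually.of_forall hm) ?_ ?_ ?_ ?_ ?_).2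
  · exact hq.bdd_mul (hψc.comp (continuous_id.sub continuous_const)).aestronglyMeasurable
      (Eventually.of_forall fun t => hC (t - 0))
  · exact (hψ.deriv.contDiff.continuous.neg.aestronglyMeasurable).mul hq.1
  · refine Eventually.of_forall fun t => ?_
    refine LipschitzOnWith.of_dist_le_mul fun x _ y _ => ?_
    rw [Real.coe_nnabs, abs_of_nonneg (by positivity), Real.dist_eq, ← sub_mul, abs_mul]
    have := hL.dist_le_mul (t - x) (t - y)
    rw [Real.dist_eq, Real.dist_eq, sub_sub_sub_cancel_left, abs_sub_comm y x] at this
    calc |ψ (t - x) - ψ (t - y)| * |q t| ≤ (L * |x - y|) * |q t| := by gcongr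
      _ = L * |q t| * dist x y := by rw [Real.dist_eq]; ring
  · exact hq.abs.const_mul _
  · refine Eventually.of_forall fun t => ?_
    have h1 : HasDerivAt ψ (deriv ψ t) (t - 0) := by
      rw [sub_zero]
      exact (hψ.contDiff.differentiable (by simp) t).hasDerivAt
    have h2 := (h1.comp_const_sub t 0).mul_const (q t)
    exact h2

/-- If `S` is symmetric and `S v` is a primitive of `g`, then `⟪S v, v⟫` has the weak derivative
`2 ⟪g, v⟫`. The proof tests the increments of `S v` with `v(· + h) + v`: by symmetry of `S` the
cross terms cancel, and the difference quotients converge since translations are continuous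
on `L²`. -/
theorem integral_deriv_mul_inner_eq [CompleteSpace V] {S : V →L[ℝ] V}
    (hS : ∀ x y, ⟪S x, y⟫_ℝ = ⟪x, S y⟫_ℝ)
    {a b : ℝ} (hab : a < b) (v g : Lp V 2 (volume : Measure ℝ)) {c : V}
    (hv : ∀ᵐ t ∂volume.restrict (Ioo a b), S (v t) = c + ∫ s in a..t, g s)
    {ψ : ℝ → ℝ} (hψ : IsTest a b ψ) :
    ∫ t, deriv ψ t * ⟪S (v t), v t⟫_ℝ = - ∫ t, ψ t * (2 * ⟪g t, v t⟫_ℝ) := by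
  have hψc : Continuous ψ := hψ.contDiff.continuous
  obtain ⟨C, hC⟩ := hψ.hasCompactSupport.exists_bound_of_continuous hψc
  have hC0 : 0 ≤ C := (norm_nonneg _).trans (hC 0)
  set q : ℝ → ℝ := fun t => ⟪S (v t), v t⟫_ℝ with hqdef
  have hq : Integrable q := by
    have := L2.integrable_inner (𝕜 := ℝ) (S.compLp v) v
    refine this.congr ?_
    filter_upwards [S.coeFn_compLp v] with t ht
    rw [ht]
  set Φ : ℝ → ℝ → ℝ := fun s h =>
    weightedInner hψc hC0 hC (translate s g) (translate h v + v) with hΦdef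
  have hΦ : Continuous (Function.uncurry Φ) := by
    have h1 : Continuous fun p : ℝ × ℝ => translate p.1 g :=
      (continuous_translate g).comp continuous_fst
    have h2 : Continuous fun p : ℝ × ℝ => translate p.2 v + v :=
      ((continuous_translate v).comp continuous_snd).add continuous_const
    exact ((weightedInner hψc hC0 hC).continuous.comp h1).clm_apply h2
  obtain ⟨a', b', ha', hb', hsupp⟩ := hψ.exists_Icc hab
  rw [ae_restrict_iff' measurableSet_Ioo] at hv
  have hstep : ∀ h ∈ Ioo 0 (b - b'), ∫ s in (0 : ℝ)..h, Φ s h =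
      (∫ t, ψ (t - (0 + h)) * q t) - ∫ t, ψ (t - 0) * q t := by
    intro h hh
    have hvh : ∀ᵐ t, h + t ∈ Ioo a b → S (v (h + t)) = c + ∫ s in a..(h + t), g s :=
      (measurePreserving_add_left volume h).quasiMeasurePreserving.ae hv
    rw [integral_weighted_interval_eq hψc hC0 hC g v hh.1.le]
    have hq' : Integrable (fun t => q (h + t)) := hq.comp_add_left h
    have e1 : ∫ t, ψ (t - (0 + h)) * q t = ∫ t, ψ t * q (h + t) := by
      rw [← integral_add_left_eq_self (fun t => ψ (t - (0 + h)) * q t) h]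
      simp
    have e2 : ∫ t, ψ (t - 0) * q t = ∫ t, ψ t * q t := by simp
    rw [e1, e2, ← integral_sub (hq'.bdd_mul hψc.aestronglyMeasurable (Eventually.of_forall hC))
      (hq.bdd_mul hψc.aestronglyMeasurable (Eventually.of_forall hC))]
    refine integral_congr_ae ?_
    filter_upwards [hv, hvh] with t h1 h2
    by_cases ht : t ∈ Icc a' b'
    · have m1 : t ∈ Ioo a b := ⟨by linarith [ht.1], by linarith [ht.2]⟩
      have m2 : h + t ∈ Ioo a b := ⟨by linarith [ht.1, hh.1], by linarith [ht.2, hh.2]⟩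
      have e3 : ∫ s in (0 : ℝ)..h, g (s + t) = S (v (h + t)) - S (v t) := by
        rw [intervalIntegral.integral_comp_add_right, h1 m1, h2 m2, add_sub_add_left_eq_sub,
          intervalIntegral.integral_interval_sub_left (intervalIntegrable_of_L2 g _ _)
            (intervalIntegrable_of_L2 g _ _), zero_add]
      rw [e3, ← mul_sub]
      congr 1
      -- the mixed terms `⟪S v(h + t), v t⟫` and `⟪S v t, v(h + t)⟫` agree by symmetry
      simp only [hqdef, inner_sub_left, inner_add_right]
      rw [hS (v t) (v (h + t)), real_inner_comm (S (v (h + t))) (v t)]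
      ring
    · have : ψ t = 0 := image_eq_zero_of_notMem_tsupport fun h => ht (hsupp h)
      simp [this]
  have hlim1 := tendsto_average_of_continuous hΦ
  have hlim2 := (hasDerivAt_iff_tendsto_slope_zero.1
    (hasDerivAt_integral_translate_mul hψ hq)).mono_left
      (nhdsWithin_mono 0 (fun x (hx : 0 < x) => ne_of_gt hx))
  have heq : (fun h : ℝ => h⁻¹ • ∫ s in (0 : ℝ)..h, Φ s h) =ᶠ[𝓝[>] 0]
      fun h => h⁻¹ • ((∫ t, ψ (t - (0 + h)) * q t) - ∫ t, ψ (t - 0) * q t) := by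
    filter_upwards [Ioo_mem_nhdsGT (sub_pos.2 hb')] with h hh
    rw [hstep h hh]
  have hfin := tendsto_nhds_unique (hlim1.congr' heq) hlim2
  have e4 : Φ 0 0 = ∫ t, ψ t * (2 * ⟪g t, v t⟫_ℝ) := by
    simp only [hΦdef, translate_zero]
    rw [weightedInner_apply]
    refine integral_congr_ae ?_
    filter_upwards [Lp.coeFn_add v v] with t ht
    rw [ht, Pi.add_apply, inner_add_right]
    ring
  rw [← e4, hfin]
  simp only [neg_mul, integral_neg, neg_neg, hqdef]

end Energy

/-! ### Continuous representatives and the energy identity -/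

section ContinuousRepresentative

open scoped ContDiff Topology
open Filter

theorem Icc_subset_closure_of_ae {a b : ℝ} (hab : a < b) {E : Set ℝ}
    (hE : ∀ᵐ t ∂volume.restrict (Ioo a b), t ∈ E) : Icc a b ⊆ closure (E ∩ Ioo a b) := by
  intro x hx
  rw [← closure_Ioo hab.ne] at hx
  rw [mem_closure_iff] at hx ⊢
  intro U hU hxU
  have hpos : 0 < volume (U ∩ Ioo a b) :=
    (hU.inter isOpen_Ioo).measure_pos volume (hx U hU hxU)
  rw [ae_restrict_iff' measurableSet_Ioo] at hE
  by_contra hcon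
  rw [not_nonempty_iff_eq_empty] at hcon
  refine hpos.ne' (measure_mono_null (fun t ht => ?_) hE)
  intro h
  have : t ∈ U ∩ (E ∩ Ioo a b) := ⟨ht.1, h ht.2, ht.2⟩
  rw [hcon] at this
  exact this

theorem eqOn_Icc_of_ae_eq {X : Type*} [TopologicalSpace X] [T2Space X] {a b : ℝ} (hab : a < b)
    {u u' : ℝ → X} (hu : ContinuousOn u (Icc a b)) (hu' : ContinuousOn u' (Icc a b))
    (h : ∀ᵐ t ∂volume.restrict (Ioo a b), u t = u' t) : EqOn u u' (Icc a b) := by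
  have hcl := Icc_subset_closure_of_ae hab (E := {t | u t = u' t}) h
  exact EqOn.of_subset_closure (s := {t | u t = u' t} ∩ Ioo a b) (fun t ht => ht.1) hu hu'
    (inter_subset_right.trans Ioo_subset_Icc_self) hcl

/-- The extension by zero of `f ∈ L²((a, b); V)` to the real line. -/
def extendZero {V : Type*} [NormedAddCommGroup V] {a b : ℝ} (f : L2t V a b) :
    Lp V 2 (volume : Measure ℝ) :=
  ((memLp_indicator_iff_restrict measurableSet_Ioo).2 (Lp.memLp f)).toLp ((Ioo a b).indicator f)

theorem coeFn_extendZero {V : Type*} [NormedAddCommGroup V] {a b : ℝ} (f : L2t V a b) :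
    extendZero f =ᵐ[volume] (Ioo a b).indicator f := MemLp.coeFn_toLp _

theorem extendZero_ae_eq {V : Type*} [NormedAddCommGroup V] {a b : ℝ} (f : L2t V a b) :
    ∀ᵐ t ∂volume.restrict (Ioo a b), extendZero f t = f t := by
  rw [ae_restrict_iff' measurableSet_Ioo]
  filter_upwards [coeFn_extendZero f] with t ht hmem
  rw [ht, indicator_of_mem hmem]

theorem integrable_of_L2t {V : Type*} [NormedAddCommGroup V] {a b : ℝ} (f : L2t V a b) :
    IntegrableOn f (Ioo a b) := (Lp.memLp f).integrable (by norm_num)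

theorem integrable_extendZero {V : Type*} [NormedAddCommGroup V] {a b : ℝ} (f : L2t V a b) :
    Integrable (extendZero f) :=
  ((integrable_of_L2t f).integrable_indicator measurableSet_Ioo).congr (coeFn_extendZero f).symm

theorem norm_intervalIntegral_sq_le {V : Type*} [NormedAddCommGroup V] [NormedSpace ℝ V]
    (g : Lp V 2 (volume : Measure ℝ)) (s t : ℝ) :
    ‖∫ r in s..t, g r‖ ^ 2 ≤ ‖g‖ ^ 2 * |t - s| := by
  rcases eq_or_ne s t with rfl | hne
  · simp
  have hL : 0 < |t - s| := abs_pos.2 (sub_ne_zero.2 hne.symm)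
  have h1 : ‖∫ r in s..t, g r‖ ≤ ∫ r in uIoc s t, ‖g r‖ :=
    intervalIntegral.norm_integral_le_integral_norm_uIoc
  set I := ∫ r in uIoc s t, ‖g r‖ with hI
  have hfin : volume (uIoc s t) ≠ ⊤ := by
    rw [uIoc]; exact measure_Ioc_lt_top.ne
  have i1 : IntegrableOn (fun r => ‖g r‖) (uIoc s t) :=
    (intervalIntegrable_iff.1 (intervalIntegrable_of_L2 g s t)).norm
  have i2 : IntegrableOn (fun r => ‖g r‖ ^ 2) (uIoc s t) := (integrable_norm_sq g).integrableOn
  -- expanding `0 ≤ ∫ (‖g‖ - x)²` with `x` the mean value of `‖g‖`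
  set x := I / |t - s| with hx
  have h2 : 0 ≤ ∫ r in uIoc s t, (‖g r‖ ^ 2 - 2 * x * ‖g r‖ + x ^ 2) := by
    refine integral_nonneg fun r => ?_
    show 0 ≤ ‖g r‖ ^ 2 - 2 * x * ‖g r‖ + x ^ 2
    nlinarith [sq_nonneg (‖g r‖ - x)]
  have hvol : volume.real (uIoc s t) = |t - s| := by
    rw [uIoc, Real.volume_real_Ioc, max_sub_min_eq_abs, max_eq_left (abs_nonneg _)]
  have i3 : IntegrableOn (fun r => ‖g r‖ ^ 2 - 2 * x * ‖g r‖) (uIoc s t) :=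
    i2.sub (i1.const_mul _)
  rw [integral_add i3 (integrableOn_const hfin), integral_sub i2 (i1.const_mul _),
    integral_const_mul, setIntegral_const, hvol, ← hI, smul_eq_mul] at h2
  have h3 : ∫ r in uIoc s t, ‖g r‖ ^ 2 ≤ ‖g‖ ^ 2 := by
    rw [norm_sq_eq_integral g]
    exact setIntegral_le_integral (integrable_norm_sq g)
      (Eventually.of_forall fun r => sq_nonneg _)
  have h4 : I ^ 2 / |t - s| ≤ ‖g‖ ^ 2 := by
    have : 2 * x * I - |t - s| * x ^ 2 = I ^ 2 / |t - s| := by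
      rw [hx]; field_simp; ring
    linarith
  calc ‖∫ r in s..t, g r‖ ^ 2 ≤ I ^ 2 := by gcongr
    _ = I ^ 2 / |t - s| * |t - s| := by field_simp
    _ ≤ ‖g‖ ^ 2 * |t - s| := by gcongr

/-- A linear functional bounded by `‖K ·‖` is represented by a vector through `K`. -/
theorem exists_inner_eq_of_abs_le {E F : Type*} [AddCommGroup E] [Module ℝ E]
    [NormedAddCommGroup F] [InnerProductSpace ℝ F] [CompleteSpace F] (K : E →ₗ[ℝ] F)
    (L : E →ₗ[ℝ] ℝ) {C : ℝ} (h : ∀ φ, |L φ| ≤ C * ‖K φ‖) :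
    ∃ y : F, ∀ φ, L φ = ⟪y, K φ⟫_ℝ := by
  have hker : LinearMap.ker K ≤ LinearMap.ker L := by
    intro φ hφ
    have h1 : K φ = 0 := hφ
    have := h φ
    rw [h1, norm_zero, mul_zero] at this
    exact abs_nonpos_iff.1 this
  obtain ⟨ℓ, hℓ⟩ : ∃ ℓ : LinearMap.range K →ₗ[ℝ] ℝ, ∀ φ, ℓ (K.rangeRestrict φ) = L φ := by
    obtain ⟨s, hs⟩ := K.rangeRestrict.exists_rightInverse_of_surjective K.range_rangeRestrict
    refine ⟨L ∘ₗ s, fun φ => ?_⟩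
    have h1 : K.rangeRestrict (s (K.rangeRestrict φ)) = K.rangeRestrict φ :=
      LinearMap.congr_fun hs _
    have h2 : s (K.rangeRestrict φ) - φ ∈ LinearMap.ker K := by
      rw [LinearMap.mem_ker, map_sub, sub_eq_zero]
      exact congrArg Subtype.val h1
    have h3 := hker h2
    rw [LinearMap.mem_ker, map_sub, sub_eq_zero] at h3
    exact h3
  let ℓc : StrongDual ℝ (LinearMap.range K) := ℓ.mkContinuous C (by
    rintro ⟨_, φ, rfl⟩
    have := h φ
    rw [← hℓ φ] at this
    exact this)
  obtain ⟨ℓe, hℓe, -⟩ := exists_extension_norm_eq (LinearMap.range K) ℓc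
  refine ⟨(InnerProductSpace.toDual ℝ F).symm ℓe, fun φ => ?_⟩
  rw [InnerProductSpace.toDual_symm_apply, ← hℓ φ]
  exact (hℓe (K.rangeRestrict φ)).symm

variable {V H : Type*} [NormedAddCommGroup V] [InnerProductSpace ℝ V]
  [NormedAddCommGroup H] [InnerProductSpace ℝ H]

theorem eq_of_forall_inner_denseRange {j : V →L[ℝ] H} (hj : DenseRange j) {x y : H}
    (h : ∀ w, ⟪x, j w⟫_ℝ = ⟪y, j w⟫_ℝ) : x = y := by
  refine ext_inner_right ℝ fun z => ?_
  refine hj.induction_on (p := fun z => ⟪x, z⟫_ℝ = ⟪y, z⟫_ℝ) z ?_ h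
  exact isClosed_eq (by fun_prop) (by fun_prop)

/-- Bounded functions that are continuous when tested against a dense set are weakly
continuous. -/
theorem continuousOn_inner_of_denseRange {j : V →L[ℝ] H} (hj : DenseRange j) {s : Set ℝ}
    {u : ℝ → H} {M : ℝ} (hM : ∀ t ∈ s, ‖u t‖ ≤ M)
    (h : ∀ w, ContinuousOn (fun t => ⟪u t, j w⟫_ℝ) s) (x : H) :
    ContinuousOn (fun t => ⟪u t, x⟫_ℝ) s := by
  refine continuousOn_of_uniform_approx_of_continuousOn fun ε hε => ?_
  obtain ⟨δ, hδ, hδε⟩ := Metric.mem_uniformity_dist.1 hε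
  obtain ⟨w, hw⟩ := hj.exists_dist_lt x (ε := δ / (|M| + 1)) (by positivity)
  refine ⟨fun t => ⟪u t, j w⟫_ℝ, h w, fun t ht => hδε ?_⟩
  rw [Real.dist_eq, ← inner_sub_right]
  calc |⟪u t, x - j w⟫_ℝ| ≤ ‖u t‖ * ‖x - j w‖ := abs_real_inner_le_norm _ _
    _ ≤ |M| * ‖x - j w‖ := by gcongr; exact (hM t ht).trans (le_abs_self M)
    _ ≤ (|M| + 1) * ‖x - j w‖ := by gcongr; linarith
    _ < (|M| + 1) * (δ / (|M| + 1)) := by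
      gcongr
      rwa [← dist_eq_norm]
    _ = δ := by field_simp

/-- A functional on `V` bounded by the norm of `H` comes from an element of `H` with the same
bound, when `V` is dense in `H`. -/
theorem exists_inner_eq_of_denseRange [CompleteSpace H] {j : V →L[ℝ] H} (hj : DenseRange j)
    {G : V} {R : ℝ} (hR : 0 ≤ R) (h : ∀ w, |⟪G, w⟫_ℝ| ≤ R * ‖j w‖) :
    ∃ u : H, (∀ w, ⟪u, j w⟫_ℝ = ⟪G, w⟫_ℝ) ∧ ‖u‖ ≤ R := by
  obtain ⟨u, hu⟩ := exists_inner_eq_of_abs_le (j : V →ₗ[ℝ] H) ((innerForm V G) : V →ₗ[ℝ] ℝ)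
    (C := R) h
  refine ⟨u, fun w => (hu w).symm, ?_⟩
  have h1 : ∀ x : H, |⟪u, x⟫_ℝ| ≤ R * ‖x‖ := by
    intro x
    refine hj.induction_on (p := fun x => |⟪u, x⟫_ℝ| ≤ R * ‖x‖) x ?_ fun w => ?_
    · exact isClosed_le (by fun_prop) (by fun_prop)
    · have := h w
      rwa [show ⟪G, w⟫_ℝ = ⟪u, j w⟫_ℝ from hu w] at this
  have h2 := h1 u
  rw [real_inner_self_eq_norm_sq, abs_of_nonneg (sq_nonneg _), sq] at h2
  rcases (norm_nonneg u).eq_or_lt with h0 | h0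
  · rw [← h0]; exact hR
  · exact le_of_mul_le_mul_right h2 h0

/-- `L²` functions do not dominate a multiple of `|t - s|^(-1/2)` near a point `s` of the
interval, as `(t - s)⁻¹` is not integrable there. The set `E` of full measure allows to avoid
exceptional times. -/
theorem exists_norm_sq_mul_lt {X : Type*} [NormedAddCommGroup X]
    (v : Lp X 2 (volume : Measure ℝ)) {a b s δ : ℝ} (hab : a < b) (hs : s ∈ Icc a b) (hδ : 0 < δ)
    {E : Set ℝ} (hE : ∀ᵐ t ∂volume.restrict (Ioo a b), t ∈ E) {K : ℝ} (hK : 0 < K) :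
    ∃ t ∈ E ∩ Ioo a b, |t - s| < δ ∧ ‖v t‖ ^ 2 * |t - s| < K := by
  by_contra! hcon
  obtain ⟨e, hes, he⟩ : ∃ e, s ≠ e ∧ ∀ t ∈ uIoc s e, t ≠ s → t ≠ e → t ∈ Ioo a b ∧ |t - s| < δ := by
    rcases hs.2.lt_or_eq with hsb | rfl
    · refine ⟨min (s + δ) b, (lt_min (by linarith) hsb).ne, fun t ht _ hte => ?_⟩
      rw [uIoc_of_le (lt_min (by linarith) hsb).le] at ht
      have h1 : t < min (s + δ) b := lt_of_le_of_ne ht.2 hte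
      refine ⟨⟨hs.1.trans_lt ht.1, h1.trans_le (min_le_right _ _)⟩, ?_⟩
      rw [abs_of_pos (sub_pos.2 ht.1)]
      linarith [h1.trans_le (min_le_left (s + δ) b)]
    · have hmax : max (s - δ) a < s := max_lt (by linarith) hab
      refine ⟨max (s - δ) a, hmax.ne', fun t ht hts _ => ?_⟩
      rw [uIoc_of_ge hmax.le] at ht
      have h1 : t < s := lt_of_le_of_ne ht.2 hts
      refine ⟨⟨(le_max_right _ _).trans_lt ht.1, h1⟩, ?_⟩
      rw [abs_of_neg (sub_neg.2 h1)]
      linarith [(le_max_left (s - δ) a).trans_lt ht.1]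
  have hint : IntervalIntegrable (fun t => (t - s)⁻¹) volume s e := by
    rw [intervalIntegrable_iff]
    refine Integrable.mono' (((integrable_norm_sq v).const_mul K⁻¹).integrableOn)
      (by fun_prop) ?_
    rw [ae_restrict_iff' measurableSet_uIoc]
    rw [ae_restrict_iff' measurableSet_Ioo] at hE
    have hs0 : ∀ᵐ t : ℝ, t ≠ s := by simp [ae_iff]
    have he0 : ∀ᵐ t : ℝ, t ≠ e := by simp [ae_iff]
    filter_upwards [hE, hs0, he0] with t h1 h2 h3 h4
    obtain ⟨h5, h6⟩ := he t h4 h2 h3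
    have h7 := hcon t ⟨h1 h5, h5⟩ h6
    have h8 : 0 < |t - s| := abs_pos.2 (sub_ne_zero.2 h2)
    rw [norm_inv, Real.norm_eq_abs, inv_le_iff_one_le_mul₀ h8, mul_assoc,
      ← inv_mul_cancel₀ hK.ne']
    gcongr
  rw [intervalIntegrable_sub_inv_iff] at hint
  rcases hint with h | h
  · exact hes h
  · exact h left_mem_uIcc

variable [CompleteSpace V] [CompleteSpace H]

/-- The inclusion `V → H ≅ H' → V'` composed with the Riesz isomorphism `V' ≅ V`. -/
def rieszIncl (j : V →L[ℝ] H) : V →L[ℝ] V := (ContinuousLinearMap.adjoint j).comp j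

theorem inner_rieszIncl (j : V →L[ℝ] H) (x y : V) : ⟪rieszIncl j x, y⟫_ℝ = ⟪j x, j y⟫_ℝ :=
  ContinuousLinearMap.adjoint_inner_left j y (j x)

theorem inner_rieszIncl_right (j : V →L[ℝ] H) (x y : V) :
    ⟪x, rieszIncl j y⟫_ℝ = ⟪j x, j y⟫_ℝ :=
  ContinuousLinearMap.adjoint_inner_right j x (j y)

/-- Functions in `L²((a, b); V)` with weak derivative in `L²((a, b); V')` (in Riesz
representation) have a continuous representative in `H`, which satisfies the energy identity.
The representative `u t` is the functional that the primitive of `g` at time `t` defines on `H`;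
it is weakly continuous, and strongly continuous since its norm is the square root of the
primitive of `2 ⟪g, v⟫`. -/
theorem exists_continuousOn_rep {j : V →L[ℝ] H} (hj : DenseRange j) {a b : ℝ} (hab : a < b)
    (v g : L2t V a b) (hvg : IsTimeDeriv (rieszIncl j) v g) :
    ∃ u : ℝ → H, ContinuousOn u (Icc a b) ∧
      (∀ᵐ t ∂volume.restrict (Ioo a b), u t = j (v t)) ∧
      (∀ t ∈ Icc a b, ∀ w, ⟪u t, j w⟫_ℝ = ⟪u a, j w⟫_ℝ + ⟪∫ s in Ioo a t, g s, w⟫_ℝ) ∧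
      ∀ t ∈ Icc a b, ‖u t‖ ^ 2 = ‖u a‖ ^ 2 + 2 * ∫ s in Ioo a t, ⟪g s, v s⟫_ℝ := by
  set vh := extendZero v
  set gh := extendZero g
  have hvh : ∀ᵐ t ∂volume.restrict (Ioo a b), vh t = v t := extendZero_ae_eq v
  have hgh : ∀ᵐ t ∂volume.restrict (Ioo a b), gh t = g t := extendZero_ae_eq g
  -- `S v` is a primitive `G`
  have hSv : IntegrableOn (fun t => rieszIncl j (v t)) (Ioo a b) :=
    (rieszIncl j).integrable_comp (integrable_of_L2t v)
  obtain ⟨c, hc⟩ := exists_ae_eq_primitive hab hSv (integrable_extendZero g) (by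
    intro ψ hψ
    rw [hvg ψ hψ.contDiff hψ.hasCompactSupport hψ.tsupport_subset]
    congr 1
    refine integral_congr_ae ?_
    filter_upwards [hgh] with t ht
    rw [ht])
  set G : ℝ → V := fun t => c + ∫ s in a..t, gh s with hG
  have hGc : Continuous G := continuous_const.add ((integrable_extendZero g).continuous_primitive a)
  -- `‖j v‖²` is a primitive `Q`
  have hp : Integrable (fun t => 2 * ⟪gh t, vh t⟫_ℝ) := (L2.integrable_inner gh vh).const_mul 2
  have hq : IntegrableOn (fun t => ‖j (v t)‖ ^ 2) (Ioo a b) := by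
    refine (integrable_norm_sq (j.compLp v)).congr ?_
    filter_upwards [j.coeFn_compLp v] with t ht
    rw [ht]
  obtain ⟨d, hd⟩ := exists_ae_eq_primitive hab hq hp (by
    intro ψ hψ
    have h1 := integral_deriv_mul_inner_eq (S := rieszIncl j)
      (fun x y => by rw [inner_rieszIncl, inner_rieszIncl_right]) hab vh gh (c := c)
      (by filter_upwards [hc, hvh] with t h1 h2; rw [h2]; exact h1) hψ
    have h2 := hψ.setIntegral_smul (fun t => 2 * ⟪gh t, vh t⟫_ℝ)
    have h3 := hψ.deriv.setIntegral_smul (fun t => ⟪rieszIncl j (vh t), vh t⟫_ℝ)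
    simp only [smul_eq_mul] at h2 h3 ⊢
    rw [h2, ← h1, ← h3]
    refine integral_congr_ae ?_
    filter_upwards [hvh] with t ht
    rw [ht, inner_rieszIncl, real_inner_self_eq_norm_sq])
  set Q : ℝ → ℝ := fun t => d + ∫ s in a..t, 2 * ⟪gh s, vh s⟫_ℝ with hQ
  have hQc : Continuous Q := continuous_const.add (hp.continuous_primitive a)
  -- the good times
  set E : Set ℝ := {t | vh t = v t ∧ rieszIncl j (v t) = G t ∧ ‖j (v t)‖ ^ 2 = Q t} with hEdef
  have hE : ∀ᵐ t ∂volume.restrict (Ioo a b), t ∈ E := by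
    filter_upwards [hvh, hc, hd] with t h1 h2 h3 using ⟨h1, h2, h3⟩
  have hcl := Icc_subset_closure_of_ae hab hE
  have hQ0 : ∀ t ∈ Icc a b, 0 ≤ Q t := by
    intro t ht
    have : closure (E ∩ Ioo a b) ⊆ {t | 0 ≤ Q t} :=
      closure_minimal (fun t ht => by
        show 0 ≤ Q t
        rw [← ht.1.2.2]; exact sq_nonneg _) (isClosed_le continuous_const hQc)
    exact this (hcl ht)
  have hGw : ∀ t ∈ Icc a b, ∀ w, |⟪G t, w⟫_ℝ| ≤ √(Q t) * ‖j w‖ := by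
    intro t ht w
    have : closure (E ∩ Ioo a b) ⊆ {t | |⟪G t, w⟫_ℝ| ≤ √(Q t) * ‖j w‖} := by
      refine closure_minimal (fun t ht => ?_) (isClosed_le (by fun_prop) (by fun_prop))
      show |⟪G t, w⟫_ℝ| ≤ √(Q t) * ‖j w‖
      rw [← ht.1.2.2, ← ht.1.2.1, inner_rieszIncl, Real.sqrt_sq (norm_nonneg _)]
      exact abs_real_inner_le_norm _ _
    exact this (hcl ht)
  choose! u hu using fun t (ht : t ∈ Icc a b) =>
    exists_inner_eq_of_denseRange hj (Real.sqrt_nonneg (Q t)) (hGw t ht)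
  have huE : ∀ t ∈ E ∩ Ioo a b, u t = j (v t) := by
    intro t ht
    refine eq_of_forall_inner_denseRange hj fun w => ?_
    rw [(hu t (Ioo_subset_Icc_self ht.2)).1 w, ← ht.1.2.1, inner_rieszIncl]
  obtain ⟨M, hM⟩ : ∃ M, ∀ t ∈ Icc a b, ‖u t‖ ≤ M := by
    obtain ⟨M, hM⟩ := isCompact_Icc.exists_bound_of_continuousOn
      (hQc.sqrt.continuousOn (s := Icc a b))
    exact ⟨M, fun t ht => (hu t ht).2.trans ((le_abs_self _).trans (hM t ht))⟩
  have hweak : ∀ x, ContinuousOn (fun t => ⟪u t, x⟫_ℝ) (Icc a b) :=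
    continuousOn_inner_of_denseRange hj hM fun w =>
      ContinuousOn.congr (f := fun t => ⟪G t, w⟫_ℝ) (by fun_prop) fun t ht => (hu t ht).1 w
  -- the norm does not drop in the weak limit: if `‖u s‖² < Q s`, then
  -- `Q t - ⟪u t, u s⟫ = ⟪G t - G s, v t⟫` stays above some `ε > 0` for good times `t` near `s`,
  -- and since `‖G t - G s‖² ≤ ‖g‖² |t - s|`, the function `‖v‖²` dominates a multiple of
  -- `|t - s|⁻¹` there
  have hnorm : ∀ t ∈ Icc a b, ‖u t‖ ^ 2 = Q t := by
    intro s hs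
    refine le_antisymm ?_ ?_
    · calc ‖u s‖ ^ 2 ≤ √(Q s) ^ 2 := by gcongr; exact (hu s hs).2
        _ = Q s := Real.sq_sqrt (hQ0 s hs)
    · by_contra! hlt
      set ε := (Q s - ‖u s‖ ^ 2) / 2 with hε
      have hε0 : 0 < ε := by rw [hε]; linarith
      have hcont : ContinuousOn (fun t => Q t - ⟪u t, u s⟫_ℝ) (Icc a b) :=
        hQc.continuousOn.sub (hweak (u s))
      have hval : ε < Q s - ⟪u s, u s⟫_ℝ := by
        rw [real_inner_self_eq_norm_sq, hε]; linarith
      obtain ⟨δ, hδ, hδ'⟩ := Metric.mem_nhdsWithin_iff.1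
        ((hcont s hs).eventually (lt_mem_nhds hval))
      obtain ⟨t, ht, hts, hKt⟩ := exists_norm_sq_mul_lt vh hab hs hδ hE
        (K := ε ^ 2 / (‖gh‖ ^ 2 + 1)) (by positivity)
      have htI : t ∈ Icc a b := Ioo_subset_Icc_self ht.2
      have h1 : ε < Q t - ⟪u t, u s⟫_ℝ := hδ' ⟨by rwa [Metric.mem_ball, Real.dist_eq], htI⟩
      have h2 : Q t - ⟪u t, u s⟫_ℝ = ⟪G t - G s, v t⟫_ℝ := by
        rw [real_inner_comm, huE t ht, (hu s hs).1, inner_sub_left, ← ht.1.2.2, ← ht.1.2.1,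
          inner_rieszIncl, real_inner_self_eq_norm_sq]
      have h3 : G t - G s = ∫ r in s..t, gh r := by
        rw [hG]
        simp only
        rw [add_sub_add_left_eq_sub, intervalIntegral.integral_interval_sub_left
          (intervalIntegrable_of_L2 _ _ _) (intervalIntegrable_of_L2 _ _ _)]
      have h4 : ε < ‖G t - G s‖ * ‖v t‖ :=
        (h1.trans_eq h2).trans_le (real_inner_le_norm _ _)
      have h5 : ‖G t - G s‖ ^ 2 ≤ ‖gh‖ ^ 2 * |t - s| := by
        rw [h3]; exact norm_intervalIntegral_sq_le gh s t
      have h6 : ε ^ 2 < ε ^ 2 := by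
        calc ε ^ 2 < (‖G t - G s‖ * ‖v t‖) ^ 2 := by gcongr
          _ = ‖G t - G s‖ ^ 2 * ‖v t‖ ^ 2 := by ring
          _ ≤ ‖gh‖ ^ 2 * |t - s| * ‖v t‖ ^ 2 := by gcongr
          _ ≤ (‖gh‖ ^ 2 + 1) * (‖v t‖ ^ 2 * |t - s|) := by
            nlinarith [mul_nonneg (sq_nonneg ‖v t‖) (abs_nonneg (t - s))]
          _ ≤ (‖gh‖ ^ 2 + 1) * (ε ^ 2 / (‖gh‖ ^ 2 + 1)) := by
            rw [ht.1.1] at hKt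
            gcongr
          _ = ε ^ 2 := by field_simp
      exact lt_irrefl _ h6
  have haI : a ∈ Icc a b := left_mem_Icc.2 hab.le
  have hIoo : ∀ t ∈ Icc a b, Ioo a t ⊆ Ioo a b := fun t ht => Ioo_subset_Ioo_right ht.2
  refine ⟨u, ?_, ?_, ?_, ?_⟩
  · intro s hs
    rw [ContinuousWithinAt, tendsto_iff_norm_sub_tendsto_zero]
    have h1 : Tendsto (fun t => Q t + Q s - 2 * ⟪u t, u s⟫_ℝ) (𝓝[Icc a b] s)
        (𝓝 (Q s + Q s - 2 * ⟪u s, u s⟫_ℝ)) :=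
      ((hQc.continuousWithinAt.tendsto).add_const _).sub ((hweak (u s) s hs).const_mul 2)
    have h2 : Q s + Q s - 2 * ⟪u s, u s⟫_ℝ = 0 := by
      rw [real_inner_self_eq_norm_sq, hnorm s hs]; ring
    rw [h2] at h1
    have h3 := h1.sqrt
    rw [Real.sqrt_zero] at h3
    refine h3.congr' ?_
    filter_upwards [self_mem_nhdsWithin] with t ht
    rw [← hnorm t ht, ← hnorm s hs, Real.sqrt_eq_iff_mul_self_eq (by
      have := norm_sub_sq_real (u t) (u s)
      nlinarith [sq_nonneg ‖u t - u s‖]) (norm_nonneg _), ← sq, norm_sub_sq_real]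
    ring
  · rw [ae_restrict_iff' measurableSet_Ioo] at hE ⊢
    filter_upwards [hE] with t h1 h2 using huE t ⟨h1 h2, h2⟩
  · intro t ht w
    rw [(hu t ht).1, (hu a haI).1, hG]
    simp only
    rw [intervalIntegral.integral_same, add_zero, inner_add_left,
      intervalIntegral.integral_of_le ht.1, integral_Ioc_eq_integral_Ioo]
    congr 2
    exact integral_congr_ae (ae_restrict_of_ae_restrict_of_subset (hIoo t ht) hgh)
  · intro t ht
    rw [hnorm t ht, hnorm a haI, hQ]
    simp only
    rw [intervalIntegral.integral_same, add_zero,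
      intervalIntegral.integral_of_le ht.1, integral_Ioc_eq_integral_Ioo, integral_const_mul]
    congr 2
    refine integral_congr_ae ?_
    filter_upwards [ae_restrict_of_ae_restrict_of_subset (hIoo t ht) hgh,
      ae_restrict_of_ae_restrict_of_subset (hIoo t ht) hvh] with s h1 h2
    rw [h1, h2]

end ContinuousRepresentative

/-! ### The abstract parabolic problem -/

section Abstract

open scoped Topology
open Filter

variable {V H : Type*} [NormedAddCommGroup V] [InnerProductSpace ℝ V]
  [NormedAddCommGroup H] [InnerProductSpace ℝ H]

/-- A time-dependent family of bilinear forms on `V` that is weakly measurable, bounded by `M` and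
satisfies the Gårding inequality `α ‖v‖² ≤ A t v v + lam ‖j v‖²` on `(a, b)`. -/
structure IsGardingFamily (j : V →L[ℝ] H) (a b M α lam : ℝ) (A : ℝ → V →L[ℝ] V →L[ℝ] ℝ) :
    Prop where
  meas : ∀ x y, AEStronglyMeasurable (fun t => A t x y) (volume.restrict (Ioo a b))
  bound_nonneg : 0 ≤ M
  bound : ∀ᵐ t ∂volume.restrict (Ioo a b), ‖A t‖ ≤ M
  pos : 0 < α
  lam_nonneg : 0 ≤ lam
  garding : ∀ᵐ t ∂volume.restrict (Ioo a b), ∀ v, α * ‖v‖ ^ 2 ≤ A t v v + lam * ‖j v‖ ^ 2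

variable {j : V →L[ℝ] H} {a b M α lam : ℝ} {A : ℝ → V →L[ℝ] V →L[ℝ] ℝ}

/-- The form `(y, φ) ↦ ∫ A t (y t) (φ t) dt` on `L²((a, b); V)`. -/
def IsGardingFamily.form (h : IsGardingFamily j a b M α lam A) :
    L2t V a b →L[ℝ] L2t V a b →L[ℝ] ℝ :=
  liftForm _ A h.meas M h.bound_nonneg h.bound

theorem IsGardingFamily.form_apply (h : IsGardingFamily j a b M α lam A) (y φ : L2t V a b) :
    h.form y φ = ∫ t in Ioo a b, A t (y t) (φ t) := rfl

theorem IsGardingFamily.abs_form_le (h : IsGardingFamily j a b M α lam A) (y φ : L2t V a b) :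
    |h.form y φ| ≤ M * ‖y‖ * ‖φ‖ := abs_integral_bilin_le h.bound_nonneg h.bound y φ

theorem IsGardingFamily.integrable (h : IsGardingFamily j a b M α lam A) (y φ : L2t V a b) :
    IntegrableOn (fun t => A t (y t) (φ t)) (Ioo a b) := integrable_bilin h.meas h.bound y φ

/-- `y` solves `y' + A y = f`, where `g` is the Riesz representation of `y'`. -/
def IsGardingFamily.Solves (h : IsGardingFamily j a b M α lam A) (y g f : L2t V a b) : Prop :=
  ∀ φ : L2t V a b, ⟪g, φ⟫_ℝ + h.form y φ = ⟪f, φ⟫_ℝ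

/-- The equation tested with `y` cut off to `(a, t)`. -/
theorem IsGardingFamily.Solves.setIntegral_eq {h : IsGardingFamily j a b M α lam A}
    {y g f : L2t V a b} (hs : h.Solves y g f) {t : ℝ} (ht : t ∈ Icc a b) :
    ∫ s in Ioo a t, ⟪g s, y s⟫_ℝ = ∫ s in Ioo a t, (⟪f s, y s⟫_ℝ - A s (y s) (y s)) := by
  have hsub : Ioo a t ⊆ Ioo a b := Ioo_subset_Ioo_right ht.2
  set φ : L2t V a b := ((Lp.memLp y).indicator (measurableSet_Ioo (a := a) (b := t))).toLp _
  have hφ : ∀ᵐ s ∂volume.restrict (Ioo a b), φ s = (Ioo a t).indicator y s :=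
    MemLp.coeFn_toLp _
  have key : ∀ F : ℝ → V → ℝ, (∀ s, F s 0 = 0) →
      ∫ s in Ioo a b, F s (φ s) = ∫ s in Ioo a t, F s (y s) := by
    intro F hF
    have : ∫ s in Ioo a b, F s (φ s) =
        ∫ s in Ioo a b, (Ioo a t).indicator (fun s => F s (y s)) s := by
      refine integral_congr_ae ?_
      filter_upwards [hφ] with s hs'
      rw [hs']
      by_cases hmem : s ∈ Ioo a t <;> simp [hmem, hF]
    rw [this, setIntegral_indicator measurableSet_Ioo, inter_eq_right.2 hsub]
  have h1 := hs φ
  rw [L2.inner_def, L2.inner_def, h.form_apply, key (fun s x => ⟪g s, x⟫_ℝ) (by simp),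
    key (fun s x => ⟪f s, x⟫_ℝ) (by simp), key (fun s x => A s (y s) x) (by simp)] at h1
  rw [integral_sub ((L2.integrable_inner f y).mono_measure (Measure.restrict_mono hsub le_rfl))
    ((h.integrable y y).mono_set hsub), ← h1]
  ring

theorem IsGardingFamily.integrableOn_sub (h : IsGardingFamily j a b M α lam A)
    (y f : L2t V a b) {t : ℝ} (ht : t ∈ Icc a b) :
    IntegrableOn (fun s => ⟪f s, y s⟫_ℝ - A s (y s) (y s)) (Ioo a t) :=
  IntegrableOn.mono_set ((L2.integrable_inner f y).sub (h.integrable y y))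
    (Ioo_subset_Ioo_right ht.2)

/-- The equation tested with the time derivative itself. -/
theorem IsGardingFamily.Solves.norm_deriv_le {h : IsGardingFamily j a b M α lam A}
    {y g f : L2t V a b} (hs : h.Solves y g f) : ‖g‖ ≤ ‖f‖ + M * ‖y‖ := by
  have h1 := hs g
  rw [real_inner_self_eq_norm_sq] at h1
  have h2 := real_inner_le_norm f g
  have h3 := (abs_le.1 (h.abs_form_le y g)).1
  rcases (norm_nonneg g).eq_or_lt with h0 | h0
  · rw [← h0]
    have := h.bound_nonneg
    positivity
  · refine le_of_mul_le_mul_right ?_ h0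
    nlinarith

/-- The integral form of Grönwall's inequality. -/
theorem le_mul_exp_of_le_add_integral {ρ : ℝ → ℝ} (hρ : Continuous ρ) (hρ0 : ∀ t, 0 ≤ ρ t)
    {a b C K : ℝ} (hK : 0 < K) (hC : 0 ≤ C)
    (h : ∀ t ∈ Icc a b, ρ t ≤ C + K * ∫ s in a..t, ρ s) :
    ∀ t ∈ Icc a b, ρ t ≤ C * Real.exp (K * (b - a)) := by
  intro t ht
  have hd : ∀ t, HasDerivAt (fun t => ∫ s in a..t, ρ s) (ρ t) t := fun t =>
    (hρ.integral_hasStrictDerivAt a t).hasDerivAt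
  have hpos : ∀ x ∈ Icc a b, 0 ≤ ∫ s in a..x, ρ s := fun x hx =>
    intervalIntegral.integral_nonneg hx.1 fun s _ => hρ0 s
  have h1 := norm_le_gronwallBound_of_norm_deriv_right_le (f := fun t => ∫ s in a..t, ρ s)
    (f' := ρ) (δ := 0) (K := K) (ε := C) (a := a) (b := b)
    (fun x _ => (hd x).continuousAt.continuousWithinAt)
    (fun x _ => (hd x).hasDerivWithinAt) (by simp)
    (fun x hx => by
      have hx' := Ico_subset_Icc_self hx
      rw [Real.norm_of_nonneg (hρ0 x), Real.norm_of_nonneg (hpos x hx')]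
      linarith [h x hx']) t ht
  rw [Real.norm_of_nonneg (hpos t ht), gronwallBound_of_K_ne_0 hK.ne'] at h1
  calc ρ t ≤ C + K * ∫ s in a..t, ρ s := h t ht
    _ ≤ C + K * (0 * Real.exp (K * (t - a)) + C / K * (Real.exp (K * (t - a)) - 1)) := by gcongr
    _ = C * Real.exp (K * (t - a)) := by field_simp; ring
    _ ≤ C * Real.exp (K * (b - a)) := by
      gcongr
      exact ht.2

/-- The constant of the energy estimate on an interval of length `L`. -/
def energyConst (M α lam L : ℝ) : ℝ :=
  Real.exp ((2 * lam + 1) * L) * (1 + α⁻¹) +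
    (α⁻¹ * (1 + 2 * lam * L * Real.exp ((2 * lam + 1) * L)) * (1 + α⁻¹)) * (1 + 2 * M ^ 2) + 2

theorem energyConst_pos (M : ℝ) {α lam L : ℝ} (hα : 0 < α) (hlam : 0 ≤ lam) (hL : 0 ≤ L) :
    0 < energyConst M α lam L := by
  unfold energyConst; positivity

variable [CompleteSpace V] [CompleteSpace H]

/-- The energy identity, for an arbitrary continuous representative. -/
theorem norm_sq_eq_of_isTimeDeriv (hj : DenseRange j) (hab : a < b) {v g : L2t V a b}
    (hvg : IsTimeDeriv (rieszIncl j) v g) {u : ℝ → H} (hu : ContinuousOn u (Icc a b))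
    (huv : ∀ᵐ t ∂volume.restrict (Ioo a b), u t = j (v t)) :
    ∀ t ∈ Icc a b, ‖u t‖ ^ 2 = ‖u a‖ ^ 2 + 2 * ∫ s in Ioo a t, ⟪g s, v s⟫_ℝ := by
  obtain ⟨u', hu', hu'v, -, hen⟩ := exists_continuousOn_rep hj hab v g hvg
  have heq : EqOn u u' (Icc a b) := eqOn_Icc_of_ae_eq hab hu hu' (by
    filter_upwards [huv, hu'v] with t h1 h2 using h1.trans h2.symm)
  intro t ht
  rw [heq ht, heq (left_mem_Icc.2 hab.le)]
  exact hen t ht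

section Estimates

variable {h : IsGardingFamily j a b M α lam A} {y g f : L2t V a b} {u : ℝ → H}

theorem IsGardingFamily.Solves.norm_sq_eq (hs : h.Solves y g f) (hj : DenseRange j) (hab : a < b)
    (hyg : IsTimeDeriv (rieszIncl j) y g) (hu : ContinuousOn u (Icc a b))
    (huy : ∀ᵐ t ∂volume.restrict (Ioo a b), u t = j (y t)) {t : ℝ} (ht : t ∈ Icc a b) :
    ‖u t‖ ^ 2 = ‖u a‖ ^ 2 + 2 * ∫ s in Ioo a t, (⟪f s, y s⟫_ℝ - A s (y s) (y s)) := by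
  rw [norm_sq_eq_of_isTimeDeriv hj hab hyg hu huy t ht, hs.setIntegral_eq ht]

theorem setIntegral_Ioo_le_of_nonneg {F : ℝ → ℝ} (hF : IntegrableOn F (Ioo a b))
    (hF0 : ∀ t, 0 ≤ F t) {t : ℝ} (ht : t ∈ Icc a b) :
    ∫ s in Ioo a t, F s ≤ ∫ s in Ioo a b, F s :=
  setIntegral_mono_set hF (Eventually.of_forall hF0)
    (Ioo_subset_Ioo_right ht.2).eventuallyLE

/-- Energy inequality: integrate the Gårding inequality against the solution. -/
theorem IsGardingFamily.Solves.norm_sq_add_le (hs : h.Solves y g f) (hj : DenseRange j)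
    (hab : a < b) (hyg : IsTimeDeriv (rieszIncl j) y g) (hu : ContinuousOn u (Icc a b))
    (huy : ∀ᵐ t ∂volume.restrict (Ioo a b), u t = j (y t)) {t : ℝ} (ht : t ∈ Icc a b) :
    ‖u t‖ ^ 2 + α * ∫ s in Ioo a t, ‖y s‖ ^ 2 ≤
      (‖u a‖ ^ 2 + α⁻¹ * ‖f‖ ^ 2) + 2 * lam * ∫ s in Ioo a t, ‖u s‖ ^ 2 := by
  have hsub : Ioo a t ⊆ Ioo a b := Ioo_subset_Ioo_right ht.2
  have iu : IntegrableOn (fun s => ‖u s‖ ^ 2) (Ioo a t) :=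
    (((hu.norm.pow 2).mono (Icc_subset_Icc_right ht.2)).integrableOn_Icc).mono_set
      Ioo_subset_Icc_self
  have iy : IntegrableOn (fun s => ‖y s‖ ^ 2) (Ioo a t) :=
    IntegrableOn.mono_set (integrable_norm_sq y) hsub
  have jf : IntegrableOn (fun s => ‖f s‖ ^ 2) (Ioo a t) :=
    IntegrableOn.mono_set (integrable_norm_sq f) hsub
  have hα := h.pos
  have hpt : ∀ᵐ s ∂volume.restrict (Ioo a t), 2 * (⟪f s, y s⟫_ℝ - A s (y s) (y s)) ≤
      (α⁻¹ * ‖f s‖ ^ 2 - α * ‖y s‖ ^ 2) + 2 * lam * ‖u s‖ ^ 2 := by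
    filter_upwards [ae_restrict_of_ae_restrict_of_subset hsub h.garding,
      ae_restrict_of_ae_restrict_of_subset hsub huy] with s h1 h2
    have h3 := h1 (y s)
    rw [← h2] at h3
    have h4 := real_inner_le_norm (f s) (y s)
    have h5 : 2 * (‖f s‖ * ‖y s‖) ≤ α⁻¹ * ‖f s‖ ^ 2 + α * ‖y s‖ ^ 2 := by
      have : 0 ≤ α⁻¹ * (‖f s‖ - α * ‖y s‖) ^ 2 := by positivity
      have e : α⁻¹ * (‖f s‖ - α * ‖y s‖) ^ 2 =
          α⁻¹ * ‖f s‖ ^ 2 - 2 * (‖f s‖ * ‖y s‖) + α * ‖y s‖ ^ 2 := by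
        field_simp
        ring
      linarith
    linarith
  have i1 : IntegrableOn (fun s => α⁻¹ * ‖f s‖ ^ 2 - α * ‖y s‖ ^ 2) (Ioo a t) :=
    (jf.const_mul _).sub (iy.const_mul _)
  have hint := integral_mono_ae ((h.integrableOn_sub y f ht).const_mul 2)
    (i1.add (iu.const_mul (2 * lam))) hpt
  rw [integral_const_mul] at hint
  simp only [Pi.add_apply] at hint
  rw [integral_add i1 (iu.const_mul _), integral_sub (jf.const_mul _) (iy.const_mul _),
    integral_const_mul, integral_const_mul, integral_const_mul] at hint
  have hf : ∫ s in Ioo a t, ‖f s‖ ^ 2 ≤ ‖f‖ ^ 2 := by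
    rw [norm_sq_eq_integral f]
    exact setIntegral_Ioo_le_of_nonneg (integrable_norm_sq f) (fun s => sq_nonneg _) ht
  have hf' : α⁻¹ * ∫ s in Ioo a t, ‖f s‖ ^ 2 ≤ α⁻¹ * ‖f‖ ^ 2 := by gcongr
  rw [hs.norm_sq_eq hj hab hyg hu huy ht]
  linarith

/-- The energy estimate. Grönwall's inequality bounds `‖u t‖`, then the energy inequality at the
final time bounds `y`, and the equation bounds the time derivative. -/
theorem IsGardingFamily.Solves.energy_le (hs : h.Solves y g f) (hj : DenseRange j) (hab : a < b)
    (hyg : IsTimeDeriv (rieszIncl j) y g) (hu : ContinuousOn u (Icc a b))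
    (huy : ∀ᵐ t ∂volume.restrict (Ioo a b), u t = j (y t)) {t : ℝ} (ht : t ∈ Icc a b) :
    ‖u t‖ ^ 2 + (‖y‖ ^ 2 + ‖g‖ ^ 2) ≤
      energyConst M α lam (b - a) * (‖u a‖ ^ 2 + ‖f‖ ^ 2) := by
  have hα := h.pos
  have hlam := h.lam_nonneg
  set K := 2 * lam + 1
  set C := ‖u a‖ ^ 2 + α⁻¹ * ‖f‖ ^ 2 with hC
  have hC0 : 0 ≤ C := by positivity
  have hen := fun t ht => hs.norm_sq_add_le hj hab hyg hu huy (t := t) ht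
  have hsup : ∀ t ∈ Icc a b, ‖u t‖ ^ 2 ≤ C * Real.exp (K * (b - a)) := by
    -- extended constantly beyond `[a, b]`, to be continuous on the whole line
    set ρ : ℝ → ℝ := fun t => ‖u (projIcc a b hab.le t)‖ ^ 2 with hρ
    have hρu : ∀ t ∈ Icc a b, ρ t = ‖u t‖ ^ 2 := fun t ht => by
      rw [hρ]; simp only [projIcc_of_mem hab.le ht]
    have hρc : Continuous ρ :=
      ((continuousOn_iff_continuous_domRestrict.1 hu).comp continuous_projIcc).norm.pow 2
    intro t ht
    rw [← hρu t ht]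
    refine le_mul_exp_of_le_add_integral hρc (fun t => sq_nonneg _) (by positivity) hC0
      (fun t ht => ?_) t ht
    have h1 : ∫ s in a..t, ρ s = ∫ s in Ioo a t, ‖u s‖ ^ 2 := by
      rw [intervalIntegral.integral_of_le ht.1, integral_Ioc_eq_integral_Ioo]
      exact setIntegral_congr_fun measurableSet_Ioo fun s hs' =>
        hρu s ⟨hs'.1.le, hs'.2.le.trans ht.2⟩
    rw [h1, hρu t ht]
    have h2 := hen t ht
    have h3 : 0 ≤ α * ∫ s in Ioo a t, ‖y s‖ ^ 2 :=
      mul_nonneg hα.le (integral_nonneg fun s => sq_nonneg _)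
    have h4 : 0 ≤ ∫ s in Ioo a t, ‖u s‖ ^ 2 := integral_nonneg fun s => sq_nonneg _
    linarith
  set e := Real.exp (K * (b - a)) with he
  have he0 : 0 < e := Real.exp_pos _
  set R := ‖u a‖ ^ 2 + ‖f‖ ^ 2 with hR
  have hCR : C ≤ (1 + α⁻¹) * R := by
    have : 0 ≤ α⁻¹ * ‖u a‖ ^ 2 := by positivity
    have : 0 ≤ ‖f‖ ^ 2 := by positivity
    rw [hC, hR]; linarith
  have hL : 0 < b - a := sub_pos.2 hab
  have hy : ‖y‖ ^ 2 ≤ α⁻¹ * (1 + 2 * lam * (b - a) * e) * (1 + α⁻¹) * R := by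
    have h1 := hen b (right_mem_Icc.2 hab.le)
    rw [← norm_sq_eq_integral y] at h1
    have h2 : ∫ s in Ioo a b, ‖u s‖ ^ 2 ≤ (b - a) * (C * e) := by
      have := setIntegral_mono_on (μ := volume) (s := Ioo a b) (f := fun s => ‖u s‖ ^ 2)
        (g := fun _ => C * e)
        (((hu.norm.pow 2).integrableOn_Icc).mono_set Ioo_subset_Icc_self)
        (integrableOn_const measure_Ioo_lt_top.ne) measurableSet_Ioo
        (fun s hs' => hsup s (Ioo_subset_Icc_self hs'))
      rwa [setIntegral_const, Real.volume_real_Ioo_of_le hab.le, smul_eq_mul] at this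
    have h3 : α * ‖y‖ ^ 2 ≤ C + 2 * lam * ((b - a) * (C * e)) := by
      have : 2 * lam * ∫ s in Ioo a b, ‖u s‖ ^ 2 ≤ 2 * lam * ((b - a) * (C * e)) := by gcongr
      linarith [sq_nonneg ‖u b‖]
    calc ‖y‖ ^ 2 = α⁻¹ * (α * ‖y‖ ^ 2) := by field_simp
      _ ≤ α⁻¹ * (C + 2 * lam * ((b - a) * (C * e))) := by gcongr
      _ = α⁻¹ * (1 + 2 * lam * (b - a) * e) * C := by ring
      _ ≤ α⁻¹ * (1 + 2 * lam * (b - a) * e) * ((1 + α⁻¹) * R) := by gcongr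
      _ = _ := by ring
  have hg : ‖g‖ ^ 2 ≤ 2 * R + 2 * M ^ 2 * ‖y‖ ^ 2 := by
    have h1 := hs.norm_deriv_le
    have h2 : ‖g‖ ^ 2 ≤ (‖f‖ + M * ‖y‖) ^ 2 := by gcongr
    have h3 : 0 ≤ ‖u a‖ ^ 2 := sq_nonneg _
    rw [hR]
    nlinarith [sq_nonneg (‖f‖ - M * ‖y‖)]
  have hut : ‖u t‖ ^ 2 ≤ e * (1 + α⁻¹) * R := by
    calc ‖u t‖ ^ 2 ≤ C * e := hsup t ht
      _ ≤ ((1 + α⁻¹) * R) * e := by gcongr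
      _ = _ := by ring
  have hy' : (1 + 2 * M ^ 2) * ‖y‖ ^ 2 ≤
      (1 + 2 * M ^ 2) * (α⁻¹ * (1 + 2 * lam * (b - a) * e) * (1 + α⁻¹) * R) := by gcongr
  have : energyConst M α lam (b - a) * R = e * (1 + α⁻¹) * R +
      (1 + 2 * M ^ 2) * (α⁻¹ * (1 + 2 * lam * (b - a) * e) * (1 + α⁻¹) * R) + 2 * R := by
    unfold energyConst; ring
  rw [this]
  linarith

/-- The initial value is controlled by the solution: average the energy identity in time. -/
theorem IsGardingFamily.Solves.norm_initial_sq_le (hs : h.Solves y g f) (hj : DenseRange j)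
    (hj1 : ∀ x, ‖j x‖ ≤ ‖x‖) (hab : a < b)
    (hyg : IsTimeDeriv (rieszIncl j) y g) (hu : ContinuousOn u (Icc a b))
    (huy : ∀ᵐ t ∂volume.restrict (Ioo a b), u t = j (y t)) :
    ‖u a‖ ^ 2 ≤ ((b - a)⁻¹ + 1 + 2 * M) * ‖y‖ ^ 2 + ‖f‖ ^ 2 := by
  have hM := h.bound_nonneg
  set R := ‖f‖ ^ 2 + (1 + 2 * M) * ‖y‖ ^ 2 with hR
  have hpt : ∀ t ∈ Icc a b, ‖u a‖ ^ 2 ≤ ‖u t‖ ^ 2 + R := by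
    intro t ht
    have hsub : Ioo a t ⊆ Ioo a b := Ioo_subset_Ioo_right ht.2
    have i2 : IntegrableOn (fun s => ‖f s‖ ^ 2 + (1 + 2 * M) * ‖y s‖ ^ 2) (Ioo a b) :=
      (integrable_norm_sq f).add ((integrable_norm_sq y).const_mul _)
    have h1 : ∫ s in Ioo a t, -(2 * (⟪f s, y s⟫_ℝ - A s (y s) (y s))) ≤
        ∫ s in Ioo a t, (‖f s‖ ^ 2 + (1 + 2 * M) * ‖y s‖ ^ 2) := by
      refine integral_mono_ae ((h.integrableOn_sub y f ht).const_mul 2).neg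
        (i2.mono_set hsub) ?_
      filter_upwards [ae_restrict_of_ae_restrict_of_subset hsub h.bound] with s h1
      have h2 := (abs_le.1 (abs_real_inner_le_norm (f s) (y s))).1
      have h3 : A s (y s) (y s) ≤ M * ‖y s‖ ^ 2 := by
        calc A s (y s) (y s) ≤ ‖A s (y s) (y s)‖ := le_abs_self _
          _ ≤ ‖A s‖ * ‖y s‖ * ‖y s‖ := (A s).le_opNorm₂ _ _
          _ ≤ M * ‖y s‖ * ‖y s‖ := by gcongr
          _ = M * ‖y s‖ ^ 2 := by ring
      show -(2 * (⟪f s, y s⟫_ℝ - A s (y s) (y s))) ≤ ‖f s‖ ^ 2 + (1 + 2 * M) * ‖y s‖ ^ 2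
      nlinarith [sq_nonneg (‖f s‖ - ‖y s‖)]
    have h2 := setIntegral_Ioo_le_of_nonneg i2 (fun s => by positivity) ht
    rw [integral_add (integrable_norm_sq f) ((integrable_norm_sq y).const_mul _),
      integral_const_mul, ← norm_sq_eq_integral, ← norm_sq_eq_integral] at h2
    rw [integral_neg, integral_const_mul] at h1
    have h3 := hs.norm_sq_eq hj hab hyg hu huy ht
    linarith
  have hL : 0 < b - a := sub_pos.2 hab
  have iu : IntegrableOn (fun s => ‖u s‖ ^ 2) (Ioo a b) :=
    ((hu.norm.pow 2).integrableOn_Icc).mono_set Ioo_subset_Icc_self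
  have hconst : ∀ c : ℝ, ∫ _ in Ioo a b, c = (b - a) * c := fun c => by
    rw [setIntegral_const, Real.volume_real_Ioo_of_le hab.le, smul_eq_mul]
  have h1 : (b - a) * ‖u a‖ ^ 2 ≤ (∫ s in Ioo a b, ‖u s‖ ^ 2) + (b - a) * R := by
    rw [← hconst, ← hconst R, ← integral_add iu (integrableOn_const measure_Ioo_lt_top.ne)]
    exact setIntegral_mono_on (integrableOn_const measure_Ioo_lt_top.ne)
      (iu.add (integrableOn_const measure_Ioo_lt_top.ne)) measurableSet_Ioo
      fun s hs' => hpt s (Ioo_subset_Icc_self hs')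
  have h2 : ∫ s in Ioo a b, ‖u s‖ ^ 2 ≤ ‖y‖ ^ 2 := by
    rw [norm_sq_eq_integral y]
    refine integral_mono_ae iu (integrable_norm_sq y) ?_
    filter_upwards [huy] with s hs'
    rw [hs']
    gcongr
    exact hj1 _
  calc ‖u a‖ ^ 2 = (b - a)⁻¹ * ((b - a) * ‖u a‖ ^ 2) := by field_simp
    _ ≤ (b - a)⁻¹ * (‖y‖ ^ 2 + (b - a) * R) := by gcongr; linarith
    _ = (b - a)⁻¹ * ‖y‖ ^ 2 + R := by field_simp
    _ = _ := by rw [hR]; ring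

end Estimates

end Abstract

/-! ### Existence for the abstract problem -/

section Existence

open scoped Topology
open Filter

variable {V H : Type*} [NormedAddCommGroup V] [InnerProductSpace ℝ V]
  [NormedAddCommGroup H] [InnerProductSpace ℝ H]

/-- Continuously differentiable `V`-valued functions vanishing at the final time `b`. -/
def finalTest (V : Type*) [NormedAddCommGroup V] [InnerProductSpace ℝ V] (b : ℝ) :
    Submodule ℝ (ℝ → V) where
  carrier := {φ | ContDiff ℝ 1 φ ∧ φ b = 0}
  zero_mem' := ⟨contDiff_const, rfl⟩
  add_mem' := fun {φ ψ} hφ hψ => ⟨hφ.1.add hψ.1, by simp [hφ.2, hψ.2]⟩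
  smul_mem' := fun c φ hφ => ⟨hφ.1.const_smul c, by simp [hφ.2]⟩

theorem memLp_of_continuous {X : Type*} [NormedAddCommGroup X] {φ : ℝ → X} (hφ : Continuous φ)
    (a b : ℝ) : MemLp φ 2 (volume.restrict (Ioo a b)) := by
  obtain ⟨C, hC⟩ := (isCompact_Icc (a := a) (b := b)).exists_bound_of_continuousOn hφ.continuousOn
  refine MemLp.of_bound ?_ C ?_
  · exact hφ.aestronglyMeasurable
  · rw [ae_restrict_iff' measurableSet_Ioo]
    exact Eventually.of_forall fun t ht => hC t (Ioo_subset_Icc_self ht)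

theorem continuous_deriv_of_mem {b : ℝ} (φ : finalTest V b) : Continuous (deriv φ.1) :=
  φ.2.1.continuous_deriv le_rfl

/-- The class in `L²((a, b); V)` of a test function. -/
def finalTestToL2 (V : Type*) [NormedAddCommGroup V] [InnerProductSpace ℝ V] (a b : ℝ) :
    finalTest V b →ₗ[ℝ] L2t V a b where
  toFun φ := (memLp_of_continuous φ.2.1.continuous a b).toLp φ.1
  map_add' _ _ := rfl
  map_smul' _ _ := rfl

/-- The class in `L²((a, b); V)` of the derivative of a test function. -/
def finalTestDeriv (V : Type*) [NormedAddCommGroup V] [InnerProductSpace ℝ V] (a b : ℝ) :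
    finalTest V b →ₗ[ℝ] L2t V a b where
  toFun φ := (memLp_of_continuous (continuous_deriv_of_mem φ) a b).toLp (deriv φ.1)
  map_add' φ ψ := by
    rw [← MemLp.toLp_add]
    refine MemLp.toLp_congr _ _ (Eventually.of_forall fun t => ?_)
    exact deriv_add (φ.2.1.differentiable one_ne_zero t) (ψ.2.1.differentiable one_ne_zero t)
  map_smul' c φ := by
    rw [RingHom.id_apply, ← MemLp.toLp_const_smul]
    refine MemLp.toLp_congr _ _ (Eventually.of_forall fun t => ?_)
    exact deriv_const_smul c (φ.2.1.differentiable one_ne_zero t)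

theorem coeFn_finalTestToL2 {a b : ℝ} (φ : finalTest V b) :
    ∀ᵐ t ∂volume.restrict (Ioo a b), finalTestToL2 V a b φ t = φ.1 t :=
  (memLp_of_continuous φ.2.1.continuous a b).coeFn_toLp

theorem coeFn_finalTestDeriv {a b : ℝ} (φ : finalTest V b) :
    ∀ᵐ t ∂volume.restrict (Ioo a b), finalTestDeriv V a b φ t = deriv φ.1 t :=
  (memLp_of_continuous (continuous_deriv_of_mem φ) a b).coeFn_toLp

/-- The product of a smooth scalar function and a test function. -/
def smulTest {b : ℝ} {m : ℝ → ℝ} (hm : ContDiff ℝ 1 m) (φ : finalTest V b) : finalTest V b :=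
  ⟨fun t => m t • φ.1 t, hm.smul φ.2.1, by simp [φ.2.2]⟩

variable {j : V →L[ℝ] H} {a b M α lam : ℝ} {A : ℝ → V →L[ℝ] V →L[ℝ] ℝ}

/-- The test function `t ↦ ψ t • w`. -/
def scalarTest {ψ : ℝ → ℝ} (hψ : ContDiff ℝ 1 ψ) (hψb : ψ b = 0) (w : V) : finalTest V b :=
  ⟨fun t => ψ t • w, hψ.smul contDiff_const, by simp [hψb]⟩

theorem scalarTest_deriv {ψ : ℝ → ℝ} (hψ : ContDiff ℝ 1 ψ) (hψb : ψ b = 0) (w : V) (t : ℝ) :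
    deriv (scalarTest hψ hψb w).1 t = deriv ψ t • w :=
  deriv_smul_const (hψ.differentiable one_ne_zero t) w

theorem inner_finalTestToL2_scalarTest {ψ : ℝ → ℝ} (hψ : ContDiff ℝ 1 ψ) (hψb : ψ b = 0) (w : V)
    (g : L2t V a b) : ⟪g, finalTestToL2 V a b (scalarTest hψ hψb w)⟫_ℝ =
      ∫ t in Ioo a b, ψ t * ⟪g t, w⟫_ℝ := by
  rw [L2.inner_def]
  refine integral_congr_ae ?_
  filter_upwards [coeFn_finalTestToL2 (a := a) (scalarTest hψ hψb w)] with t ht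
  rw [ht]
  exact real_inner_smul_right _ _ _

/-- Integration by parts of `½ exp (2 lam (t - a)) ‖j φ‖²`, which vanishes at the final time. -/
theorem integral_weight_inner_deriv (hab : a ≤ b) (φ : finalTest V b) (lam : ℝ) :
    - ∫ t in Ioo a b, Real.exp (2 * lam * (t - a)) * ⟪j (φ.1 t), j (deriv φ.1 t)⟫_ℝ =
      1 / 2 * ‖j (φ.1 a)‖ ^ 2 +
        ∫ t in Ioo a b, lam * (Real.exp (2 * lam * (t - a)) * ‖j (φ.1 t)‖ ^ 2) := by
  have hφ : ∀ t, HasDerivAt φ.1 (deriv φ.1 t) t := fun t =>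
    (φ.2.1.differentiable one_ne_zero t).hasDerivAt
  have hc1 : Continuous φ.1 := φ.2.1.continuous
  have hc2 : Continuous (deriv φ.1) := continuous_deriv_of_mem φ
  have hd : ∀ t, HasDerivAt (fun t => 1 / 2 * (Real.exp (2 * lam * (t - a)) * ‖j (φ.1 t)‖ ^ 2))
      (lam * (Real.exp (2 * lam * (t - a)) * ‖j (φ.1 t)‖ ^ 2) +
        Real.exp (2 * lam * (t - a)) * ⟪j (φ.1 t), j (deriv φ.1 t)⟫_ℝ) t := by
    intro t
    have h1 : HasDerivAt (fun t => j (φ.1 t)) (j (deriv φ.1 t)) t :=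
      j.hasFDerivAt.comp_hasDerivAt t (hφ t)
    have h2 := h1.norm_sq
    have h3 : HasDerivAt (fun t => Real.exp (2 * lam * (t - a)))
        (Real.exp (2 * lam * (t - a)) * (2 * lam * 1)) t :=
      (((hasDerivAt_id t).sub_const a).const_mul (2 * lam)).exp
    exact ((h3.mul h2).const_mul (1 / 2 : ℝ)).congr_deriv (by ring)
  have i1 : Continuous fun t => lam * (Real.exp (2 * lam * (t - a)) * ‖j (φ.1 t)‖ ^ 2) := by
    fun_prop
  have i2 : Continuous fun t => Real.exp (2 * lam * (t - a)) * ⟪j (φ.1 t), j (deriv φ.1 t)⟫_ℝ := by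
    fun_prop
  have hint := intervalIntegral.integral_eq_sub_of_hasDerivAt (fun t _ => hd t)
    ((i1.add i2).intervalIntegrable a b)
  rw [intervalIntegral.integral_add (i1.intervalIntegrable _ _) (i2.intervalIntegrable _ _),
    φ.2.2, intervalIntegral.integral_of_le hab, intervalIntegral.integral_of_le hab,
    integral_Ioc_eq_integral_Ioo, integral_Ioc_eq_integral_Ioo] at hint
  simp only [sub_self, mul_zero, Real.exp_zero, map_zero, norm_zero, one_mul, ne_eq,
    OfNat.ofNat_ne_zero, not_false_eq_true, zero_pow, zero_sub] at hint
  linarith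

theorem integral_inner_right [CompleteSpace V] {F : ℝ → V} {μ : Measure ℝ} (hF : Integrable F μ)
    (w : V) : ∫ t, ⟪F t, w⟫_ℝ ∂μ = ⟪∫ t, F t ∂μ, w⟫_ℝ := by
  simp only [real_inner_comm w]
  exact integral_inner hF w

variable [CompleteSpace V]

/-- The operator on `L²((a, b); V)` representing the form. -/
def IsGardingFamily.op (h : IsGardingFamily j a b M α lam A) : L2t V a b →L[ℝ] L2t V a b :=
  InnerProductSpace.continuousLinearMapOfBilin (𝕜 := ℝ) h.form

theorem IsGardingFamily.inner_op (h : IsGardingFamily j a b M α lam A) (y φ : L2t V a b) :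
    ⟪h.op y, φ⟫_ℝ = h.form y φ := InnerProductSpace.continuousLinearMapOfBilin_apply _ _ _

variable [CompleteSpace H]

/-- The adjoint parabolic operator `φ ↦ -S φ' + A* φ` on test functions. -/
def IsGardingFamily.adjointOp (h : IsGardingFamily j a b M α lam A) :
    finalTest V b →ₗ[ℝ] L2t V a b :=
  (ContinuousLinearMap.adjoint h.op : L2t V a b →ₗ[ℝ] L2t V a b) ∘ₗ finalTestToL2 V a b -
    (((rieszIncl j).compLpL 2 _ : L2t V a b →L[ℝ] L2t V a b) : L2t V a b →ₗ[ℝ] L2t V a b) ∘ₗ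
      finalTestDeriv V a b

theorem IsGardingFamily.inner_adjointOp (h : IsGardingFamily j a b M α lam A) (y : L2t V a b)
    (φ : finalTest V b) :
    ⟪y, h.adjointOp φ⟫_ℝ = h.form y (finalTestToL2 V a b φ) -
      ∫ t in Ioo a b, ⟪j (y t), j (deriv φ.1 t)⟫_ℝ := by
  have h1 : h.adjointOp φ = ContinuousLinearMap.adjoint h.op (finalTestToL2 V a b φ) -
    (rieszIncl j).compLpL 2 _ (finalTestDeriv V a b φ) := rfl
  rw [h1, inner_sub_right, ContinuousLinearMap.adjoint_inner_right, h.inner_op, L2.inner_def]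
  congr 1
  refine integral_congr_ae ?_
  filter_upwards [(rieszIncl j).coeFn_compLpL (finalTestDeriv V a b φ),
    coeFn_finalTestDeriv (a := a) φ] with t h1 h2
  rw [h1, h2, inner_rieszIncl_right]

/-- Coercivity of the adjoint operator: it is tested with the test function times the weight
`exp (2 lam (t - a))`, which absorbs the lower-order term of the Gårding inequality. -/
theorem IsGardingFamily.le_norm_adjointOp (h : IsGardingFamily j a b M α lam A) (hab : a < b)
    (φ : finalTest V b) :
    1 / 2 * ‖j (φ.1 a)‖ ^ 2 + α * ‖finalTestToL2 V a b φ‖ ^ 2 ≤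
      Real.exp (2 * lam * (b - a)) * ‖finalTestToL2 V a b φ‖ * ‖h.adjointOp φ‖ := by
  have hlam := h.lam_nonneg
  set m : ℝ → ℝ := fun t => Real.exp (2 * lam * (t - a)) with hm
  have hmc : ContDiff ℝ 1 m := by fun_prop
  set φm := smulTest hmc φ with hφm
  have e0 : ∀ᵐ t ∂volume.restrict (Ioo a b), finalTestToL2 V a b φm t = m t • φ.1 t :=
    coeFn_finalTestToL2 φm
  have e1 := coeFn_finalTestToL2 (a := a) φ
  have hinner : 1 / 2 * ‖j (φ.1 a)‖ ^ 2 + α * ‖finalTestToL2 V a b φ‖ ^ 2 ≤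
      ⟪finalTestToL2 V a b φm, h.adjointOp φ⟫_ℝ := by
    rw [h.inner_adjointOp]
    have e2 : ∫ t in Ioo a b, ⟪j (finalTestToL2 V a b φm t), j (deriv φ.1 t)⟫_ℝ =
        ∫ t in Ioo a b, m t * ⟪j (φ.1 t), j (deriv φ.1 t)⟫_ℝ := by
      refine integral_congr_ae ?_
      filter_upwards [e0] with t ht
      rw [ht, map_smul, real_inner_smul_left]
    have e3 := integral_weight_inner_deriv (j := j) hab.le φ lam
    have i1 : IntegrableOn (fun t => lam * (m t * ‖j (φ.1 t)‖ ^ 2)) (Ioo a b) := by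
      have hc1 : Continuous φ.1 := φ.2.1.continuous
      have : Continuous fun t => lam * (m t * ‖j (φ.1 t)‖ ^ 2) := by fun_prop
      exact (this.continuousOn.integrableOn_Icc).mono_set Ioo_subset_Icc_self
    have e4 : α * ‖finalTestToL2 V a b φ‖ ^ 2 ≤ h.form (finalTestToL2 V a b φm)
        (finalTestToL2 V a b φ) + ∫ t in Ioo a b, lam * (m t * ‖j (φ.1 t)‖ ^ 2) := by
      rw [h.form_apply, ← integral_add (h.integrable _ _) i1, norm_sq_eq_integral,
        ← integral_const_mul]
      refine integral_mono_ae ((integrable_norm_sq _).const_mul _)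
        ((h.integrable _ _).add i1) ?_
      have hmem : ∀ᵐ t ∂volume.restrict (Ioo a b), t ∈ Ioo a b :=
        ae_restrict_mem measurableSet_Ioo
      filter_upwards [e0, e1, h.garding, hmem] with t h0 h1 h2 h3
      rw [h0, h1]
      have h4 : 1 ≤ m t := Real.one_le_exp (by
        have := sub_nonneg.2 h3.1.le
        positivity)
      have h5 := h2 (φ.1 t)
      have h6 : 0 ≤ α * ‖φ.1 t‖ ^ 2 := mul_nonneg h.pos.le (sq_nonneg _)
      simp only [map_smul, smul_apply, smul_eq_mul]
      calc α * ‖φ.1 t‖ ^ 2 ≤ m t * (α * ‖φ.1 t‖ ^ 2) := le_mul_of_one_le_left h6 h4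
        _ ≤ m t * (A t (φ.1 t) (φ.1 t) + lam * ‖j (φ.1 t)‖ ^ 2) := by gcongr
        _ = _ := by ring
    rw [e2]
    linarith
  have hnorm : ‖finalTestToL2 V a b φm‖ ≤
      Real.exp (2 * lam * (b - a)) * ‖finalTestToL2 V a b φ‖ := by
    refine Lp.norm_le_mul_norm_of_ae_le_mul ?_
    filter_upwards [e0, e1, ae_restrict_mem measurableSet_Ioo] with t h0 h1 h3
    rw [h0, h1, norm_smul, Real.norm_of_nonneg (Real.exp_pos _).le]
    gcongr
    exact h3.2.le
  calc _ ≤ ⟪finalTestToL2 V a b φm, h.adjointOp φ⟫_ℝ := hinner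
    _ ≤ ‖finalTestToL2 V a b φm‖ * ‖h.adjointOp φ‖ := real_inner_le_norm _ _
    _ ≤ _ := by gcongr

/-- Very weak solutions, by Lions' projection theorem: the data define a functional that is
bounded in terms of the adjoint operator. -/
theorem IsGardingFamily.exists_veryWeak (h : IsGardingFamily j a b M α lam A) (hab : a < b)
    (f : L2t V a b) (y₀ : H) :
    ∃ y : L2t V a b, ∀ φ : finalTest V b,
      ⟪f, finalTestToL2 V a b φ⟫_ℝ + ⟪y₀, j (φ.1 a)⟫_ℝ = ⟪y, h.adjointOp φ⟫_ℝ := by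
  have hα := h.pos
  let L : finalTest V b →ₗ[ℝ] ℝ :=
    { toFun := fun φ => ⟪f, finalTestToL2 V a b φ⟫_ℝ + ⟪y₀, j (φ.1 a)⟫_ℝ
      map_add' := fun φ ψ => by
        simp only [map_add, inner_add_right, Submodule.coe_add, Pi.add_apply]; ring
      map_smul' := fun c φ => by
        simp only [map_smul, real_inner_smul_right, Submodule.coe_smul, Pi.smul_apply,
          RingHom.id_apply, smul_eq_mul]; ring }
  set μ := Real.exp (2 * lam * (b - a)) with hμ
  have hμ0 : 0 < μ := Real.exp_pos _
  refine exists_inner_eq_of_abs_le h.adjointOp L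
    (C := ‖f‖ * (α⁻¹ * μ) + ‖y₀‖ * √(2 * α⁻¹ * μ ^ 2)) fun φ => ?_
  have h0 := h.le_norm_adjointOp hab φ
  set N := ‖finalTestToL2 V a b φ‖ with hN
  set K := ‖h.adjointOp φ‖ with hK
  have hN0 : 0 ≤ N := norm_nonneg _
  have hK0 : 0 ≤ K := norm_nonneg _
  have h1 : N ≤ α⁻¹ * μ * K := by
    have : α * N ^ 2 ≤ μ * N * K := by linarith [sq_nonneg ‖j (φ.1 a)‖]
    rcases hN0.eq_or_lt with h00 | h00
    · rw [← h00]; positivity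
    · have h2 : α * N ≤ μ * K := le_of_mul_le_mul_right (by nlinarith) h00
      calc N = α⁻¹ * (α * N) := by field_simp
        _ ≤ α⁻¹ * (μ * K) := by gcongr
        _ = _ := by ring
  have h2 : ‖j (φ.1 a)‖ ≤ √(2 * α⁻¹ * μ ^ 2) * K := by
    rw [← Real.sqrt_sq hK0, ← Real.sqrt_mul (by positivity)]
    refine Real.le_sqrt_of_sq_le ?_
    have h3 : ‖j (φ.1 a)‖ ^ 2 ≤ 2 * (μ * N * K) := by
      have : 0 ≤ α * N ^ 2 := by positivity
      linarith
    calc ‖j (φ.1 a)‖ ^ 2 ≤ 2 * (μ * N * K) := h3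
      _ ≤ 2 * (μ * (α⁻¹ * μ * K) * K) := by gcongr
      _ = _ := by ring
  calc |L φ| ≤ |⟪f, finalTestToL2 V a b φ⟫_ℝ| + |⟪y₀, j (φ.1 a)⟫_ℝ| := abs_add_le _ _
    _ ≤ ‖f‖ * N + ‖y₀‖ * ‖j (φ.1 a)‖ := by
      gcongr <;> exact abs_real_inner_le_norm _ _
    _ ≤ ‖f‖ * (α⁻¹ * μ * K) + ‖y₀‖ * (√(2 * α⁻¹ * μ ^ 2) * K) := by gcongr
    _ = _ := by ring

/-- Existence for the abstract Cauchy problem. In the weak formulation, `φ = ψ w` with `ψ`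
compactly supported identifies the time derivative, and `φ = (b - t) w` the initial value. -/
theorem IsGardingFamily.exists_solution (h : IsGardingFamily j a b M α lam A)
    (hj : DenseRange j) (hab : a < b) (f : L2t V a b) (y₀ : H) :
    ∃ y g : L2t V a b, IsTimeDeriv (rieszIncl j) y g ∧ h.Solves y g f ∧
      ∃ u : ℝ → H, ContinuousOn u (Icc a b) ∧
        (∀ᵐ t ∂volume.restrict (Ioo a b), u t = j (y t)) ∧ u a = y₀ := by
  obtain ⟨y, hy⟩ := h.exists_veryWeak hab f y₀
  set g := f - h.op y with hg
  have hsol : h.Solves y g f := fun φ => by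
    rw [hg, inner_sub_left, h.inner_op]; ring
  have hSy : IntegrableOn (fun t => rieszIncl j (y t)) (Ioo a b) :=
    (rieszIncl j).integrable_comp (integrable_of_L2t y)
  -- the weak formulation for `φ = ψ w`
  have key : ∀ (ψ : ℝ → ℝ) (hψ : ContDiff ℝ 1 ψ) (_ : ψ b = 0) (w : V),
      ∫ t in Ioo a b, deriv ψ t * ⟪rieszIncl j (y t), w⟫_ℝ =
        - (∫ t in Ioo a b, ψ t * ⟪g t, w⟫_ℝ) - ψ a * ⟪y₀, j w⟫_ℝ := by
    intro ψ hψ hψb w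
    have h1 := hy (scalarTest hψ hψb w)
    have h2 := hsol (finalTestToL2 V a b (scalarTest hψ hψb w))
    rw [h.inner_adjointOp] at h1
    rw [inner_finalTestToL2_scalarTest] at h2
    have h3 : ∫ t in Ioo a b, ⟪j (y t), j (deriv (scalarTest hψ hψb w).1 t)⟫_ℝ =
        ∫ t in Ioo a b, deriv ψ t * ⟪rieszIncl j (y t), w⟫_ℝ := by
      refine integral_congr_ae (Eventually.of_forall fun t => ?_)
      simp only [scalarTest_deriv, map_smul, real_inner_smul_right, inner_rieszIncl]
    have h4 : ⟪y₀, j ((scalarTest hψ hψb w).1 a)⟫_ℝ = ψ a * ⟪y₀, j w⟫_ℝ := by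
      simp only [scalarTest, map_smul, real_inner_smul_right]
    rw [h3, h4] at h1
    linarith
  have hder : IsTimeDeriv (rieszIncl j) y g := by
    intro ψ hψ hψc hψs
    have hT : IsTest a b ψ := ⟨hψ, hψc, hψs⟩
    have hψ1 : ContDiff ℝ 1 ψ := hψ.of_le (by simp)
    refine ext_inner_right ℝ fun w => ?_
    have i1 := hT.deriv.integrableOn_smul hSy
    have i2 := hT.integrableOn_smul (integrable_of_L2t g)
    have h1 := key ψ hψ1 (hT.eq_zero fun h => lt_irrefl _ h.2) w
    rw [hT.eq_zero (t := a) (fun h => lt_irrefl _ h.1), zero_mul, sub_zero] at h1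
    rw [inner_neg_left, ← integral_inner_right i1, ← integral_inner_right i2]
    simpa only [real_inner_smul_left] using h1
  obtain ⟨u, hu, huy, hprim, -⟩ := exists_continuousOn_rep hj hab y g hder
  refine ⟨y, g, hder, hsol, u, hu, huy, ?_⟩
  refine eq_of_forall_inner_denseRange hj fun w => ?_
  have hψ : ContDiff ℝ 1 (fun t : ℝ => b - t) := by fun_prop
  have h1 := key (fun t => b - t) hψ (sub_self b) w
  -- integrate `S y = S u(a) + ∫ g` over the interval
  have hgi := integrable_extendZero g
  have h2 := integral_deriv_smul_primitive hgi (a := a) (b := b)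
    (ψ := fun t => t) contDiff_id
  have hderiv : ∀ t : ℝ, deriv (fun t : ℝ => b - t) t = -1 := fun t => by simp
  simp only [hderiv, deriv_id'', one_smul] at h1 h2
  have hprimc : Continuous fun t => ∫ s in a..t, extendZero g s := hgi.continuous_primitive a
  have hprimi : IntegrableOn (fun t => ∫ s in a..t, extendZero g s) (Ioo a b) :=
    hprimc.continuousOn.integrableOn_Icc.mono_set Ioo_subset_Icc_self
  have h3 : ∫ t in Ioo a b, ⟪rieszIncl j (y t), w⟫_ℝ =
      (b - a) * ⟪u a, j w⟫_ℝ + ⟪∫ t in Ioo a b, ∫ s in a..t, extendZero g s, w⟫_ℝ := by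
    have e1 : ∫ t in Ioo a b, ⟪rieszIncl j (y t), w⟫_ℝ =
        ∫ t in Ioo a b, (⟪u a, j w⟫_ℝ + ⟪∫ s in a..t, extendZero g s, w⟫_ℝ) := by
      refine integral_congr_ae ?_
      filter_upwards [huy, ae_restrict_mem measurableSet_Ioo] with t h4 h5
      have h6 := hprim t (Ioo_subset_Icc_self h5) w
      rw [inner_rieszIncl, ← h4, h6, intervalIntegral.integral_of_le h5.1.le,
        integral_Ioc_eq_integral_Ioo]
      congr 2
      exact integral_congr_ae (ae_restrict_of_ae_restrict_of_subset
        (Ioo_subset_Ioo_right h5.2.le) ((extendZero_ae_eq g).mono fun s hs => hs.symm))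
    rw [e1, integral_add (integrable_const _) (hprimi.inner_const w),
      integral_inner_right hprimi, setIntegral_const, Real.volume_real_Ioo_of_le hab.le,
      smul_eq_mul]
  have h4 : ⟪∫ t in Ioo a b, ∫ s in a..t, extendZero g s, w⟫_ℝ =
      ∫ t in Ioo a b, (b - t) * ⟪g t, w⟫_ℝ := by
    have e1 : IntegrableOn (fun t => (b - t) • extendZero g t) (Ioo a b) := by
      obtain ⟨C, hC⟩ := (isCompact_Icc (a := a) (b := b)).exists_bound_of_continuousOn
        hψ.continuous.continuousOn
      refine Integrable.bdd_smul hgi.integrableOn C hψ.continuous.aestronglyMeasurable ?_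
      filter_upwards [ae_restrict_mem measurableSet_Ioo] with t ht
      exact hC t (Ioo_subset_Icc_self ht)
    rw [h2, ← integral_inner_right e1]
    refine integral_congr_ae ?_
    filter_upwards [extendZero_ae_eq g] with t ht
    rw [ht, real_inner_smul_left]
  simp only [neg_one_mul, integral_neg] at h1
  have h5 : (b - a) * ⟪u a, j w⟫_ℝ = (b - a) * ⟪y₀, j w⟫_ℝ := by linarith
  exact mul_left_cancel₀ (sub_pos.2 hab).ne' h5

end Existence

/-! ### A Sobolev inequality for products -/

section Sobolev

open scoped Topology ContDiff
open Filter

/-- The one-dimensional case of the Sobolev inequality `W^{1,1} ⊂ L^∞`. -/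
theorem eLpNorm_top_le_eLpNorm_fderiv_one {u : Eu 1 → ℝ} (hu : ContDiff ℝ 1 u)
    (h2u : HasCompactSupport u) :
    eLpNorm u ∞ volume ≤ eLpNorm (fderiv ℝ u) 1 volume := by
  let e : ℝ ≃ₗᵢ[ℝ] Eu 1 := (OrthonormalBasis.singleton (Fin 1) ℝ).repr
  have hmp : MeasurePreserving e volume volume := e.measurePreserving
  have hue : ContDiff ℝ 1 (u ∘ e) := hu.comp e.contDiff
  have h2ue : HasCompactSupport (u ∘ e) := h2u.comp_homeomorph e.toHomeomorph
  have hd : ∀ s, ‖deriv (u ∘ e) s‖ₑ ≤ ‖fderiv ℝ u (e s)‖ₑ := by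
    intro s
    have h1 : HasDerivAt (u ∘ e) (fderiv ℝ u (e s) (e 1)) s := by
      have h2 := (hu.differentiable one_ne_zero (e s)).hasFDerivAt
      have h3 : HasDerivAt e (e 1) s := by
        have := e.toContinuousLinearEquiv.toContinuousLinearMap.hasFDerivAt (x := s)
        exact this.hasDerivAt
      exact h2.comp_hasDerivAt s h3
    rw [h1.deriv]
    rw [← ofReal_norm, ← ofReal_norm]
    refine ENNReal.ofReal_le_ofReal ?_
    calc ‖fderiv ℝ u (e s) (e 1)‖ ≤ ‖fderiv ℝ u (e s)‖ * ‖e 1‖ := ContinuousLinearMap.le_opNorm _ _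
      _ = ‖fderiv ℝ u (e s)‖ := by rw [e.norm_map, norm_one, mul_one]
  rw [eLpNorm_exponent_top, eLpNorm_one_eq_lintegral_enorm]
  refine eLpNormEssSup_le_of_ae_enorm_bound (Eventually.of_forall fun x => ?_)
  obtain ⟨s, rfl⟩ := e.surjective x
  calc ‖u (e s)‖ₑ = ‖(u ∘ e) s‖ₑ := rfl
    _ ≤ ∫⁻ y in Iic s, ‖deriv (u ∘ e) y‖ₑ := h2ue.enorm_le_lintegral_Ici_deriv hue s
    _ ≤ ∫⁻ y, ‖deriv (u ∘ e) y‖ₑ := setLIntegral_le_lintegral _ _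
    _ ≤ ∫⁻ y, ‖fderiv ℝ u (e y)‖ₑ := lintegral_mono hd
    _ = ∫⁻ x, ‖fderiv ℝ u x‖ₑ := by
      refine hmp.lintegral_comp (f := fun x => ‖fderiv ℝ u x‖ₑ) ?_
      exact (hu.continuous_fderiv one_ne_zero).measurable.enorm

/-- The Sobolev inequality `W^{1,1} ⊂ L^q`, where `q` is conjugate to the dimension. -/
theorem exists_eLpNorm_le_eLpNorm_fderiv_one {n : ℕ} (hn : 1 ≤ n) :
    ∃ (q : ℝ≥0∞) (C : ℝ), ENNReal.HolderTriple (n : ℝ≥0∞) q 1 ∧ 0 ≤ C ∧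
      ∀ u : Eu n → ℝ, ContDiff ℝ 1 u → HasCompactSupport u →
        eLpNorm u q volume ≤ ENNReal.ofReal C * eLpNorm (fderiv ℝ u) 1 volume := by
  rcases hn.eq_or_lt with rfl | hn
  · refine ⟨∞, 1, ⟨by simp⟩, zero_le_one, fun u hu h2u => ?_⟩
    rw [ENNReal.ofReal_one, one_mul]
    exact eLpNorm_top_le_eLpNorm_fderiv_one hu h2u
  · have hp : NNReal.HolderConjugate (n : NNReal) (NNReal.conjExponent n) :=
      NNReal.HolderConjugate.conjExponent (by exact_mod_cast hn)
    refine ⟨NNReal.conjExponent n,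
      eLpNormLESNormFDerivOneConst (volume : Measure (Eu n)) (NNReal.conjExponent n), ?_,
      NNReal.coe_nonneg _, fun u hu h2u => ?_⟩
    · exact hp.coe_ennreal
    · have hfin : Module.finrank ℝ (Eu n) = n := finrank_euclideanSpace_fin
      have := eLpNorm_le_eLpNorm_fderiv_one (volume : Measure (Eu n)) hu h2u
        (p := NNReal.conjExponent n) (by rw [hfin]; exact hp)
      rwa [ENNReal.ofReal_coe_nnreal]

variable {n : ℕ} {D : Set (Eu n)}

theorem norm_gradient_eq {φ : Eu n → ℝ} (x : Eu n) : ‖gradient φ x‖ = ‖fderiv ℝ φ x‖ :=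
  (InnerProductSpace.toDual ℝ (Eu n)).symm.norm_map _

theorem norm_fderiv_mul_le {φ ψ : Eu n → ℝ} (hφ : Differentiable ℝ φ) (hψ : Differentiable ℝ ψ)
    (x : Eu n) : ‖fderiv ℝ (φ * ψ) x‖ ≤
      ‖φ x‖ * ‖gradient ψ x‖ + ‖ψ x‖ * ‖gradient φ x‖ := by
  rw [norm_gradient_eq, norm_gradient_eq, fderiv_mul (hφ x) (hψ x)]
  refine ContinuousLinearMap.opNorm_le_bound _ (by positivity) fun h => ?_
  calc ‖φ x * fderiv ℝ ψ x h + ψ x * fderiv ℝ φ x h‖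
      ≤ ‖φ x‖ * ‖fderiv ℝ ψ x h‖ + ‖ψ x‖ * ‖fderiv ℝ φ x h‖ := by
        rw [← norm_mul, ← norm_mul]
        exact norm_add_le _ _
    _ ≤ ‖φ x‖ * (‖fderiv ℝ ψ x‖ * ‖h‖) + ‖ψ x‖ * (‖fderiv ℝ φ x‖ * ‖h‖) := by
        gcongr <;> exact ContinuousLinearMap.le_opNorm _ _
    _ = _ := by ring

/-- The Sobolev inequality applied to a product of two test functions, with the product rule
and the Cauchy-Schwarz inequality for the gradient. -/
theorem eLpNorm_mul_le_of_mem_testPairs {q : ℝ≥0∞} {C : ℝ}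
    (hS : ∀ u : Eu n → ℝ, ContDiff ℝ 1 u → HasCompactSupport u →
        eLpNorm u q volume ≤ ENNReal.ofReal C * eLpNorm (fderiv ℝ u) 1 volume)
    {p p' : WithLp 2 (HD D × GD D)} (hp : p ∈ testPairs D) (hp' : p' ∈ testPairs D) :
    eLpNorm (fun x => p.fst x * p'.fst x) q (volume.restrict D) ≤
      ENNReal.ofReal C * ENNReal.ofReal (‖p.fst‖ * ‖p'.snd‖ + ‖p'.fst‖ * ‖p.snd‖) := by
  obtain ⟨φ, hφ, hφc, hφD, p1, p2⟩ := hp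
  obtain ⟨ψ, hψ, hψc, hψD, q1, q2⟩ := hp'
  have hφd : Differentiable ℝ φ := hφ.differentiable (by simp)
  have hψd : Differentiable ℝ ψ := hψ.differentiable (by simp)
  have h1 := hS (φ * ψ) ((hφ.mul hψ).of_le (by simp)) hφc.mul_right
  have h2 : eLpNorm (fun x => p.fst x * p'.fst x) q (volume.restrict D) ≤
      eLpNorm (φ * ψ) q volume := by
    refine le_trans (le_of_eq (eLpNorm_congr_ae ?_)) (eLpNorm_restrict_le _ _ _ D)
    filter_upwards [p1, q1] with x h1 h2
    rw [h1, h2, Pi.mul_apply]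
  have hi : Integrable (fun x => ‖p.fst x‖ * ‖p'.snd x‖ + ‖p'.fst x‖ * ‖p.snd x‖)
      (volume.restrict D) :=
    (integrable_norm_mul_norm p.fst p'.snd).add (integrable_norm_mul_norm p'.fst p.snd)
  have h3 : eLpNorm (fderiv ℝ (φ * ψ)) 1 volume ≤
      ENNReal.ofReal (‖p.fst‖ * ‖p'.snd‖ + ‖p'.fst‖ * ‖p.snd‖) := by
    have hsupp : Function.support (fun x => ‖fderiv ℝ (φ * ψ) x‖ₑ) ⊆ D := by
      intro x hx
      have : x ∈ tsupport (φ * ψ) := by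
        by_contra hcon
        exact hx (by
          show ‖fderiv ℝ (φ * ψ) x‖ₑ = 0
          have h0 : fderiv ℝ (φ * ψ) x = 0 :=
            image_eq_zero_of_notMem_tsupport fun h => hcon (tsupport_fderiv_subset ℝ h)
          rw [← ofReal_norm, norm_eq_zero.2 h0, ENNReal.ofReal_zero])
      exact hφD (tsupport_mul_subset_left this)
    rw [eLpNorm_one_eq_lintegral_enorm, ← setLIntegral_eq_of_support_subset hsupp]
    calc ∫⁻ x in D, ‖fderiv ℝ (φ * ψ) x‖ₑ
        ≤ ∫⁻ x in D, ENNReal.ofReal (‖p.fst x‖ * ‖p'.snd x‖ + ‖p'.fst x‖ * ‖p.snd x‖) := by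
          refine lintegral_mono_ae ?_
          filter_upwards [p1, p2, q1, q2] with x h1 h2 h3 h4
          rw [h1, h2, h3, h4, ← ofReal_norm]
          exact ENNReal.ofReal_le_ofReal (norm_fderiv_mul_le hφd hψd x)
      _ = ENNReal.ofReal (∫ x in D, (‖p.fst x‖ * ‖p'.snd x‖ + ‖p'.fst x‖ * ‖p.snd x‖)) :=
          (ofReal_integral_eq_lintegral_ofReal hi
            (Eventually.of_forall fun x => by positivity)).symm
      _ ≤ _ := by
          refine ENNReal.ofReal_le_ofReal ?_
          rw [integral_add (integrable_norm_mul_norm _ _) (integrable_norm_mul_norm _ _)]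
          exact add_le_add (integral_norm_mul_norm_le _ _) (integral_norm_mul_norm_le _ _)
  calc _ ≤ eLpNorm (φ * ψ) q volume := h2
    _ ≤ _ := h1
    _ ≤ _ := by gcongr

/-- The Sobolev inequality for products passes to `H¹₀` by Fatou's lemma. -/
theorem eLpNorm_toH_mul_toH_le {q : ℝ≥0∞} {C : ℝ}
    (hS : ∀ u : Eu n → ℝ, ContDiff ℝ 1 u → HasCompactSupport u →
        eLpNorm u q volume ≤ ENNReal.ofReal C * eLpNorm (fderiv ℝ u) 1 volume) (v w : VD D) :
    eLpNorm (fun x => toH D v x * toH D w x) q (volume.restrict D) ≤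
      ENNReal.ofReal C *
        ENNReal.ofReal (‖toH D v‖ * ‖grad D w‖ + ‖toH D w‖ * ‖grad D v‖) := by
  obtain ⟨p, hp, hpv⟩ := mem_closure_iff_seq_limit.1 v.2
  obtain ⟨p', hp', hpw⟩ := mem_closure_iff_seq_limit.1 w.2
  have hf : ∀ {p : ℕ → WithLp 2 (HD D × GD D)} {v}, Tendsto p atTop (𝓝 v) →
      Tendsto (fun k => (p k).fst) atTop (𝓝 v.fst) := fun h =>
    ((WithLp.fstL 2 ℝ (HD D) (GD D)).continuous.tendsto _).comp h
  have hs : ∀ {p : ℕ → WithLp 2 (HD D × GD D)} {v}, Tendsto p atTop (𝓝 v) →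
      Tendsto (fun k => (p k).snd) atTop (𝓝 v.snd) := fun h =>
    ((WithLp.sndL 2 ℝ (HD D) (GD D)).continuous.tendsto _).comp h
  obtain ⟨k, hk, hkae⟩ := (tendstoInMeasure_of_tendsto_Lp (hf hpv)).exists_seq_tendsto_ae
  obtain ⟨l, hl, hlae⟩ := (tendstoInMeasure_of_tendsto_Lp
    ((hf hpw).comp hk.tendsto_atTop)).exists_seq_tendsto_ae
  have hkl : Tendsto (fun i => k (l i)) atTop atTop := hk.tendsto_atTop.comp hl.tendsto_atTop
  refine (Lp.eLpNorm_lim_le_liminf_eLpNorm (f := fun i x => (p (k (l i))).fst x *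
    (p' (k (l i))).fst x) (fun i => (Lp.aestronglyMeasurable _).mul (Lp.aestronglyMeasurable _))
    _ ?_).trans ?_
  · filter_upwards [hkae, hlae] with x h1 h2
    exact (h1.comp hl.tendsto_atTop).mul h2
  · have hlim : Tendsto (fun i => ENNReal.ofReal C * ENNReal.ofReal
        (‖(p (k (l i))).fst‖ * ‖(p' (k (l i))).snd‖ +
          ‖(p' (k (l i))).fst‖ * ‖(p (k (l i))).snd‖)) atTop
        (𝓝 (ENNReal.ofReal C *
          ENNReal.ofReal (‖toH D v‖ * ‖grad D w‖ + ‖toH D w‖ * ‖grad D v‖))) := by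
      refine ENNReal.Tendsto.const_mul (ENNReal.tendsto_ofReal ?_) (Or.inr ENNReal.ofReal_ne_top)
      exact (((hf hpv).comp hkl).norm.mul ((hs hpw).comp hkl).norm).add
        (((hf hpw).comp hkl).norm.mul ((hs hpv).comp hkl).norm)
    rw [← hlim.liminf_eq]
    exact liminf_le_liminf (Eventually.of_forall fun i =>
      eLpNorm_mul_le_of_mem_testPairs hS (hp _) (hp' _))

end Sobolev

/-! ### The forms of the equation on `H¹₀` -/

section Forms

open scoped Topology
open Filter

variable {n : ℕ} {D : Set (Eu n)}

theorem norm_sq_VD (v : VD D) : ‖v‖ ^ 2 = ‖toH D v‖ ^ 2 + ‖grad D v‖ ^ 2 :=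
  WithLp.prod_norm_sq_eq_of_L2 (v : WithLp 2 (HD D × GD D))

theorem norm_toH_le (v : VD D) : ‖toH D v‖ ≤ ‖v‖ := by
  refine le_of_abs_le ((sq_le_sq.1 ?_).trans (abs_of_nonneg (norm_nonneg v)).le)
  rw [norm_sq_VD]
  linarith [sq_nonneg ‖grad D v‖]

theorem norm_grad_le (v : VD D) : ‖grad D v‖ ≤ ‖v‖ := by
  refine le_of_abs_le ((sq_le_sq.1 ?_).trans (abs_of_nonneg (norm_nonneg v)).le)
  rw [norm_sq_VD]
  linarith [sq_nonneg ‖toH D v‖]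

/-- `C` bounds the trilinear reaction form `∫ α v w` on `L^r × H¹₀ × H¹₀`. -/
structure IsReactionBound (D : Set (Eu n)) (r : ℝ≥0∞) [Fact (1 ≤ r)] (C : ℝ) : Prop where
  nonneg : 0 ≤ C
  eLpNorm_le : ∀ (α : Lp ℝ r (volume.restrict D)) (v w : VD D),
    eLpNorm (fun x => α x * toH D v x * toH D w x) 1 (volume.restrict D) ≤
      ENNReal.ofReal (C * ‖α‖ * (‖toH D v‖ * ‖grad D w‖ + ‖toH D w‖ * ‖grad D v‖))

/-- The reaction bound, uniform in the exponent `r ≥ n`: Hölder's inequality for `α ∈ L^n` and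
`v w ∈ L^q`, `q` conjugate to `n`, and the inclusion `L^r ⊂ L^n` on the set `D` of finite
volume. -/
theorem exists_isReactionBound (hn : 1 ≤ n) (hD : volume D ≠ ∞) :
    ∃ C, ∀ (r : ℝ≥0∞) [Fact (1 ≤ r)], (n : ℝ≥0∞) ≤ r → IsReactionBound D r C := by
  obtain ⟨q, C, hq, hC0, hS⟩ := exists_eLpNorm_le_eLpNorm_fderiv_one hn
  -- bounds `|D|^(1/n - 1/r)`, the norm of `L^r ⊂ L^n`, for all `r ≥ n`
  set m := max 1 (volume.real D) with hm
  have hm1 : 1 ≤ m := le_max_left _ _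
  refine ⟨m * C, fun r _ hr => ⟨by positivity, fun α v w => ?_⟩⟩
  have hvol : (volume.restrict D) univ ^ (1 / (n : ℝ≥0∞).toReal - 1 / r.toReal) ≤
      ENNReal.ofReal m := by
    rw [Measure.restrict_apply_univ]
    have hDm : volume D ≤ ENNReal.ofReal m := by
      rw [← ENNReal.ofReal_toReal hD]
      exact ENNReal.ofReal_le_ofReal (le_max_right _ _)
    have hn1 : (1 : ℝ) ≤ n := by exact_mod_cast hn
    have e0 : 0 ≤ 1 / (n : ℝ≥0∞).toReal - 1 / r.toReal := by
      rw [ENNReal.toReal_natCast, sub_nonneg]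
      rcases eq_or_ne r ∞ with rfl | hrt
      · simp
      · have : (n : ℝ) ≤ r.toReal := by
          rw [← ENNReal.toReal_natCast]; exact ENNReal.toReal_mono hrt hr
        exact one_div_le_one_div_of_le (by linarith) this
    have e1 : 1 / (n : ℝ≥0∞).toReal - 1 / r.toReal ≤ 1 := by
      have h1 : 0 ≤ 1 / r.toReal := by positivity
      have h2 : 1 / (n : ℝ≥0∞).toReal ≤ 1 := by
        rw [ENNReal.toReal_natCast, div_le_one (by linarith)]; exact hn1
      linarith
    calc volume D ^ (1 / (n : ℝ≥0∞).toReal - 1 / r.toReal)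
        ≤ ENNReal.ofReal m ^ (1 / (n : ℝ≥0∞).toReal - 1 / r.toReal) := by gcongr
      _ ≤ ENNReal.ofReal m ^ (1 : ℝ) :=
        ENNReal.rpow_le_rpow_of_exponent_le (by simpa using hm1) e1
      _ = ENNReal.ofReal m := ENNReal.rpow_one _
  have hα : eLpNorm α n (volume.restrict D) ≤ ENNReal.ofReal (m * ‖α‖) := by
    refine (eLpNorm_le_eLpNorm_mul_rpow_measure_univ hr (Lp.aestronglyMeasurable α)).trans ?_
    rw [mul_comm m, ENNReal.ofReal_mul (norm_nonneg _), Lp.norm_def,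
      ENNReal.ofReal_toReal (Lp.eLpNorm_ne_top α)]
    gcongr
  have hsm := eLpNorm_smul_le_mul_eLpNorm (μ := volume.restrict D) (p := n) (q := q) (r := 1)
    ((Lp.aestronglyMeasurable (toH D v)).mul (Lp.aestronglyMeasurable (toH D w)))
    (Lp.aestronglyMeasurable α)
  have e : (fun x => α x * toH D v x * toH D w x) =
      (α : Eu n → ℝ) • ((toH D v : Eu n → ℝ) * (toH D w : Eu n → ℝ)) := by
    ext x; simp [mul_assoc]
  rw [e]
  refine hsm.trans ?_
  set B := ‖toH D v‖ * ‖grad D w‖ + ‖toH D w‖ * ‖grad D v‖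
  calc eLpNorm α n (volume.restrict D) *
        eLpNorm ((toH D v : Eu n → ℝ) * (toH D w : Eu n → ℝ)) q (volume.restrict D)
      ≤ ENNReal.ofReal (m * ‖α‖) * (ENNReal.ofReal C * ENNReal.ofReal B) := by
        gcongr
        exact eLpNorm_toH_mul_toH_le hS v w
    _ = ENNReal.ofReal (m * C * ‖α‖ * B) := by
        rw [← ENNReal.ofReal_mul hC0, ← ENNReal.ofReal_mul (by positivity)]
        congr 1; ring

section Reaction

variable {r : ℝ≥0∞} [Fact (1 ≤ r)] {C : ℝ}

theorem IsReactionBound.integrable (h : IsReactionBound D r C) (α : Lp ℝ r (volume.restrict D))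
    (v w : VD D) : Integrable (fun x => α x * toH D v x * toH D w x) (volume.restrict D) := by
  rw [← memLp_one_iff_integrable]
  exact ⟨((Lp.aestronglyMeasurable α).mul (Lp.aestronglyMeasurable _)).mul
    (Lp.aestronglyMeasurable _), (h.eLpNorm_le α v w).trans_lt ENNReal.ofReal_lt_top⟩

theorem IsReactionBound.abs_integral_le (h : IsReactionBound D r C)
    (α : Lp ℝ r (volume.restrict D)) (v w : VD D) :
    ‖∫ x in D, α x * toH D v x * toH D w x‖ ≤
      C * ‖α‖ * (‖toH D v‖ * ‖grad D w‖ + ‖toH D w‖ * ‖grad D v‖) := by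
  have h0 := h.nonneg
  have h1 := (enorm_integral_le_lintegral_enorm (μ := volume.restrict D)
    (fun x => α x * toH D v x * toH D w x)).trans
    ((eLpNorm_one_eq_lintegral_enorm (ε := ℝ)).symm.le.trans (h.eLpNorm_le α v w))
  rw [← ofReal_norm] at h1
  exact (ENNReal.ofReal_le_ofReal_iff (by positivity)).1 h1

theorem IsReactionBound.abs_integral_le' (h : IsReactionBound D r C)
    (α : Lp ℝ r (volume.restrict D)) (v w : VD D) :
    ‖∫ x in D, α x * toH D v x * toH D w x‖ ≤ 2 * C * ‖α‖ * ‖v‖ * ‖w‖ := by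
  have h0 := h.nonneg
  calc _ ≤ C * ‖α‖ * (‖toH D v‖ * ‖grad D w‖ + ‖toH D w‖ * ‖grad D v‖) :=
        h.abs_integral_le α v w
    _ ≤ C * ‖α‖ * (‖v‖ * ‖w‖ + ‖w‖ * ‖v‖) := by
        have h1 := mul_le_mul (norm_toH_le v) (norm_grad_le w) (norm_nonneg _) (norm_nonneg _)
        have h2 := mul_le_mul (norm_toH_le w) (norm_grad_le v) (norm_nonneg _) (norm_nonneg _)
        exact mul_le_mul_of_nonneg_left (add_le_add h1 h2)
          (mul_nonneg h0 (norm_nonneg _))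
    _ = _ := by ring

/-- The reaction form `(v, w) ↦ ∫ α v w` on `H¹₀`, for fixed `α`. -/
def IsReactionBound.formAt (h : IsReactionBound D r C) (α : Lp ℝ r (volume.restrict D)) :
    VD D →L[ℝ] VD D →L[ℝ] ℝ :=
  LinearMap.mkContinuous₂
    (LinearMap.mk₂ ℝ (fun v w : VD D => ∫ x in D, α x * toH D v x * toH D w x)
      (fun v v' w => by
        rw [← integral_add (h.integrable α v w) (h.integrable α v' w)]
        refine integral_congr_ae ?_
        filter_upwards [Lp.coeFn_add (toH D v) (toH D v')] with x hx
        rw [map_add, hx, Pi.add_apply]; ring)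
      (fun c v w => by
        rw [← integral_smul]
        refine integral_congr_ae ?_
        filter_upwards [Lp.coeFn_smul c (toH D v)] with x hx
        rw [map_smul, hx, Pi.smul_apply, smul_eq_mul, smul_eq_mul]; ring)
      (fun v w w' => by
        rw [← integral_add (h.integrable α v w) (h.integrable α v w')]
        refine integral_congr_ae ?_
        filter_upwards [Lp.coeFn_add (toH D w) (toH D w')] with x hx
        rw [map_add, hx, Pi.add_apply]; ring)
      (fun c v w => by
        rw [← integral_smul]
        refine integral_congr_ae ?_
        filter_upwards [Lp.coeFn_smul c (toH D w)] with x hx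
        rw [map_smul, hx, Pi.smul_apply, smul_eq_mul, smul_eq_mul]; ring))
    (2 * C * ‖α‖) (fun v w => h.abs_integral_le' α v w)

theorem IsReactionBound.formAt_apply (h : IsReactionBound D r C)
    (α : Lp ℝ r (volume.restrict D)) (v w : VD D) :
    h.formAt α v w = ∫ x in D, α x * toH D v x * toH D w x := rfl

theorem IsReactionBound.continuous_formAt_apply (h : IsReactionBound D r C) (v w : VD D) :
    Continuous fun α => h.formAt α v w := by
  have h0 := h.nonneg
  let L : Lp ℝ r (volume.restrict D) →ₗ[ℝ] ℝ :=
    { toFun := fun α => h.formAt α v w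
      map_add' := fun α β => by
        rw [h.formAt_apply, h.formAt_apply, h.formAt_apply,
          ← integral_add (h.integrable α v w) (h.integrable β v w)]
        refine integral_congr_ae ?_
        filter_upwards [Lp.coeFn_add α β] with x hx
        rw [hx, Pi.add_apply]; ring
      map_smul' := fun c α => by
        rw [h.formAt_apply, h.formAt_apply, RingHom.id_apply, ← integral_smul]
        refine integral_congr_ae ?_
        filter_upwards [Lp.coeFn_smul c α] with x hx
        rw [hx, Pi.smul_apply, smul_eq_mul, smul_eq_mul]; ring }
  exact (L.mkContinuous (2 * C * ‖v‖ * ‖w‖) fun α =>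
    (h.abs_integral_le' α v w).trans_eq (by ring)).continuous

end Reaction

theorem norm_smul_innerForm_le {c K : ℝ} (hK0 : 0 ≤ K) (hc : ‖c‖ ≤ K) :
    ‖c • innerForm (Eu n)‖ ≤ K :=
  ContinuousLinearMap.opNorm_le_bound₂ _ hK0 fun ξ η => by
    calc ‖c * ⟪ξ, η⟫_ℝ‖ = ‖c‖ * ‖⟪ξ, η⟫_ℝ‖ := norm_mul _ _
      _ ≤ K * (‖ξ‖ * ‖η‖) := by gcongr; exact norm_inner_le_norm ξ η
      _ = K * ‖ξ‖ * ‖η‖ := (mul_assoc _ _ _).symm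

theorem norm_smulRight_innerForm_le {β : Eu n} {K : ℝ} (hK0 : 0 ≤ K) (hβ : ‖β‖ ≤ K) :
    ‖(ContinuousLinearMap.id ℝ ℝ).smulRight (innerForm (Eu n) β)‖ ≤ K :=
  ContinuousLinearMap.opNorm_le_bound₂ _ hK0 fun s η => by
    calc ‖s * ⟪β, η⟫_ℝ‖ = ‖s‖ * ‖⟪β, η⟫_ℝ‖ := norm_mul _ _
      _ ≤ ‖s‖ * (‖β‖ * ‖η‖) := by gcongr; exact norm_inner_le_norm _ _
      _ ≤ ‖s‖ * (K * ‖η‖) := by gcongr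
      _ = K * ‖s‖ * ‖η‖ := by ring

/-- The diffusion form `(v, w) ↦ ∫ c ∇v · ∇w` on `H¹₀` for a bounded coefficient `c`. -/
def diffusionAt (D : Set (Eu n)) {c : Eu n → ℝ} (hc : StronglyMeasurable c) {K : ℝ} (hK0 : 0 ≤ K)
    (hK : ∀ x, ‖c x‖ ≤ K) : VD D →L[ℝ] VD D →L[ℝ] ℝ :=
  (liftForm (volume.restrict D) (fun x => c x • innerForm (Eu n))
    (fun _ _ => (hc.mul stronglyMeasurable_const).aestronglyMeasurable) K hK0
    (Eventually.of_forall fun x => norm_smul_innerForm_le hK0 (hK x))).bilinearComp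
      (grad D) (grad D)

theorem diffusionAt_apply {c : Eu n → ℝ} (hc : StronglyMeasurable c) {K : ℝ} (hK0 : 0 ≤ K)
    (hK : ∀ x, ‖c x‖ ≤ K) (v w : VD D) : diffusionAt D hc hK0 hK v w =
      ∫ x in D, c x * ⟪grad D v x, grad D w x⟫_ℝ := rfl

theorem abs_diffusionAt_le {c : Eu n → ℝ} (hc : StronglyMeasurable c) {K : ℝ} (hK0 : 0 ≤ K)
    (hK : ∀ x, ‖c x‖ ≤ K) (v w : VD D) : ‖diffusionAt D hc hK0 hK v w‖ ≤ K * ‖v‖ * ‖w‖ := by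
  refine (abs_integral_bilin_le hK0 (Eventually.of_forall fun x =>
    norm_smul_innerForm_le hK0 (hK x)) (grad D v) (grad D w)).trans ?_
  gcongr <;> exact norm_grad_le _

/-- Coercivity of the diffusion form in the gradient. -/
theorem le_diffusionAt {c : Eu n → ℝ} (hc : StronglyMeasurable c) {K : ℝ} (hK0 : 0 ≤ K)
    (hK : ∀ x, ‖c x‖ ≤ K) {l : ℝ} (hl : ∀ᵐ x ∂volume.restrict D, l ≤ c x) (v : VD D) :
    l * ‖grad D v‖ ^ 2 ≤ diffusionAt D hc hK0 hK v v := by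
  rw [diffusionAt_apply, norm_sq_eq_integral, ← integral_const_mul]
  refine integral_mono_ae ((integrable_norm_sq _).const_mul l) ?_ ?_
  · refine (L2.integrable_inner (grad D v) (grad D v)).bdd_mul
      hc.aestronglyMeasurable (Eventually.of_forall hK)
  · filter_upwards [hl] with x hx
    rw [real_inner_self_eq_norm_sq]
    gcongr

/-- The convection form `(v, w) ↦ ∫ v β · ∇w` on `H¹₀` for a bounded vector field `β`. -/
def convectionAt (D : Set (Eu n)) {β : Eu n → Eu n} (hβ : StronglyMeasurable β) {K : ℝ}
    (hK0 : 0 ≤ K) (hK : ∀ x, ‖β x‖ ≤ K) : VD D →L[ℝ] VD D →L[ℝ] ℝ :=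
  (liftForm (volume.restrict D)
    (fun x => (ContinuousLinearMap.id ℝ ℝ).smulRight (innerForm (Eu n) (β x)))
    (fun _ _ => (stronglyMeasurable_const.mul
      (hβ.inner stronglyMeasurable_const)).aestronglyMeasurable) K hK0
    (Eventually.of_forall fun x => norm_smulRight_innerForm_le hK0 (hK x))).bilinearComp
      (toH D) (grad D)

theorem abs_convectionAt_le {β : Eu n → Eu n} (hβ : StronglyMeasurable β) {K : ℝ} (hK0 : 0 ≤ K)
    (hK : ∀ x, ‖β x‖ ≤ K) (v w : VD D) :
    ‖convectionAt D hβ hK0 hK v w‖ ≤ K * ‖toH D v‖ * ‖grad D w‖ :=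
  abs_integral_bilin_le hK0 (Eventually.of_forall fun x =>
    norm_smulRight_innerForm_le hK0 (hK x)) (toH D v) (grad D w)

end Forms

/-! ### Density of `V` in `H` -/

section Density

theorem denseRange_iff_forall_inner_eq_zero {V H : Type*} [NormedAddCommGroup V] [NormedSpace ℝ V]
    [NormedAddCommGroup H] [InnerProductSpace ℝ H] [CompleteSpace H] {j : V →L[ℝ] H} :
    DenseRange j ↔ ∀ h : H, (∀ v, ⟪h, j v⟫_ℝ = 0) → h = 0 := by
  have h1 : DenseRange j ↔ (LinearMap.range (j : V →ₗ[ℝ] H)).topologicalClosure = ⊤ := by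
    rw [DenseRange, ← Submodule.dense_iff_topologicalClosure_eq_top]
    rfl
  rw [h1, Submodule.topologicalClosure_eq_top_iff, Submodule.eq_bot_iff]
  refine forall_congr' fun h => imp_congr_left ?_
  rw [Submodule.mem_orthogonal']
  exact ⟨fun H v => H _ ⟨v, rfl⟩, by rintro H _ ⟨v, rfl⟩; exact H v⟩

/-- Test functions are dense in `L²(D)`. -/
theorem denseRange_toH {n : ℕ} {D : Set (Eu n)} (hD : IsOpen D) : DenseRange (toH D) := by
  rw [denseRange_iff_forall_inner_eq_zero]
  intro h hh
  have hloc : LocallyIntegrableOn h D volume := by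
    have h1 : LocallyIntegrable h (volume.restrict D) :=
      (Lp.memLp h).locallyIntegrable (by norm_num)
    exact locallyIntegrableOn_of_locallyIntegrable_restrict h1
  have h0 := hD.ae_eq_zero_of_integral_contDiff_smul_eq_zero hloc (fun φ hφ hφc hφD => by
    have hd : Continuous (gradient φ) :=
      (InnerProductSpace.toDual ℝ (Eu n)).symm.continuous.comp
        (hφ.continuous_fderiv (by simp))
    have hdc : HasCompactSupport (gradient φ) :=
      (hφc.fderiv ℝ).comp_left (g := (InnerProductSpace.toDual ℝ (Eu n)).symm) (map_zero _)
    have m1 : MemLp φ 2 (volume.restrict D) :=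
      (hφ.continuous.memLp_of_hasCompactSupport hφc).restrict D
    have m2 : MemLp (gradient φ) 2 (volume.restrict D) :=
      (hd.memLp_of_hasCompactSupport hdc).restrict D
    let p : WithLp 2 (HD D × GD D) := WithLp.toLp 2 (m1.toLp φ, m2.toLp (gradient φ))
    have hp : p ∈ testPairs D := ⟨φ, hφ, hφc, hφD, m1.coeFn_toLp, m2.coeFn_toLp⟩
    have h2 := hh ⟨p, subset_closure hp⟩
    have h3 : toH D ⟨p, subset_closure hp⟩ = m1.toLp φ := rfl
    rw [h3, L2.inner_def] at h2
    rw [← setIntegral_eq_integral_of_forall_compl_eq_zero (s := D) (fun x hx => by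
      rw [image_eq_zero_of_notMem_tsupport fun h => hx (hφD h), zero_smul]), ← h2]
    refine integral_congr_ae ?_
    filter_upwards [m1.coeFn_toLp] with x hx
    rw [hx]
    simp)
  refine Lp.ext ?_
  refine Filter.EventuallyEq.trans ?_ (Lp.coeFn_zero _ _ _).symm
  exact (ae_restrict_iff' hD.measurableSet).2 h0

/-- Pointwise application of a map with dense range has dense range in `L²`: if `h` is orthogonal
to the range then `‖j* h‖² = ⟪h, j (j* h)⟫ = 0`, and `j*` is injective. -/
theorem denseRange_compLpL {V H Ω : Type*} [NormedAddCommGroup V] [InnerProductSpace ℝ V]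
    [CompleteSpace V] [NormedAddCommGroup H] [InnerProductSpace ℝ H] [CompleteSpace H]
    [MeasurableSpace Ω] (P : Measure Ω) {j : V →L[ℝ] H} (hj : DenseRange j) :
    DenseRange (j.compLpL 2 P) := by
  rw [denseRange_iff_forall_inner_eq_zero]
  intro h hh
  have h1 := hh ((ContinuousLinearMap.adjoint j).compLpL 2 P h)
  have h2 : ‖(ContinuousLinearMap.adjoint j).compLpL 2 P h‖ ^ 2 = 0 := by
    rw [← h1, norm_sq_eq_integral, L2.inner_def]
    refine integral_congr_ae ?_
    filter_upwards [j.coeFn_compLpL ((ContinuousLinearMap.adjoint j).compLpL 2 P h),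
      (ContinuousLinearMap.adjoint j).coeFn_compLpL h] with s e1 e2
    rw [e1, e2, ← ContinuousLinearMap.adjoint_inner_left, real_inner_self_eq_norm_sq]
  have h3 : (ContinuousLinearMap.adjoint j).compLpL 2 P h = 0 :=
    norm_eq_zero.1 (pow_eq_zero_iff (two_ne_zero)|>.1 h2)
  refine Lp.ext ?_
  filter_upwards [(ContinuousLinearMap.adjoint j).coeFn_compLpL h, Lp.coeFn_zero V 2 P,
    Lp.coeFn_zero H 2 P] with s e1 e2 e3
  rw [e3, Pi.zero_apply]
  rw [h3, e2, Pi.zero_apply] at e1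
  refine denseRange_iff_forall_inner_eq_zero.1 hj _ fun v => ?_
  rw [← ContinuousLinearMap.adjoint_inner_left, ← e1, inner_zero_left]

end Density

/-! ### The Riesz isomorphism on Bochner spaces -/

section Riesz

/-- The Riesz isomorphism of a real Hilbert space, as a real linear map. -/
def rieszEquiv (V : Type*) [NormedAddCommGroup V] [InnerProductSpace ℝ V] [CompleteSpace V] :
    StrongDual ℝ V ≃ₗᵢ[ℝ] V where
  toFun := (InnerProductSpace.toDual ℝ V).symm
  invFun := InnerProductSpace.toDual ℝ V
  map_add' := map_add _
  map_smul' c x := by simp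
  left_inv := (InnerProductSpace.toDual ℝ V).right_inv
  right_inv := (InnerProductSpace.toDual ℝ V).left_inv
  norm_map' x := (InnerProductSpace.toDual ℝ V).symm.norm_map x

theorem inner_rieszEquiv {V : Type*} [NormedAddCommGroup V] [InnerProductSpace ℝ V]
    [CompleteSpace V] (g : StrongDual ℝ V) (v : V) : ⟪rieszEquiv V g, v⟫_ℝ = g v :=
  InnerProductSpace.toDual_symm_apply

variable {α E F : Type*} [MeasurableSpace α] [NormedAddCommGroup E] [NormedSpace ℝ E]
  [NormedAddCommGroup F] [NormedSpace ℝ F]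

/-- The isometry `L²(μ; E) ≃ L²(μ; F)` induced by an isometry `E ≃ F`. -/
def lpCongr (e : E ≃ₗᵢ[ℝ] F) (μ : Measure α) : Lp E 2 μ ≃ₗᵢ[ℝ] Lp F 2 μ where
  toFun := (e.toContinuousLinearEquiv : E →L[ℝ] F).compLpL 2 μ
  invFun := (e.symm.toContinuousLinearEquiv : F →L[ℝ] E).compLpL 2 μ
  map_add' := map_add _
  map_smul' := map_smul _
  left_inv f := by
    refine Lp.ext ?_
    filter_upwards [(e.symm.toContinuousLinearEquiv : F →L[ℝ] E).coeFn_compLpL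
      ((e.toContinuousLinearEquiv : E →L[ℝ] F).compLpL 2 μ f),
      (e.toContinuousLinearEquiv : E →L[ℝ] F).coeFn_compLpL f] with a h1 h2
    rw [h1, h2]
    exact e.symm_apply_apply _
  right_inv f := by
    refine Lp.ext ?_
    filter_upwards [(e.toContinuousLinearEquiv : E →L[ℝ] F).coeFn_compLpL
      ((e.symm.toContinuousLinearEquiv : F →L[ℝ] E).compLpL 2 μ f),
      (e.symm.toContinuousLinearEquiv : F →L[ℝ] E).coeFn_compLpL f] with a h1 h2
    rw [h1, h2]
    exact e.apply_symm_apply _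
  norm_map' f := by
    refine congrArg ENNReal.toReal (eLpNorm_congr_norm_ae ?_)
    filter_upwards [(e.toContinuousLinearEquiv : E →L[ℝ] F).coeFn_compLpL f] with a h
    exact (congrArg norm h).trans (e.norm_map _)

theorem coeFn_lpCongr (e : E ≃ₗᵢ[ℝ] F) {μ : Measure α} (f : Lp E 2 μ) :
    ∀ᵐ a ∂μ, lpCongr e μ f a = e (f a) :=
  (e.toContinuousLinearEquiv : E →L[ℝ] F).coeFn_compLpL f

-- sealed: only the characterizations above are used, and unfolding would slow unification
attribute [irreducible] rieszEquiv lpCongr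

end Riesz

/-! ### The random parabolic operator as a Gårding family -/

section Families

theorem norm_liftForm_apply_le {α X Y : Type*} [MeasurableSpace α] {μ : Measure α}
    [NormedAddCommGroup X] [NormedSpace ℝ X] [NormedAddCommGroup Y] [NormedSpace ℝ Y]
    {B : α → X →L[ℝ] Y →L[ℝ] ℝ} (hB : ∀ x y, AEStronglyMeasurable (fun a => B a x y) μ) {K : ℝ}
    (hK0 : 0 ≤ K) (hK : ∀ᵐ a ∂μ, ‖B a‖ ≤ K) (u : Lp X 2 μ) (w : Lp Y 2 μ) :
    ‖liftForm μ B hB K hK0 hK u w‖ ≤ K * ‖u‖ * ‖w‖ :=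
  ContinuousLinearMap.le_of_opNorm₂_le_of_le _ (norm_liftForm_le hB hK0 hK) le_rfl le_rfl

/-- Sums of bounded measurable families of forms, with Gårding's inequality for the total, form a
Gårding family. -/
theorem IsGardingFamily.of_add_sub {V H : Type*} [NormedAddCommGroup V] [InnerProductSpace ℝ V]
    [NormedAddCommGroup H] [InnerProductSpace ℝ H] {j : V →L[ℝ] H} {a b M₁ M₂ M₃ α lam : ℝ}
    {A₁ A₂ A₃ : ℝ → V →L[ℝ] V →L[ℝ] ℝ}
    (m₁ : ∀ x y, AEStronglyMeasurable (fun t => A₁ t x y) (volume.restrict (Ioo a b)))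
    (m₂ : ∀ x y, AEStronglyMeasurable (fun t => A₂ t x y) (volume.restrict (Ioo a b)))
    (m₃ : ∀ x y, AEStronglyMeasurable (fun t => A₃ t x y) (volume.restrict (Ioo a b)))
    (hM₁ : 0 ≤ M₁) (hM₂ : 0 ≤ M₂) (hM₃ : 0 ≤ M₃)
    (b₁ : ∀ᵐ t ∂volume.restrict (Ioo a b), ∀ x y, ‖A₁ t x y‖ ≤ M₁ * ‖x‖ * ‖y‖)
    (b₂ : ∀ᵐ t ∂volume.restrict (Ioo a b), ∀ x y, ‖A₂ t x y‖ ≤ M₂ * ‖x‖ * ‖y‖)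
    (b₃ : ∀ᵐ t ∂volume.restrict (Ioo a b), ∀ x y, ‖A₃ t x y‖ ≤ M₃ * ‖x‖ * ‖y‖)
    (hα : 0 < α) (hlam : 0 ≤ lam)
    (hG : ∀ᵐ t ∂volume.restrict (Ioo a b), ∀ v,
      α * ‖v‖ ^ 2 ≤ A₁ t v v + A₂ t v v - A₃ t v v + lam * ‖j v‖ ^ 2) :
    IsGardingFamily j a b (M₁ + M₂ + M₃) α lam (fun t => A₁ t + A₂ t - A₃ t) where
  meas x y := ((m₁ x y).add (m₂ x y)).sub (m₃ x y)
  bound_nonneg := by positivity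
  bound := by
    filter_upwards [b₁, b₂, b₃] with t h1 h2 h3
    refine ContinuousLinearMap.opNorm_le_bound₂ _ (by positivity) fun v w => ?_
    calc ‖A₁ t v w + A₂ t v w - A₃ t v w‖ ≤ ‖A₁ t v w‖ + ‖A₂ t v w‖ + ‖A₃ t v w‖ :=
          (norm_sub_le _ _).trans (by gcongr; exact norm_add_le _ _)
      _ ≤ M₁ * ‖v‖ * ‖w‖ + M₂ * ‖v‖ * ‖w‖ + M₃ * ‖v‖ * ‖w‖ :=
          add_le_add (add_le_add (h1 v w) (h2 v w)) (h3 v w)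
      _ = _ := by ring
  pos := hα
  lam_nonneg := hlam
  garding := hG

theorem IsGardingFamily.form_add_sub {V H : Type*} [NormedAddCommGroup V] [InnerProductSpace ℝ V]
    [NormedAddCommGroup H] [InnerProductSpace ℝ H] {j : V →L[ℝ] H} {a b M M₁ M₂ M₃ α lam : ℝ}
    {A₁ A₂ A₃ : ℝ → V →L[ℝ] V →L[ℝ] ℝ}
    (m₁ : ∀ x y, AEStronglyMeasurable (fun t => A₁ t x y) (volume.restrict (Ioo a b)))
    (m₂ : ∀ x y, AEStronglyMeasurable (fun t => A₂ t x y) (volume.restrict (Ioo a b)))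
    (m₃ : ∀ x y, AEStronglyMeasurable (fun t => A₃ t x y) (volume.restrict (Ioo a b)))
    (b₁ : ∀ᵐ t ∂volume.restrict (Ioo a b), ∀ x y, ‖A₁ t x y‖ ≤ M₁ * ‖x‖ * ‖y‖)
    (b₂ : ∀ᵐ t ∂volume.restrict (Ioo a b), ∀ x y, ‖A₂ t x y‖ ≤ M₂ * ‖x‖ * ‖y‖)
    (b₃ : ∀ᵐ t ∂volume.restrict (Ioo a b), ∀ x y, ‖A₃ t x y‖ ≤ M₃ * ‖x‖ * ‖y‖)
    (hM₁ : 0 ≤ M₁) (hM₂ : 0 ≤ M₂) (hM₃ : 0 ≤ M₃)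
    (h : IsGardingFamily j a b M α lam (fun t => A₁ t + A₂ t - A₃ t)) (y φ : L2t V a b) :
    h.form y φ = (∫ t in Ioo a b, A₁ t (y t) (φ t)) + (∫ t in Ioo a b, A₂ t (y t) (φ t))
      - ∫ t in Ioo a b, A₃ t (y t) (φ t) := by
  have i₁ := integrable_bilin m₁
    (b₁.mono fun t h => ContinuousLinearMap.opNorm_le_bound₂ (A₁ t) hM₁ h) y φ
  have i₂ := integrable_bilin m₂
    (b₂.mono fun t h => ContinuousLinearMap.opNorm_le_bound₂ (A₂ t) hM₂ h) y φ
  have i₃ := integrable_bilin m₃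
    (b₃.mono fun t h => ContinuousLinearMap.opNorm_le_bound₂ (A₃ t) hM₃ h) y φ
  rw [← integral_add i₁ i₂]
  exact integral_sub (i₁.add i₂) i₃

/-- Measurability in the parameter of a partially integrated measurable family of forms. -/
theorem aestronglyMeasurable_integral_bilin {τ Ω V : Type*} [MeasurableSpace τ]
    [MeasurableSpace Ω] [NormedAddCommGroup V] [NormedSpace ℝ V] {μ : Measure τ} [SFinite μ]
    {P : Measure Ω} [SFinite P] {B : τ → Ω → V →L[ℝ] V →L[ℝ] ℝ}
    (hB : ∀ x y, AEStronglyMeasurable (fun p : τ × Ω => B p.1 p.2 x y) (μ.prod P))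
    (x y : Lp V 2 P) : AEStronglyMeasurable (fun t => ∫ ω, B t ω (x ω) (y ω) ∂P) μ :=
  (aestronglyMeasurable_bilin_apply (B := fun p : τ × Ω => B p.1 p.2) hB
    (Lp.aestronglyMeasurable x).comp_snd (Lp.aestronglyMeasurable y).comp_snd).integral_prod_right'

end Families

section Operator

variable {n : ℕ} {D : Set (Eu n)} {Ω : Type*} [MeasurableSpace Ω] {P : Measure Ω}

theorem stronglyMeasurable_diffusionAt {S : Type*} [MeasurableSpace S] {c : S × Eu n → ℝ}
    (hc : StronglyMeasurable c) {K : ℝ} (hK0 : 0 ≤ K) (hK : ∀ p, ‖c p‖ ≤ K) (v w : VD D) :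
    StronglyMeasurable fun s => diffusionAt D (hc.comp_measurable measurable_prodMk_left :
      StronglyMeasurable fun x => c (s, x)) hK0 (fun x => hK (s, x)) v w :=
  StronglyMeasurable.integral_prod_right' (f := fun p : S × Eu n =>
    c p * ⟪grad D v p.2, grad D w p.2⟫_ℝ) (hc.mul
      (((Lp.stronglyMeasurable _).comp_measurable measurable_snd).inner
        ((Lp.stronglyMeasurable _).comp_measurable measurable_snd)))

theorem stronglyMeasurable_convectionAt {S : Type*} [MeasurableSpace S] {β : S × Eu n → Eu n}
    (hβ : StronglyMeasurable β) {K : ℝ} (hK0 : 0 ≤ K) (hK : ∀ p, ‖β p‖ ≤ K) (v w : VD D) :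
    StronglyMeasurable fun s => convectionAt D (hβ.comp_measurable measurable_prodMk_left :
      StronglyMeasurable fun x => β (s, x)) hK0 (fun x => hK (s, x)) v w :=
  StronglyMeasurable.integral_prod_right' (f := fun p : S × Eu n =>
    toH D v p.2 * ⟪β p, grad D w p.2⟫_ℝ)
    (((Lp.stronglyMeasurable _).comp_measurable measurable_snd).mul
      (hβ.inner ((Lp.stronglyMeasurable _).comp_measurable measurable_snd)))

/-- The diffusion form on `V_P` for a bounded random coefficient. -/
def diffusionP (D : Set (Eu n)) (P : Measure Ω) {c : Ω × Eu n → ℝ} (hc : StronglyMeasurable c)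
    {K : ℝ} (hK0 : 0 ≤ K) (hK : ∀ p, ‖c p‖ ≤ K) : VP D P →L[ℝ] VP D P →L[ℝ] ℝ :=
  liftForm P (fun ω => diffusionAt D (hc.comp_measurable measurable_prodMk_left :
      StronglyMeasurable fun x => c (ω, x)) hK0 (fun x => hK (ω, x)))
    (fun v w => (stronglyMeasurable_diffusionAt hc hK0 hK v w).aestronglyMeasurable) K hK0
    (.of_forall fun _ => ContinuousLinearMap.opNorm_le_bound₂ _ hK0 fun _ _ =>
      abs_diffusionAt_le _ _ _ _ _)

/-- The reaction form on `V_P` for a deterministic coefficient. -/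
def IsReactionBound.formP {r : ℝ≥0∞} [Fact (1 ≤ r)] {C : ℝ} (h : IsReactionBound D r C)
    (P : Measure Ω) (α : Lp ℝ r (volume.restrict D)) : VP D P →L[ℝ] VP D P →L[ℝ] ℝ :=
  liftForm P (fun _ => h.formAt α) (fun _ _ => aestronglyMeasurable_const) (2 * C * ‖α‖)
    (mul_nonneg (mul_nonneg zero_le_two h.nonneg) (norm_nonneg _))
    (.of_forall fun _ => ContinuousLinearMap.opNorm_le_bound₂ _
      (mul_nonneg (mul_nonneg zero_le_two h.nonneg) (norm_nonneg _)) fun v w =>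
      h.abs_integral_le' α v w)

/-- The convection form on `V_P` for a bounded deterministic vector field. -/
def convectionP (D : Set (Eu n)) (P : Measure Ω) {β : Eu n → Eu n} (hβ : StronglyMeasurable β)
    {K : ℝ} (hK0 : 0 ≤ K) (hK : ∀ x, ‖β x‖ ≤ K) : VP D P →L[ℝ] VP D P →L[ℝ] ℝ :=
  liftForm P (fun _ => convectionAt D hβ hK0 hK) (fun _ _ => aestronglyMeasurable_const) K hK0
    (.of_forall fun _ => ContinuousLinearMap.opNorm_le_bound₂ _ hK0 fun v w =>
      (abs_convectionAt_le _ _ _ _ _).trans (by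
        gcongr; exacts [norm_toH_le _, norm_grad_le _]))

theorem diffusionP_apply {c : Ω × Eu n → ℝ} (hc : StronglyMeasurable c)
    {K : ℝ} (hK0 : 0 ≤ K) (hK : ∀ p, ‖c p‖ ≤ K) (v w : VP D P) :
    diffusionP D P hc hK0 hK v w = diffusionForm (fun ω x => c (ω, x)) v w := rfl

theorem IsReactionBound.formP_apply {r : ℝ≥0∞} [Fact (1 ≤ r)] {C : ℝ} (h : IsReactionBound D r C)
    (α : Lp ℝ r (volume.restrict D)) (v w : VP D P) :
    h.formP P α v w = reactionForm α v w := rfl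

theorem convectionP_apply {β : Eu n → Eu n} (hβ : StronglyMeasurable β)
    {K : ℝ} (hK0 : 0 ≤ K) (hK : ∀ x, ‖β x‖ ≤ K) (v w : VP D P) :
    convectionP D P hβ hK0 hK v w = convectionForm β v w := rfl

/-- Gårding's inequality on `V`, for a fixed realization of the coefficients: the lower-order
terms are absorbed by Young's inequality. -/
theorem garding_VD {r : ℝ≥0∞} [Fact (1 ≤ r)] {C : ℝ} (h : IsReactionBound D r C)
    {c : Eu n → ℝ} (hc : StronglyMeasurable c) {K : ℝ} (hK0 : 0 ≤ K) (hK : ∀ x, ‖c x‖ ≤ K)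
    {l : ℝ} (hl0 : 0 < l) (hl : ∀ x, l ≤ c x) {α : Lp ℝ r (volume.restrict D)} {S : ℝ}
    (hα : ‖α‖ ≤ S) {β : Eu n → Eu n} (hβ : StronglyMeasurable β) {L : ℝ} (hL0 : 0 ≤ L)
    (hL : ∀ x, ‖β x‖ ≤ L) (v : VD D) :
    l / 2 * ‖v‖ ^ 2 ≤ diffusionAt D hc hK0 hK v v + h.formAt α v v - convectionAt D hβ hL0 hL v v
      + (l / 2 + (2 * C * S + L) ^ 2 / (2 * l)) * ‖toH D v‖ ^ 2 := by
  have h1 := le_diffusionAt hc hK0 hK (D := D) (.of_forall hl) v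
  have h2 : -(C * S * (‖toH D v‖ * ‖grad D v‖ + ‖toH D v‖ * ‖grad D v‖)) ≤ h.formAt α v v := by
    refine le_trans (neg_le_neg ?_) (abs_le.1 (h.abs_integral_le α v v)).1
    have := h.nonneg
    gcongr
  have h3 := (abs_le.1 (abs_convectionAt_le hβ hL0 hL v v)).2
  rw [norm_sq_VD]
  generalize diffusionAt D hc hK0 hK v v = X at *
  generalize h.formAt α v v = Y at *
  generalize convectionAt D hβ hL0 hL v v = Z at *
  generalize ‖toH D v‖ = p at *
  generalize ‖grad D v‖ = q at *
  have h4 : (2 * C * S + L) * (p * q) ≤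
      l / 2 * q ^ 2 + (2 * C * S + L) ^ 2 / (2 * l) * p ^ 2 := by
    have h5 : l / 2 * q ^ 2 + (2 * C * S + L) ^ 2 / (2 * l) * p ^ 2 - (2 * C * S + L) * (p * q) =
        (l * q - (2 * C * S + L) * p) ^ 2 / (2 * l) := by field_simp; ring
    have : 0 ≤ (l * q - (2 * C * S + L) * p) ^ 2 / (2 * l) := by positivity
    linarith
  linarith

/-- Gårding's inequality on `V_P`: the inequality on `V` has constants that do not depend on `ω`
and is integrated over `Ω`. -/
theorem garding_VP {r : ℝ≥0∞} [Fact (1 ≤ r)] {C : ℝ} (h : IsReactionBound D r C)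
    {c : Ω × Eu n → ℝ} (hc : StronglyMeasurable c) {K : ℝ} (hK0 : 0 ≤ K) (hK : ∀ p, ‖c p‖ ≤ K)
    {l : ℝ} (hl0 : 0 < l) (hl : ∀ p, l ≤ c p) {α : Lp ℝ r (volume.restrict D)} {S : ℝ}
    (hα : ‖α‖ ≤ S) {β : Eu n → Eu n} (hβ : StronglyMeasurable β) {L : ℝ} (hL0 : 0 ≤ L)
    (hL : ∀ x, ‖β x‖ ≤ L) (v : VP D P) :
    l / 2 * ‖v‖ ^ 2 ≤ diffusionP D P hc hK0 hK v v + h.formP P α v v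
      - convectionP D P hβ hL0 hL v v
      + (l / 2 + (2 * C * S + L) ^ 2 / (2 * l)) * ‖toHP D P v‖ ^ 2 := by
  set N := l / 2 + (2 * C * S + L) ^ 2 / (2 * l) with hN
  have i₁ := integrable_bilin (μ := P)
    (B := fun ω => diffusionAt D (hc.comp_measurable measurable_prodMk_left :
      StronglyMeasurable fun x => c (ω, x)) hK0 (fun x => hK (ω, x)))
    (fun v w => (stronglyMeasurable_diffusionAt hc hK0 hK v w).aestronglyMeasurable)
    (.of_forall fun _ => ContinuousLinearMap.opNorm_le_bound₂ _ hK0 fun _ _ =>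
      abs_diffusionAt_le _ _ _ _ _) v v
  have i₂ := integrable_bilin (μ := P) (B := fun _ => h.formAt α)
    (fun _ _ => aestronglyMeasurable_const) (.of_forall fun _ => le_rfl) v v
  have i₃ := integrable_bilin (μ := P) (B := fun _ => convectionAt D hβ hL0 hL)
    (fun _ _ => aestronglyMeasurable_const) (.of_forall fun _ => le_rfl) v v
  have i₄ := (integrable_norm_sq (toHP D P v)).const_mul N
  rw [norm_sq_eq_integral, norm_sq_eq_integral, ← integral_const_mul, ← integral_const_mul]
  refine (integral_mono_ae ((integrable_norm_sq v).const_mul _)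
    (((i₁.add i₂).sub i₃).add i₄) ?_).trans_eq ?_
  · filter_upwards [(toH D).coeFn_compLpL v] with ω hω
    refine (garding_VD h (hc.comp_measurable measurable_prodMk_left :
      StronglyMeasurable fun x => c (ω, x)) hK0 (fun x => hK (ω, x)) hl0 (fun x => hl (ω, x))
      hα hβ hL0 hL (v ω)).trans_eq ?_
    rw [← hω]
    rfl
  · refine (integral_add ((i₁.add i₂).sub i₃) i₄).trans ?_
    congr 1
    refine (integral_sub (i₁.add i₂) i₃).trans ?_
    congr 1
    exact integral_add i₁ i₂

theorem norm_diffusionP_apply_le {c : Ω × Eu n → ℝ} (hc : StronglyMeasurable c)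
    {K : ℝ} (hK0 : 0 ≤ K) (hK : ∀ p, ‖c p‖ ≤ K) (v w : VP D P) :
    ‖diffusionP D P hc hK0 hK v w‖ ≤ K * ‖v‖ * ‖w‖ :=
  norm_liftForm_apply_le _ _ _ _ _

theorem IsReactionBound.norm_formP_apply_le {r : ℝ≥0∞} [Fact (1 ≤ r)] {C : ℝ}
    (h : IsReactionBound D r C) (α : Lp ℝ r (volume.restrict D)) (v w : VP D P) :
    ‖h.formP P α v w‖ ≤ 2 * C * ‖α‖ * ‖v‖ * ‖w‖ :=
  norm_liftForm_apply_le _ _ _ _ _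

theorem norm_convectionP_apply_le {β : Eu n → Eu n} (hβ : StronglyMeasurable β)
    {K : ℝ} (hK0 : 0 ≤ K) (hK : ∀ x, ‖β x‖ ≤ K) (v w : VP D P) :
    ‖convectionP D P hβ hK0 hK v w‖ ≤ K * ‖v‖ * ‖w‖ :=
  norm_liftForm_apply_le _ _ _ _ _

theorem IsReactionBound.aestronglyMeasurable_formP_apply [SFinite P] {τ : Type*}
    [MeasurableSpace τ] {μ : Measure τ} [SFinite μ] {r : ℝ≥0∞} [Fact (1 ≤ r)] {C : ℝ}
    (h : IsReactionBound D r C) {a : τ → Lp ℝ r (volume.restrict D)} (ha : StronglyMeasurable a)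
    (v w : VP D P) : AEStronglyMeasurable (fun t => h.formP P (a t) v w) μ :=
  aestronglyMeasurable_integral_bilin (B := fun t _ => h.formAt (a t))
    (fun x y => ((h.continuous_formAt_apply x y).comp_stronglyMeasurable
      (ha.comp_measurable measurable_fst)).aestronglyMeasurable) v w

theorem aestronglyMeasurable_convectionP_apply [SFinite P] {τ : Type*}
    [MeasurableSpace τ] {μ : Measure τ} [SFinite μ] {β : τ × Eu n → Eu n}
    (hβ : StronglyMeasurable β) {K : ℝ} (hK0 : 0 ≤ K) (hK : ∀ p, ‖β p‖ ≤ K) (v w : VP D P) :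
    AEStronglyMeasurable (fun t => convectionP D P (hβ.comp_measurable measurable_prodMk_left :
      StronglyMeasurable fun x => β (t, x)) hK0 (fun x => hK (t, x)) v w) μ :=
  aestronglyMeasurable_integral_bilin
    (B := fun t _ => convectionAt D (hβ.comp_measurable measurable_prodMk_left :
      StronglyMeasurable fun x => β (t, x)) hK0 (fun x => hK (t, x)))
    (fun x y => ((stronglyMeasurable_convectionAt hβ hK0 hK x y).comp_measurable
      measurable_fst).aestronglyMeasurable) v w

-- sealed: only the lemmas above are used, and unfolding would slow unification
attribute [irreducible] diffusionP IsReactionBound.formP convectionP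

end Operator

/-! ### Bounded representatives of the coefficients -/

section Coefficients

variable {n : ℕ} {D : Set (Eu n)} {Ω : Type*} [MeasurableSpace Ω] {P : Measure Ω}

theorem ae_norm_le_norm_top {α E : Type*} [MeasurableSpace α] [NormedAddCommGroup E]
    {μ : Measure α} (f : Lp E ∞ μ) : ∀ᵐ x ∂μ, ‖f x‖ ≤ ‖f‖ := by
  filter_upwards [enorm_ae_le_eLpNormEssSup f μ] with x hx
  rw [← eLpNorm_exponent_top] at hx
  have := ENNReal.toReal_mono (Lp.memLp f).2.ne hx
  rwa [toReal_enorm] at this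

/-- A representative of the convection coefficient that is bounded everywhere. -/
def boundedRep (b : ConvectionSpace D) (p : ℝ × Eu n) : Eu n :=
  {p | ‖b p‖ ≤ ‖b‖}.indicator b p

theorem stronglyMeasurable_boundedRep (b : ConvectionSpace D) :
    StronglyMeasurable (boundedRep b) :=
  (Lp.stronglyMeasurable b).indicator
    (measurableSet_le (Lp.stronglyMeasurable b).norm.measurable measurable_const)

theorem norm_boundedRep_le (b : ConvectionSpace D) (p : ℝ × Eu n) : ‖boundedRep b p‖ ≤ ‖b‖ := by
  by_cases h : ‖b p‖ ≤ ‖b‖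
  · rwa [boundedRep, indicator_of_mem (s := {p | ‖b p‖ ≤ ‖b‖}) h]
  · rw [boundedRep, indicator_of_notMem (s := {p | ‖b p‖ ≤ ‖b‖}) h, norm_zero]
    exact norm_nonneg _

theorem boundedRep_ae_eq (b : ConvectionSpace D) :
    ∀ᵐ t ∂volume.restrict (Ioi (0 : ℝ)), ∀ᵐ x ∂volume.restrict D,
      boundedRep b (t, x) = b (t, x) := by
  refine Measure.ae_ae_of_ae_prod (p := fun p => boundedRep b p = b p) ?_
  filter_upwards [ae_norm_le_norm_top b] with p hp
  exact indicator_of_mem (s := {p | ‖b p‖ ≤ ‖b‖}) hp _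

/-- The diffusion coefficient agrees almost everywhere with a strongly measurable function that
satisfies the bounds everywhere, obtained by clamping. -/
theorem IsUniformDiffusion.exists_rep [SFinite P] {νlo νhi : ℝ} {ν : Ω → Eu n → ℝ}
    (h : IsUniformDiffusion D P νlo νhi ν) :
    ∃ c : Ω × Eu n → ℝ, StronglyMeasurable c ∧ (∀ p, νlo ≤ c p) ∧ (∀ p, ‖c p‖ ≤ max νlo νhi) ∧
      ∀ᵐ ω ∂P, ∀ᵐ x ∂volume.restrict D, c (ω, x) = ν ω x := by
  have hm := h.aestronglyMeasurable
  refine ⟨fun p => max νlo (min (hm.mk _ p) (max νlo νhi)),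
    stronglyMeasurable_const.sup (hm.stronglyMeasurable_mk.inf stronglyMeasurable_const),
    fun p => le_max_left _ _, fun p => ?_, ?_⟩
  · rw [Real.norm_of_nonneg (h.pos.le.trans (le_max_left _ _))]
    exact max_le (le_max_left _ _) (min_le_right _ _)
  · obtain ⟨νmin, νmax, -, -, hb⟩ := h.bounds
    filter_upwards [hb, Measure.ae_ae_of_ae_prod hm.ae_eq_mk] with ω h1 h2
    filter_upwards [h1.2.2, h2] with x h3 h4
    rw [← h4]
    have h5 : ν ω x ≤ max νlo νhi := (h3.2.trans h1.2.1).trans (le_max_right _ _)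
    show max νlo (min (ν ω x) (max νlo νhi)) = ν ω x
    rw [min_eq_left h5, max_eq_right (h1.1.trans h3.1)]

theorem diffusionForm_congr {ν ν' : Ω → Eu n → ℝ}
    (h : ∀ᵐ ω ∂P, ∀ᵐ x ∂volume.restrict D, ν ω x = ν' ω x) (v w : VP D P) :
    diffusionForm ν v w = diffusionForm ν' v w := by
  refine integral_congr_ae ?_
  filter_upwards [h] with ω hω
  refine integral_congr_ae ?_
  filter_upwards [hω] with x hx
  rw [hx]

theorem convectionForm_congr {β β' : Eu n → Eu n}
    (h : ∀ᵐ x ∂volume.restrict D, β x = β' x) (v w : VP D P) :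
    convectionForm β v w = convectionForm β' v w := by
  refine integral_congr_ae (.of_forall fun ω => integral_congr_ae ?_)
  filter_upwards [h] with x hx
  rw [hx]

end Coefficients

/-! ### Well-posedness of an abstract parabolic equation -/

section WellPosed

/-- An isometry applied to the time derivative transports the notion of weak derivative. -/
theorem isTimeDeriv_lpCongr_iff {X Y Z : Type*} [NormedAddCommGroup X] [NormedSpace ℝ X]
    [NormedAddCommGroup Y] [NormedSpace ℝ Y] [NormedAddCommGroup Z] [NormedSpace ℝ Z]
    {ι : X →L[ℝ] Y} {κ : X →L[ℝ] Z} (e : Y ≃ₗᵢ[ℝ] Z) (h : ∀ x, e (ι x) = κ x) {a b : ℝ}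
    (v : L2t X a b) (g : L2t Y a b) :
    IsTimeDeriv κ v (lpCongr e _ g) ↔ IsTimeDeriv ι v g := by
  have key : ∀ ψ : ℝ → ℝ,
      ((∫ t in Ioo a b, deriv ψ t • κ (v t)) = - ∫ t in Ioo a b, ψ t • lpCongr e _ g t) ↔
      ((∫ t in Ioo a b, deriv ψ t • ι (v t)) = - ∫ t in Ioo a b, ψ t • g t) := by
    intro ψ
    have e1 : ∫ t in Ioo a b, deriv ψ t • κ (v t) = e (∫ t in Ioo a b, deriv ψ t • ι (v t)) := by
      refine Eq.trans (integral_congr_ae (.of_forall fun t => ?_))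
        (e.toContinuousLinearEquiv.integral_comp_comm _)
      show _ = e (deriv ψ t • ι (v t))
      rw [map_smul, h]
    have e2 : ∫ t in Ioo a b, ψ t • lpCongr e _ g t = e (∫ t in Ioo a b, ψ t • g t) := by
      refine Eq.trans (integral_congr_ae ?_) (e.toContinuousLinearEquiv.integral_comp_comm _)
      filter_upwards [coeFn_lpCongr e g] with t ht
      show _ = e (ψ t • g t)
      rw [map_smul, ht]
    rw [e1, e2, ← map_neg, e.injective.eq_iff]
  exact forall₄_congr fun ψ _ _ _ => key ψ

theorem inner_lpCongr {V W : Type*} [NormedAddCommGroup V] [InnerProductSpace ℝ V]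
    [NormedAddCommGroup W] [NormedSpace ℝ W] (e : W ≃ₗᵢ[ℝ] V) {pair : W → V → ℝ}
    (hpair : ∀ g v, ⟪e g, v⟫_ℝ = pair g v) {a b : ℝ} (g : L2t W a b) (φ : L2t V a b) :
    ⟪lpCongr e _ g, φ⟫_ℝ = ∫ t in Ioo a b, pair (g t) (φ t) := by
  rw [L2.inner_def]
  refine integral_congr_ae ?_
  filter_upwards [coeFn_lpCongr e g] with t ht
  rw [ht, hpair]

theorem ae_IccExtend_eq {V H : Type*} [TopologicalSpace H] {j : V → H} {a b : ℝ} (hab : a ≤ b)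
    {v : ℝ → V} {u : C(Icc a b, H)}
    (hu : ∀ᵐ t ∂volume.restrict (Ioo a b), ∀ ht : t ∈ Icc a b, u ⟨t, ht⟩ = j (v t)) :
    ∀ᵐ t ∂volume.restrict (Ioo a b), IccExtend hab u t = j (v t) := by
  filter_upwards [hu, ae_restrict_mem measurableSet_Ioo] with t ht hmem
  rw [IccExtend_of_mem hab u (Ioo_subset_Icc_self hmem), ht]

variable {V W H : Type*} [NormedAddCommGroup V] [InnerProductSpace ℝ V] [CompleteSpace V]
  [NormedAddCommGroup W] [NormedSpace ℝ W]
  [NormedAddCommGroup H] [InnerProductSpace ℝ H] [CompleteSpace H]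

/-- A pair `(y, ∂ₜ y)` solves `∂ₜ y + A₁ y + A₂ y - A₃ y = f`, `y(a) = y₀`. Here `W` plays the
role of the dual of `V`, through `pair`, and the forms enter only through their values. -/
def IsSolution (pair : W → V → ℝ) (F₁ F₂ F₃ : ℝ → V → V → ℝ) (j : V →L[ℝ] H) {a b : ℝ}
    (hab : a ≤ b) (y₀ : H) (f : L2t W a b) (y : L2t V a b) (g : L2t W a b) : Prop :=
  (∀ φ : L2t V a b,
    (∫ t in Ioo a b, pair (g t) (φ t)) + (∫ t in Ioo a b, F₁ t (y t) (φ t))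
      + (∫ t in Ioo a b, F₂ t (y t) (φ t)) - (∫ t in Ioo a b, F₃ t (y t) (φ t))
      = ∫ t in Ioo a b, pair (f t) (φ t)) ∧
  ∃ u : C(Icc a b, H), (∀ᵐ t ∂volume.restrict (Ioo a b), ∀ ht : t ∈ Icc a b,
    u ⟨t, ht⟩ = j (y t)) ∧ u ⟨a, left_mem_Icc.2 hab⟩ = y₀

/-- Well-posedness with explicit constants. The space `W` is carried over to `V` by the isometry
`e`, and `A₁`, `A₂`, `A₃` are bounded forms whose values agree with those of `F₁`, `F₂`, `F₃` at
almost all times. -/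
theorem exists_unique_isSolution {j : V →L[ℝ] H} {ι : V →L[ℝ] W} (e : W ≃ₗᵢ[ℝ] V)
    (hι : ∀ x, e (ι x) = rieszIncl j x) (hj : DenseRange j) (hj1 : ∀ x, ‖j x‖ ≤ ‖x‖)
    {pair : W → V → ℝ} (hpair : ∀ g v, ⟪e g, v⟫_ℝ = pair g v)
    {a b M₁ M₂ M₃ α lam : ℝ} (hab : a < b)
    {A₁ A₂ A₃ : ℝ → V →L[ℝ] V →L[ℝ] ℝ} {F₁ F₂ F₃ : ℝ → V → V → ℝ}
    (f₁ : ∀ᵐ t ∂volume.restrict (Ioo a b), ∀ x y, A₁ t x y = F₁ t x y)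
    (f₂ : ∀ᵐ t ∂volume.restrict (Ioo a b), ∀ x y, A₂ t x y = F₂ t x y)
    (f₃ : ∀ᵐ t ∂volume.restrict (Ioo a b), ∀ x y, A₃ t x y = F₃ t x y)
    (m₁ : ∀ x y, AEStronglyMeasurable (fun t => A₁ t x y) (volume.restrict (Ioo a b)))
    (m₂ : ∀ x y, AEStronglyMeasurable (fun t => A₂ t x y) (volume.restrict (Ioo a b)))
    (m₃ : ∀ x y, AEStronglyMeasurable (fun t => A₃ t x y) (volume.restrict (Ioo a b)))
    (hM₁ : 0 ≤ M₁) (hM₂ : 0 ≤ M₂) (hM₃ : 0 ≤ M₃)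
    (b₁ : ∀ᵐ t ∂volume.restrict (Ioo a b), ∀ x y, ‖A₁ t x y‖ ≤ M₁ * ‖x‖ * ‖y‖)
    (b₂ : ∀ᵐ t ∂volume.restrict (Ioo a b), ∀ x y, ‖A₂ t x y‖ ≤ M₂ * ‖x‖ * ‖y‖)
    (b₃ : ∀ᵐ t ∂volume.restrict (Ioo a b), ∀ x y, ‖A₃ t x y‖ ≤ M₃ * ‖x‖ * ‖y‖)
    (hα : 0 < α) (hlam : 0 ≤ lam)
    (hG : ∀ᵐ t ∂volume.restrict (Ioo a b), ∀ v,
      α * ‖v‖ ^ 2 ≤ A₁ t v v + A₂ t v v - A₃ t v v + lam * ‖j v‖ ^ 2)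
    (y₀ : H) (f : L2t W a b) :
    ∃ y : timeSobolev ι a b, IsSolution pair F₁ F₂ F₃ j hab.le y₀ f y.1.fst y.1.snd ∧
      (∀ z : timeSobolev ι a b,
        IsSolution pair F₁ F₂ F₃ j hab.le y₀ f z.1.fst z.1.snd → z = y) ∧
      (∃ u : C(Icc a b, H), (∀ᵐ t ∂volume.restrict (Ioo a b), ∀ ht : t ∈ Icc a b,
          u ⟨t, ht⟩ = j (y.1.fst t)) ∧
        ‖u‖ ^ 2 + ‖y‖ ^ 2 ≤
          energyConst (M₁ + M₂ + M₃) α lam (b - a) * (‖y₀‖ ^ 2 + ‖f‖ ^ 2)) ∧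
      ‖y₀‖ ^ 2 ≤ ((b - a)⁻¹ + 1 + 2 * (M₁ + M₂ + M₃)) * ‖y.1.fst‖ ^ 2 + ‖f‖ ^ 2 := by
  have h := IsGardingFamily.of_add_sub (j := j) m₁ m₂ m₃ hM₁ hM₂ hM₃ b₁ b₂ b₃ hα hlam hG
  have hform : ∀ y φ : L2t V a b, h.form y φ = (∫ t in Ioo a b, F₁ t (y t) (φ t))
      + (∫ t in Ioo a b, F₂ t (y t) (φ t)) - ∫ t in Ioo a b, F₃ t (y t) (φ t) := by
    intro y φ
    rw [IsGardingFamily.form_add_sub m₁ m₂ m₃ b₁ b₂ b₃ hM₁ hM₂ hM₃ h]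
    rw [integral_congr_ae (f₁.mono fun t ht => ht (y t) (φ t)),
      integral_congr_ae (f₂.mono fun t ht => ht (y t) (φ t)),
      integral_congr_ae (f₃.mono fun t ht => ht (y t) (φ t))]
  set E : L2t W a b ≃ₗᵢ[ℝ] L2t V a b := lpCongr e _ with hE
  have hsolves : ∀ (y : L2t V a b) (g : L2t W a b), h.Solves y (E g) (E f) ↔ ∀ φ : L2t V a b,
      (∫ t in Ioo a b, pair (g t) (φ t)) + (∫ t in Ioo a b, F₁ t (y t) (φ t))
        + (∫ t in Ioo a b, F₂ t (y t) (φ t)) - (∫ t in Ioo a b, F₃ t (y t) (φ t))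
        = ∫ t in Ioo a b, pair (f t) (φ t) := by
    intro y g
    refine forall_congr' fun φ => ?_
    rw [hform, inner_lpCongr e hpair, inner_lpCongr e hpair, ← add_sub_assoc, ← add_assoc]
  have hderiv := isTimeDeriv_lpCongr_iff e hι (a := a) (b := b)
  obtain ⟨y, g, hd, hs, u, hu, huy, hu0⟩ := h.exists_solution hj hab (E f) y₀
  have hg : E (E.symm g) = g := E.apply_symm_apply g
  have hd' : IsTimeDeriv ι y (E.symm g) := by
    rw [← hderiv]
    exact hg.symm ▸ hd
  let Y : timeSobolev ι a b := ⟨WithLp.toLp 2 (y, E.symm g), hd'⟩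
  let U : C(Icc a b, H) := ⟨(Icc a b).domRestrict u, hu.domRestrict⟩
  have hU : ∀ᵐ t ∂volume.restrict (Ioo a b), ∀ ht : t ∈ Icc a b, U ⟨t, ht⟩ = j (Y.1.fst t) :=
    huy.mono fun t ht _ => ht
  have hY : IsSolution pair F₁ F₂ F₃ j hab.le y₀ f Y.1.fst Y.1.snd :=
    ⟨(hsolves y (E.symm g)).1 (by rwa [hg]), U, hU, hu0⟩
  refine ⟨Y, hY, fun z hz => ?_, ⟨U, hU, ?_⟩, ?_⟩
  · -- the difference of two solutions solves the homogeneous problem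
    obtain ⟨hz1, uz, hz2, hz3⟩ := hz
    have hzs := (hsolves _ _).2 hz1
    have hds : h.Solves (z.1.fst - y) (E z.1.snd - g) 0 := fun φ => by
      have e1 := hzs φ
      have e2 := hs φ
      rw [map_sub, inner_sub_left, inner_zero_left, sub_apply]
      linarith
    have hdd : IsTimeDeriv (rieszIncl j) (z.1.fst - y) (E z.1.snd - g) := by
      have h1 : IsTimeDeriv ι (z.1.fst - y) (z.1.snd - E.symm g) := (z - Y).2
      rw [← hderiv] at h1
      have h2 : E (z.1.snd - E.symm g) = E z.1.snd - g := by rw [map_sub, hg]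
      exact h2 ▸ h1
    have hle := hds.energy_le hj hab hdd
      (u := fun t => IccExtend hab.le uz t - u t)
      ((uz.continuous.Icc_extend' (h := hab.le)).continuousOn.sub hu) (by
        filter_upwards [ae_IccExtend_eq hab.le hz2, huy, Lp.coeFn_sub z.1.fst y] with t h1 h2 h3
        rw [h1, h2, h3, Pi.sub_apply, map_sub]) (left_mem_Icc.2 hab.le)
    have h0 : IccExtend hab.le uz a - u a = 0 := by
      rw [IccExtend_of_mem hab.le uz (left_mem_Icc.2 hab.le), hz3, hu0, sub_self]
    rw [h0, norm_zero, norm_zero] at hle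
    have k1 : ‖z.1.fst - y‖ = 0 := by
      have := sq_nonneg ‖E z.1.snd - g‖
      have := sq_nonneg ‖z.1.fst - y‖
      exact pow_eq_zero_iff two_ne_zero |>.1 (by nlinarith)
    have k2 : ‖E z.1.snd - g‖ = 0 := by
      have := sq_nonneg ‖E z.1.snd - g‖
      have := sq_nonneg ‖z.1.fst - y‖
      exact pow_eq_zero_iff two_ne_zero |>.1 (by nlinarith)
    have k3 : z.1.fst = y := sub_eq_zero.1 (norm_eq_zero.1 k1)
    have k4 : z.1.snd = E.symm g := by
      rw [← sub_eq_zero.1 (norm_eq_zero.1 k2), E.symm_apply_apply]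
    refine Subtype.ext (WithLp.ofLp_injective 2 (Prod.ext k3 k4))
  · have hen : ∀ t ∈ Icc a b, ‖u t‖ ^ 2 + (‖y‖ ^ 2 + ‖g‖ ^ 2) ≤
        energyConst (M₁ + M₂ + M₃) α lam (b - a) * (‖y₀‖ ^ 2 + ‖f‖ ^ 2) := fun t ht => by
      have := hs.energy_le hj hab hd hu huy ht
      rwa [hu0, E.norm_map] at this
    have hYn : ‖Y‖ ^ 2 = ‖y‖ ^ 2 + ‖g‖ ^ 2 := by
      have h1 : ‖Y‖ ^ 2 = ‖y‖ ^ 2 + ‖E.symm g‖ ^ 2 := WithLp.prod_norm_sq_eq_of_L2 Y.1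
      rw [h1, E.symm.norm_map]
    rw [hYn]
    set R := energyConst (M₁ + M₂ + M₃) α lam (b - a) * (‖y₀‖ ^ 2 + ‖f‖ ^ 2) with hR
    have hR0 : 0 ≤ R - (‖y‖ ^ 2 + ‖g‖ ^ 2) := by
      have := hen a (left_mem_Icc.2 hab.le)
      linarith [sq_nonneg ‖u a‖]
    have hUn : ‖U‖ ≤ √(R - (‖y‖ ^ 2 + ‖g‖ ^ 2)) := by
      refine (ContinuousMap.norm_le _ (Real.sqrt_nonneg _)).2 fun t => Real.le_sqrt_of_sq_le ?_
      have := hen t t.2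
      show ‖u t‖ ^ 2 ≤ _
      linarith
    have := pow_le_pow_left₀ (norm_nonneg U) hUn 2
    rw [Real.sq_sqrt hR0] at this
    linarith
  · have := hs.norm_initial_sq_le hj hj1 hab hd hu huy
    rwa [hu0, E.norm_map] at this

end WellPosed

/-! ### The Riesz isomorphism between `V'_P` and `V_P` -/

section RieszP

variable {n : ℕ} (D : Set (Eu n)) {Ω : Type*} [MeasurableSpace Ω] (P : Measure Ω)

/-- The isometry `V'_P ≃ V_P` given by the Riesz isomorphism of `V` at almost every `ω`. -/
def rieszP : VPdual D P ≃ₗᵢ[ℝ] VP D P := lpCongr (rieszEquiv (VD D)) P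

variable {D P}

theorem inner_rieszP (g : VPdual D P) (v : VP D P) : ⟪rieszP D P g, v⟫_ℝ = pairing g v := by
  rw [L2.inner_def]
  refine integral_congr_ae ?_
  filter_upwards [coeFn_lpCongr (rieszEquiv (VD D)) g] with ω hω
  exact (congrArg (fun z => ⟪z, v ω⟫_ℝ) hω).trans (inner_rieszEquiv _ _)

theorem rieszP_toDualP (v : VP D P) : rieszP D P (toDualP D P v) = rieszIncl (toHP D P) v := by
  refine ext_inner_right ℝ fun w => ?_
  rw [inner_rieszP, inner_rieszIncl, L2.inner_def]
  refine integral_congr_ae ?_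
  have h0 : ∀ᵐ ω ∂P, toDualP D P v ω = toDual D (v ω) := ContinuousLinearMap.coeFn_compLpL _ _
  filter_upwards [h0, (toH D).coeFn_compLpL v,
    (toH D).coeFn_compLpL w] with ω h1 h2 h3
  refine (congrArg (fun z : VDdual D => z (w ω)) h1).trans ?_
  exact (congrArg₂ (fun z z' : HD D => ⟪z, z'⟫_ℝ) h2 h3).symm

-- sealed: only the characterizations above are used, and unfolding would slow unification
attribute [irreducible] rieszP

end RieszP

/-! ### Well-posedness of the random parabolic equation -/

section Main

variable {n : ℕ}

theorem isOpen_box (lo hi : Fin n → ℝ) : IsOpen (box lo hi) := by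
  have : box lo hi = ⋂ i, {x : Eu n | x i ∈ Ioo (lo i) (hi i)} := by
    ext x; simp [box]
  rw [this]
  exact isOpen_iInter_of_finite fun i => isOpen_Ioo.preimage (by fun_prop)

theorem volume_box_ne_top (lo hi : Fin n → ℝ) : volume (box lo hi) ≠ ∞ := by
  have h : box lo hi =
      WithLp.ofLp ⁻¹' (univ.pi fun i => Ioo (lo i) (hi i)) := by
    ext x; simp [box]
  rw [h, (PiLp.volume_preserving_ofLp (Fin n)).measure_preimage
    (MeasurableSet.univ_pi fun i => measurableSet_Ioo).nullMeasurableSet, Real.volume_pi_Ioo]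
  exact ENNReal.prod_ne_top fun _ _ => ENNReal.ofReal_ne_top

theorem norm_toHP_le {D : Set (Eu n)} {Ω : Type*} [MeasurableSpace Ω] {P : Measure Ω}
    (v : VP D P) : ‖toHP D P v‖ ≤ ‖v‖ := by
  refine Lp.norm_le_norm_of_ae_le ?_
  filter_upwards [(toH D).coeFn_compLpL v] with ω h
  exact (congrArg norm h).trans_le (norm_toH_le _)

theorem denseRange_toHP {D : Set (Eu n)} (hD : IsOpen D) {Ω : Type*} [MeasurableSpace Ω]
    (P : Measure Ω) : DenseRange (toHP D P) :=
  denseRange_compLpL P (denseRange_toH hD)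

/-- Well-posedness of the random parabolic equation on an open set that admits a reaction bound,
with explicit constants: the operator is bounded by `max νlo νhi + 2 C ‖a‖ + ‖b‖`. -/
theorem exists_unique_isWeakSolution {D : Set (Eu n)} (hD : IsOpen D)
    {Ω : Type*} [MeasurableSpace Ω] {P : Measure Ω} [IsProbabilityMeasure P]
    {r : ℝ≥0∞} [Fact (1 ≤ r)] {C : ℝ} (hC : IsReactionBound D r C) {νlo νhi : ℝ}
    {ν : Ω → Eu n → ℝ} (hν : IsUniformDiffusion D P νlo νhi ν) (a : ReactionSpace D r)
    (b : ConvectionSpace D) {t₀ T : ℝ} (ht₀ : 0 ≤ t₀) (hT : 0 < T) (y₀ : HP D P)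
    (f : L2t (VPdual D P) t₀ (t₀ + T)) :
    ∃ y : WP D P t₀ (t₀ + T), IsWeakSolution ν a b t₀ T hT y₀ f y ∧
      (∀ z : WP D P t₀ (t₀ + T), IsWeakSolution ν a b t₀ T hT y₀ f z → z = y) ∧
      (∃ u : C(Icc t₀ (t₀ + T), HP D P), IsContRep y.1.fst u ∧
        ‖u‖ ^ 2 + ‖y‖ ^ 2 ≤ energyConst (max νlo νhi + 2 * C * ‖a‖ + ‖b‖) (νlo / 2)
          (νlo / 2 + (2 * C * ‖a‖ + ‖b‖) ^ 2 / (2 * νlo)) T * (‖y₀‖ ^ 2 + ‖f‖ ^ 2)) ∧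
      ‖y₀‖ ^ 2 ≤ (T⁻¹ + 1 + 2 * (max νlo νhi + 2 * C * ‖a‖ + ‖b‖)) * ‖y.1.fst‖ ^ 2
        + ‖f‖ ^ 2 := by
  obtain ⟨c, hcm, hcl, hcK, hcν⟩ := hν.exists_rep
  have hK0 : 0 ≤ max νlo νhi := hν.pos.le.trans (le_max_left _ _)
  have hC0 := hC.nonneg
  have hpos := hν.pos
  have hac : (volume.restrict (Ioo t₀ (t₀ + T))) ≤ volume.restrict (Ioi (0 : ℝ)) :=
    Measure.restrict_mono (fun t ht => lt_of_le_of_lt ht₀ ht.1) le_rfl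
  have ha : ∀ᵐ t ∂volume.restrict (Ioo t₀ (t₀ + T)), ‖a t‖ ≤ ‖a‖ :=
    ae_mono hac (ae_norm_le_norm_top a)
  have hb' : ∀ᵐ t ∂volume.restrict (Ioo t₀ (t₀ + T)), ∀ᵐ x ∂volume.restrict D,
      boundedRep b (t, x) = b (t, x) := ae_mono hac (boundedRep_ae_eq b)
  have hb := stronglyMeasurable_boundedRep b
  have key := exists_unique_isSolution (V := VP D P) (W := VPdual D P) (H := HP D P)
    (j := toHP D P) (ι := toDualP D P) (rieszP D P) (by exact rieszP_toDualP)
    (by exact denseRange_toHP hD P) (by exact norm_toHP_le) (pair := pairing)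
    (by exact inner_rieszP)
    (a := t₀) (b := t₀ + T) (M₁ := max νlo νhi) (M₂ := 2 * C * ‖a‖) (M₃ := ‖b‖)
    (α := νlo / 2) (lam := νlo / 2 + (2 * C * ‖a‖ + ‖b‖) ^ 2 / (2 * νlo))
    (lt_add_of_pos_right t₀ hT)
    (A₁ := fun _ => diffusionP D P hcm hK0 hcK) (A₂ := fun t => hC.formP P (a t))
    (A₃ := fun t => convectionP D P (hb.comp_measurable measurable_prodMk_left :
      StronglyMeasurable fun x => boundedRep b (t, x)) (norm_nonneg b)
      (fun x => norm_boundedRep_le b (t, x)))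
    (F₁ := fun _ => diffusionForm ν) (F₂ := fun t => reactionForm (a t))
    (F₃ := fun t => convectionForm (fun x => b (t, x)))
    (by exact .of_forall fun t x y =>
          (diffusionP_apply hcm hK0 hcK x y).trans (diffusionForm_congr hcν x y))
    (by exact .of_forall fun t x y => hC.formP_apply (a t) x y)
    (by exact hb'.mono fun t ht x y =>
          (convectionP_apply _ _ _ x y).trans (convectionForm_congr ht x y))
    (fun x y => aestronglyMeasurable_const (b := diffusionP D P hcm hK0 hcK x y))
    (by exact fun x y => hC.aestronglyMeasurable_formP_apply (Lp.stronglyMeasurable a) x y)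
    (by exact fun x y => aestronglyMeasurable_convectionP_apply hb (norm_nonneg b)
          (norm_boundedRep_le b) x y)
    hK0 (by positivity) (norm_nonneg b)
    (by exact .of_forall fun _ x y => norm_diffusionP_apply_le hcm hK0 hcK x y)
    (by exact ha.mono fun t ht x y => (hC.norm_formP_apply_le (a t) x y).trans (by gcongr))
    (by exact .of_forall fun _ x y => norm_convectionP_apply_le _ _ _ x y)
    (by positivity) (by positivity)
    (by exact ha.mono fun t ht v =>
          garding_VP hC hcm hK0 hcK hν.pos hcl ht _ (norm_nonneg b) _ v)
    y₀ f
  rw [add_sub_cancel_left] at key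
  exact key

end Main

end RandomParabolic

end

theorem mainTheorem4 {n : ℕ} (hn : 1 ≤ n) (lo hi : Fin n → ℝ) (hbox : ∀ i, lo i < hi i)
    (νlo νhi : ℝ) (T : ℝ) (hT : 0 < T) :
    ∃ c₂ : ℝ, 0 < c₂ ∧
      ∀ (r : ℝ≥0∞) [Fact (1 ≤ r)], (n : ℝ≥0∞) ≤ r →
      ∀ (a : RandomParabolic.ReactionSpace (RandomParabolic.box lo hi) r)
        (b : RandomParabolic.ConvectionSpace (RandomParabolic.box lo hi)),
      ∃ c₁ : ℝ, 0 < c₁ ∧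
        ∀ (Ω : Type*) [MeasurableSpace Ω] (P : Measure Ω) [IsProbabilityMeasure P]
          [TopologicalSpace.SeparableSpace (Lp ℝ 2 P)] (ν : Ω → RandomParabolic.Eu n → ℝ),
          RandomParabolic.IsUniformDiffusion (RandomParabolic.box lo hi) P νlo νhi ν →
        ∀ (t₀ : ℝ), 0 ≤ t₀ →
        ∀ (y₀ : RandomParabolic.HP (RandomParabolic.box lo hi) P)
          (f : RandomParabolic.L2t
            (RandomParabolic.VPdual (RandomParabolic.box lo hi) P) t₀ (t₀ + T)),
        ∃ y : RandomParabolic.WP (RandomParabolic.box lo hi) P t₀ (t₀ + T),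
          RandomParabolic.IsWeakSolution ν a b t₀ T hT y₀ f y ∧
          (∀ z : RandomParabolic.WP (RandomParabolic.box lo hi) P t₀ (t₀ + T),
            RandomParabolic.IsWeakSolution ν a b t₀ T hT y₀ f z → z = y) ∧
          (∃ u : C(Icc t₀ (t₀ + T), RandomParabolic.HP (RandomParabolic.box lo hi) P),
            RandomParabolic.IsContRep y.1.fst u ∧
            ‖u‖ ^ 2 + ‖y‖ ^ 2 ≤ c₁ * (‖y₀‖ ^ 2 + ‖f‖ ^ 2)) ∧
          ‖y₀‖ ^ 2 ≤
            c₂ * (1 + T⁻¹ + RandomParabolic.coeffNorm a b) * ‖y.1.fst‖ ^ 2 + ‖f‖ ^ 2 := by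
  have hD := RandomParabolic.isOpen_box lo hi
  obtain ⟨C, hC⟩ := RandomParabolic.exists_isReactionBound hn
    (RandomParabolic.volume_box_ne_top lo hi)
  refine ⟨3 + 2 * |max νlo νhi| + 4 * |C|, by positivity, fun r _ hr a b => ?_⟩
  have hCr := hC r hr
  have hC0 := hCr.nonneg
  -- the constants have to be named before `ν`, whose bounds force `0 < νlo`
  by_cases hν0 : 0 < νlo
  · refine ⟨RandomParabolic.energyConst (max νlo νhi + 2 * C * ‖a‖ + ‖b‖) (νlo / 2)
      (νlo / 2 + (2 * C * ‖a‖ + ‖b‖) ^ 2 / (2 * νlo)) T,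
      RandomParabolic.energyConst_pos _ (by positivity) (by positivity) hT.le,
      fun Ω _ P _ _ ν hν t₀ ht₀ y₀ f => ?_⟩
    obtain ⟨y, hy, huniq, hu, hy₀⟩ :=
      RandomParabolic.exists_unique_isWeakSolution hD hCr hν a b ht₀ hT y₀ f
    refine ⟨y, hy, huniq, hu, hy₀.trans ?_⟩
    have hK : T⁻¹ + 1 + 2 * (max νlo νhi + 2 * C * ‖a‖ + ‖b‖) ≤
        (3 + 2 * |max νlo νhi| + 4 * |C|) * (1 + T⁻¹ + RandomParabolic.coeffNorm a b) := by
      have h1 := le_abs_self (max νlo νhi)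
      have h2 : 0 ≤ T⁻¹ := inv_nonneg.2 hT.le
      rw [abs_of_nonneg hC0, RandomParabolic.coeffNorm]
      generalize |max νlo νhi| = m at *
      have hm : 0 ≤ m := (hν0.le.trans (le_max_left _ _)).trans h1
      have h3 := norm_nonneg a
      have h4 := norm_nonneg b
      generalize ‖a‖ = p at *
      generalize ‖b‖ = q at *
      generalize T⁻¹ = s at *
      have e1 : 0 ≤ C * s := by positivity
      have e2 : 0 ≤ C * q := by positivity
      have e3 : 0 ≤ m * (s + p + q) := by positivity
      nlinarith
    gcongr
  · exact ⟨1, one_pos, fun Ω _ P _ _ ν hν => absurd hν.pos hν0⟩
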